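/- Work in $L^2(\mathbb R)$ with $\hbar=1$, position operator $\hat\chi$ (multiplication by $\chi$) and momentum operator $\hat p=-i\,d/d\chi$, and let $m,\omega>0$, $\hat a=\sqrt{\tfrac{m\omega}{2}}\,\hat\chi+\tfrac{i}{\sqrt{2m\omega}}\,\hat p$, $\hat a^\dagger=\sqrt{\tfrac{m\omega}{2}}\,\hat\chi-\tfrac{i}{\sqrt{2m\omega}}\,\hat p$. Polynomials in $\hat\chi,\hat p$ are taken as the closures of the corresponding operators on the Schwartz space, and $\exp B$ denotes the value at $t=1$ of the strongly continuous semigroup $e^{tB}$ generated by $B$. Let $\zeta=\eta e^{i\psi}$ with $\eta\ge 0$, $\psi\in\mathbb R$, let $\theta\in\mathbb R$, $\vartheta>0$, and put $$\hat S(\zeta)=\exp\bigl[\tfrac12\zeta^*\hat a^2-\tfrac12\zeta\hat a^{\dagger2}\bigr],\quad \hat R(\theta)=\exp\bigl[-i\theta(\hat a^\dagger\hat a+\tfrac12)\bigr],\quad \hat\rho_\vartheta=\frac{\exp[-\vartheta(\hat a^\dagger\hat a+\frac12)]}{\operatorname{Tr}\exp[-\vartheta(\hat a^\dagger\hat a+\frac12)]},$$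 $$\hat\rho=\hat S(\zeta)\hat R(\theta)\,\hat\rho_\vartheta\,\hat R^\dagger(\theta)\hat S^\dagger(\zeta)$$ (the squeezed thermal state). Put $\Xi=\coth\frac{\vartheta}{2}$, let $\varphi\in\mathbb R$ be given by $e^{2\varphi}=\Xi^2$, and let $$a=\tfrac{m\omega}{2}\Xi(\cosh2\eta+\sinh2\eta\cos\psi),\quad b=\tfrac{1}{2m\omega}\Xi(\cosh2\eta-\sinh2\eta\cos\psi),\quad c=-\tfrac{\Xi}{2}\sinh2\eta\sin\psi .$$ Then the following hold. 1. The exponentials defining $\hat S(\zeta)$, $\hat R(\theta)$, $\hat\rho_\vartheta$ and the exponential in (3) exist and are unique, and $\exp[-\vartheta(\hat a^\dagger\hat a+\frac12)]$ is of trace class with trace $\tfrac12\sqrt{e^{2\varphi}-1}$. 2. $a,b,c$ are the covariance matrix elements of the state: $a=\langle\hat p^2\rangle$, $b=\langle\hat\chi^2\rangle$, $c=\tfrac12\langle\{\hat\chi,\hat p\}\rangle$, where $\langle B\rangle=\operatorname{Tr}(B\hat\rho)$ with $B\hat\rho$ everywhere defined and of trace class; and $e^{2\varphi}=4(ab-c^2)$.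 3. (Operator form) $$\hat\rho=\frac{2}{\sqrt{e^{2\varphi}-1}}\exp\Bigl\{-e^{-\varphi}\cosh^{-1}(\coth\varphi)\bigl[a\hat\chi^2+b\hat p^2-c\{\hat\chi,\hat p\}\bigr]\Bigr\}.$$ 4. (Position matrix elements) $\hat\rho$ is the integral operator with kernel $$\langle\chi|\hat\rho|\chi'\rangle=\frac{1}{\sqrt{2\pi b}}\exp\Bigl[-\frac{ab-(c+\frac i2)^2}{2b}\chi^2+\frac{ab-c^2-\frac14}{b}\chi\chi'-\frac{ab-(c-\frac i2)^2}{2b}\chi'^2\Bigr],$$ equivalently, with $\Sigma=(\chi+\chi')/2$ and $\Delta=\chi-\chi'$, $$\langle\chi|\hat\rho|\chi'\rangle=\frac{1}{\sqrt{2\pi b}}\exp\Bigl[-\frac{\Sigma^2}{2b}+i\frac cb\,\Sigma\Delta-\frac{ab-c^2}{2b}\Delta^2\Bigr].$$ -/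

import Mathlib

open MeasureTheory Filter Topology
open scoped SchwartzMap ENNReal

noncomputable section

namespace SqueezedThermal

/-! ## Operators on `L²(ℝ)` and exponentials of unbounded operators -/

/-- The Hilbert space `L²(ℝ, ℂ)` of the position representation. -/
abbrev StateSpace : Type := Lp ℂ 2 (volume : Measure ℝ)

/-- Operators on the Schwartz space, the common invariant domain of all polynomials in the
canonical operators; multiplication is composition. Such an operator is regarded as a densely
defined operator in `L²(ℝ)`. -/
abbrev SchwartzOp : Type := 𝓢(ℝ, ℂ) →L[ℂ] 𝓢(ℝ, ℂ)

/-- The graph, in `L²(ℝ) × L²(ℝ)`, of the closure of the operator `B` with domain the Schwartz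
space. -/
def closureGraph (B : SchwartzOp) : Set (StateSpace × StateSpace) :=
  closure (Set.range fun f : 𝓢(ℝ, ℂ) => (f.toLp 2 volume, (B f).toLp 2 volume))

/-- `U t`, `t ≥ 0`, is a strongly continuous one-parameter semigroup of bounded operators
(the values at negative times are irrelevant). -/
structure IsC0Semigroup (U : ℝ → StateSpace →L[ℂ] StateSpace) : Prop where
  zero : U 0 = 1
  add : ∀ s t : ℝ, 0 ≤ s → 0 ≤ t → U (s + t) = U s * U t
  continuousOn : ∀ f : StateSpace, ContinuousOn (fun t => U t f) (Set.Ici 0)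

/-- The graph of the infinitesimal generator of the semigroup `U`. -/
def generatorGraph (U : ℝ → StateSpace →L[ℂ] StateSpace) : Set (StateSpace × StateSpace) :=
  {q | Tendsto (fun t : ℝ => ((t⁻¹ : ℝ) : ℂ) • (U t q.1 - q.1)) (𝓝[>] 0) (𝓝 q.2)}

/-- `T = exp B`: the closure of `B` generates a strongly continuous semigroup `exp (t B)`, and
`T` is its value at time `1`. -/
def IsExp (B : SchwartzOp) (T : StateSpace →L[ℂ] StateSpace) : Prop :=
  ∃ U : ℝ → StateSpace →L[ℂ] StateSpace,
    IsC0Semigroup U ∧ generatorGraph U = closureGraph B ∧ U 1 = T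

/-- `exp B` exists and is unique. -/
def HasExp (B : SchwartzOp) : Prop := ∃! T : StateSpace →L[ℂ] StateSpace, IsExp B T

open Classical in
/-- The operator exponential `exp B` (zero if the closure of `B` is not a generator). -/
def opExp (B : SchwartzOp) : StateSpace →L[ℂ] StateSpace :=
  if h : ∃ T, IsExp B T then h.choose else 0

/-- `T` is of trace class with trace `τ`: the diagonal sum in every orthonormal basis converges
(unconditionally) to `τ`. -/
def HasTrace (T : StateSpace →L[ℂ] StateSpace) (τ : ℂ) : Prop :=
  ∀ (ι : Type) (e : HilbertBasis ι ℂ StateSpace), HasSum (fun i => inner ℂ (e i) (T (e i))) τ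

open Classical in
/-- The trace (zero for an operator which is not of trace class). -/
def opTrace (T : StateSpace →L[ℂ] StateSpace) : ℂ :=
  if h : ∃ τ, HasTrace T τ then h.choose else 0

/-- `⟨B⟩ = Tr (B ρ) = τ` for a possibly unbounded observable `B`: the product of the closure
of `B` with `ρ` is an everywhere defined trace class operator with trace `τ`. -/
def HasExpectation (ρ : StateSpace →L[ℂ] StateSpace) (B : SchwartzOp) (τ : ℂ) : Prop :=
  ∃ T : StateSpace →L[ℂ] StateSpace, (∀ f, (ρ f, T f) ∈ closureGraph B) ∧ HasTrace T τ

/-- `⟨x|T|y⟩ = k x y`: `T` is the integral operator with kernel `k`. -/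
def HasKernel (T : StateSpace →L[ℂ] StateSpace) (k : ℝ → ℝ → ℂ) : Prop :=
  ∀ f : StateSpace, ∀ᵐ x : ℝ, Integrable (fun y => k x y * f y) ∧ T f x = ∫ y, k x y * f y

/-! ## Canonical operators -/

/-- The position operator, multiplication by `x`. -/
def position : SchwartzOp := SchwartzMap.smulLeftCLM ℂ (fun x : ℝ => (x : ℂ))

/-- The momentum operator `-i d/dx`. -/
def momentum : SchwartzOp := (-Complex.I) • SchwartzMap.derivCLM ℂ ℂ

theorem position_apply (f : 𝓢(ℝ, ℂ)) (x : ℝ) : position f x = (x : ℂ) * f x := by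
  have h : (fun x : ℝ => (x : ℂ)).HasTemperateGrowth :=
    Complex.ofRealCLM.hasTemperateGrowth
  simp [position, SchwartzMap.smulLeftCLM_apply_apply h]

theorem momentum_apply (f : 𝓢(ℝ, ℂ)) (x : ℝ) : momentum f x = -Complex.I * deriv f x := by
  simp [momentum]

/-- The anticommutator `{A, B} = A B + B A`. -/
def anticomm (A B : SchwartzOp) : SchwartzOp := A * B + B * A

/-- The annihilation operator of an oscillator of mass `m` and frequency `ω`. -/
def annihilation (m ω : ℝ) : SchwartzOp :=
  ((√(m * ω / 2) : ℝ) : ℂ) • position + (Complex.I * ((1 / √(2 * m * ω) : ℝ) : ℂ)) • momentum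

/-- The creation operator of an oscillator of mass `m` and frequency `ω`. -/
def creation (m ω : ℝ) : SchwartzOp :=
  ((√(m * ω / 2) : ℝ) : ℂ) • position - (Complex.I * ((1 / √(2 * m * ω) : ℝ) : ℂ)) • momentum

theorem sqrt_two_mul (m ω : ℝ) : √(2 * m * ω) = 2 * √(m * ω / 2) := by
  have h : 2 * m * ω = 2 ^ 2 * (m * ω / 2) := by ring
  rw [h, Real.sqrt_mul (by norm_num), Real.sqrt_sq (by norm_num)]

theorem position_eq {m ω : ℝ} (hm : 0 < m) (hω : 0 < ω) :
    position = ((1 / √(2 * m * ω) : ℝ) : ℂ) • (creation m ω + annihilation m ω) := by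
  have h0 : ((√(m * ω / 2) : ℝ) : ℂ) ≠ 0 := by
    exact_mod_cast (Real.sqrt_pos.2 (by positivity)).ne'
  rw [creation, annihilation, sqrt_two_mul]
  push_cast
  match_scalars <;> field_simp <;> norm_num

theorem momentum_eq {m ω : ℝ} (hm : 0 < m) (hω : 0 < ω) :
    momentum = (Complex.I * ((√(m * ω / 2) : ℝ) : ℂ)) • (creation m ω - annihilation m ω) := by
  have h0 : ((√(m * ω / 2) : ℝ) : ℂ) ≠ 0 := by
    exact_mod_cast (Real.sqrt_pos.2 (by positivity)).ne'
  rw [creation, annihilation, sqrt_two_mul]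
  push_cast
  match_scalars
  · field_simp
    norm_num
  · ring

/-- The shifted number operator `a† a + 1/2`. -/
def number (m ω : ℝ) : SchwartzOp := creation m ω * annihilation m ω + (1 / 2 : ℂ) • 1

/-! ## The squeezed thermal state -/

/-- The exponent `(ζ* a² - ζ a†²)/2` of the squeeze operator. -/
def squeezeExponent (m ω : ℝ) (ζ : ℂ) : SchwartzOp :=
  (1 / 2 * (starRingEnd ℂ) ζ) • annihilation m ω ^ 2 - (1 / 2 * ζ) • creation m ω ^ 2

/-- The exponent `-iθ (a† a + 1/2)` of the rotation operator. -/
def rotationExponent (m ω θ : ℝ) : SchwartzOp := (-Complex.I * (θ : ℂ)) • number m ω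

/-- The exponent `-ϑ (a† a + 1/2)` of the thermal state. -/
def thermalExponent (m ω ϑ : ℝ) : SchwartzOp := (-(ϑ : ℂ)) • number m ω

/-- The squeeze operator `S(ζ)`. -/
def squeeze (m ω : ℝ) (ζ : ℂ) : StateSpace →L[ℂ] StateSpace := opExp (squeezeExponent m ω ζ)

/-- The rotation operator `R(θ)`. -/
def rotation (m ω θ : ℝ) : StateSpace →L[ℂ] StateSpace := opExp (rotationExponent m ω θ)

/-- The partition function `Z_ϑ = Tr exp (-ϑ (a† a + 1/2))`. -/
def partitionFunction (m ω ϑ : ℝ) : ℂ := opTrace (opExp (thermalExponent m ω ϑ))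

/-- The thermal state `ρ_ϑ = exp (-ϑ (a† a + 1/2)) / Z_ϑ`. -/
def thermalState (m ω ϑ : ℝ) : StateSpace →L[ℂ] StateSpace :=
  (partitionFunction m ω ϑ)⁻¹ • opExp (thermalExponent m ω ϑ)

/-- The squeezed thermal state `S(ζ) R(θ) ρ_ϑ R(θ)† S(ζ)†`. -/
def squeezedThermalState (m ω : ℝ) (ζ : ℂ) (θ ϑ : ℝ) : StateSpace →L[ℂ] StateSpace :=
  squeeze m ω ζ * rotation m ω θ * thermalState m ω ϑ *
    ContinuousLinearMap.adjoint (rotation m ω θ) * ContinuousLinearMap.adjoint (squeeze m ω ζ)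

/-- The quadratic operator `a χ² + b p² - c {χ, p}`. -/
def quadraticOp (a b c : ℝ) : SchwartzOp :=
  (a : ℂ) • position ^ 2 + (b : ℂ) • momentum ^ 2 - (c : ℂ) • anticomm position momentum

/-- The hyperbolic cotangent. -/
def coth (x : ℝ) : ℝ := Real.cosh x / Real.sinh x

/-- The exponent `-e^{-φ} arcosh (coth φ) [a χ² + b p² - c {χ, p}]`. -/
def gaussianExponent (a b c φ : ℝ) : SchwartzOp :=
  -(((Real.exp (-φ) * Real.arcosh (coth φ) : ℝ) : ℂ) • quadraticOp a b c)

end SqueezedThermal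

end

noncomputable section
namespace SqueezedThermal

/-! ## Contraction semigroups and their generators -/

/-! Everything is reduced to an explicit eigenbasis. The unitaries used here map the Schwartz space
onto itself and act on (χ, p) by a 2×2 matrix of determinant one (`Implements`); chirps, dilations
and the Fourier transform supply enough of them. The squeeze exponent is V G V⁻¹, where G = η(x d/dx
+ 1/2) generates the explicit dilation group and V is such a unitary (`exists_implements_rotation`,
`exists_squeeze`). Hence S(ζ) is again of this kind, with a known matrix (α, β; γ, δ). The number
operator is diagonal in the Hermite functions h_n, so exp(z(a†a + 1/2)) with Re z ≤ 0 is the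
diagonal operator with entries exp(z(n + 1/2)) (`contractionExp_number`). R(θ) is diagonal in the
same basis and cancels, leaving ρ = 2 sinh(ϑ/2) S exp(-ϑ(a†a + 1/2)) S⁻¹
(`squeezedThermalState_eq`), with eigenvectors S h_n and eigenvalues 2 sinh(ϑ/2) exp(-ϑ(n + 1/2)).

All claims follow from this form. Conjugation by S turns the thermal exponent into the quadratic
form of (3), because arcosh(coth φ) = ϑ (`gaussianExponent_eq`, `arcosh_coth`). For the covariances,
S⁻¹BS is again quadratic, and only its component along the number operator has diagonal entries in
the h_n (`hasExpectation_transformedThermal`). For the kernel, the Gaussian integral operator maps S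
h_0 to a multiple of itself and intertwines S a† S⁻¹ with e^{-ϑ} times itself, so by induction it
has the same eigenvectors and, after normalisation, the same eigenvalues as ρ
(`integral_gaussianKernel_hermite`, `hasKernel_of_basis`).

Existence and uniqueness of the exponentials concern the closure of an operator on the Schwartz
space. All semigroups involved are contractions. A contraction semigroup with the right derivative
on a core D is generated by the closure of B once (1 - B)D is dense (`ContractionExp.of_core`), and
no other semigroup has that generator (`ContractionExp.semigroup_unique`). -/

/-- The embedding of the Schwartz space into `L²(ℝ)`. -/
def ket : 𝓢(ℝ, ℂ) →L[ℂ] StateSpace := SchwartzMap.toLpCLM ℂ ℂ 2 volume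

theorem ket_apply (f : 𝓢(ℝ, ℂ)) : ket f = f.toLp 2 volume := rfl

theorem denseRange_ket : DenseRange ket :=
  SchwartzMap.denseRange_toLpCLM ENNReal.ofNat_ne_top

theorem ket_injective : Function.Injective ket := SchwartzMap.injective_toLp 2 volume

theorem closureGraph_eq (B : SchwartzOp) :
    closureGraph B = closure (Set.range fun f => (ket f, ket (B f))) := rfl

theorem mem_closureGraph (B : SchwartzOp) (f : 𝓢(ℝ, ℂ)) : (ket f, ket (B f)) ∈ closureGraph B :=
  subset_closure ⟨f, rfl⟩

theorem mem_generatorGraph {U : ℝ → StateSpace →L[ℂ] StateSpace} {q : StateSpace × StateSpace} :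
    q ∈ generatorGraph U ↔
      Tendsto (fun t : ℝ => t⁻¹ • (U t q.1 - q.1)) (𝓝[>] 0) (𝓝 q.2) := by
  have h (t : ℝ) (x : StateSpace) : ((t⁻¹ : ℝ) : ℂ) • x = t⁻¹ • x := algebraMap_smul ℂ (t⁻¹) x
  simp only [generatorGraph, Set.mem_ofPred_eq, h]

/-- The generator graph as a linear subspace. -/
def generatorSubmodule (U : ℝ → StateSpace →L[ℂ] StateSpace) :
    Submodule ℂ (StateSpace × StateSpace) where
  carrier := generatorGraph U
  zero_mem' := by simp [mem_generatorGraph]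
  add_mem' {p q} hp hq := by
    rw [mem_generatorGraph] at *
    refine (hp.add hq).congr fun t => ?_
    simp only [Prod.fst_add, map_add, ← smul_add]
    rw [add_sub_add_comm]
  smul_mem' c q hq := by
    rw [mem_generatorGraph] at *
    refine (hq.const_smul c).congr fun t => ?_
    simp only [Prod.smul_fst, map_smul, ← smul_sub]
    rw [smul_comm]

theorem tendsto_sub_right_nhdsGT (t : ℝ) : Tendsto (fun s : ℝ => s - t) (𝓝[>] t) (𝓝[>] 0) := by
  refine tendsto_nhdsWithin_iff.2 ⟨?_, ?_⟩
  · have : Tendsto (fun s : ℝ => s - t) (𝓝 t) (𝓝 (t - t)) := (continuous_sub_right t).tendsto t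
    rw [sub_self] at this
    exact this.mono_left nhdsWithin_le_nhds
  · filter_upwards [self_mem_nhdsWithin] with s hs
    exact Set.mem_Ioi.2 (sub_pos.2 (Set.mem_Ioi.1 hs))

theorem tendsto_abs_sub_nhdsGE (s : ℝ) :
    Tendsto (fun t : ℝ => |t - s|) (𝓝[Set.Ici 0] s) (𝓝[≥] 0) := by
  refine tendsto_nhdsWithin_iff.2 ⟨?_, Eventually.of_forall fun t => Set.mem_Ici.2 (abs_nonneg _)⟩
  have : Tendsto (fun t : ℝ => |t - s|) (𝓝 s) (𝓝 |s - s|) :=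
    (continuous_abs.comp (continuous_sub_right s)).tendsto s
  rw [sub_self, abs_zero] at this
  exact this.mono_left nhdsWithin_le_nhds

namespace IsC0Semigroup

variable {U : ℝ → StateSpace →L[ℂ] StateSpace}

theorem hasDerivWithinAt (hU : IsC0Semigroup U) {q : StateSpace × StateSpace}
    (hq : q ∈ generatorGraph U) {t : ℝ} (ht : 0 ≤ t) :
    HasDerivWithinAt (fun s => U s q.1) (U t q.2) (Set.Ici t) t := by
  rw [mem_generatorGraph] at hq
  rw [hasDerivWithinAt_iff_tendsto_slope, Set.Ici_sdiff_left]
  have h1 := tendsto_sub_right_nhdsGT t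
  refine (((U t).continuous.tendsto _).comp (hq.comp h1)).congr' ?_
  filter_upwards [self_mem_nhdsWithin] with s hs
  have hs' : 0 ≤ s - t := (sub_pos.2 hs).le
  have := hU.add t (s - t) ht hs'
  rw [add_sub_cancel] at this
  simp [slope_def_module, this, ContinuousLinearMap.map_smul_of_tower]

/-- U t commutes with U s, hence with the difference quotients that define the generator. -/
theorem orbit_mem (hU : IsC0Semigroup U) {q : StateSpace × StateSpace}
    (hq : q ∈ generatorGraph U) {t : ℝ} (ht : 0 ≤ t) :
    (U t q.1, U t q.2) ∈ generatorGraph U := by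
  rw [mem_generatorGraph] at *
  refine (((U t).continuous.tendsto _).comp hq).congr' ?_
  filter_upwards [self_mem_nhdsWithin] with s hs
  have h1 := hU.add t s ht (le_of_lt hs)
  have h2 := hU.add s t (le_of_lt hs) ht
  rw [add_comm, h1] at h2
  have h3 : U s (U t q.1) = U t (U s q.1) := (DFunLike.congr_fun h2 q.1).symm
  simp [h3, ContinuousLinearMap.map_smul_of_tower]

theorem continuousOn_Icc (hU : IsC0Semigroup U) (f : StateSpace) (t : ℝ) :
    ContinuousOn (fun s => U s f) (Set.Icc 0 t) :=
  (hU.continuousOn f).mono Set.Icc_subset_Ici_self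

theorem intervalIntegrable (hU : IsC0Semigroup U) (f : StateSpace) {t : ℝ} (ht : 0 ≤ t) :
    IntervalIntegrable (fun s => U s f) volume 0 t :=
  ContinuousOn.intervalIntegrable (by rw [Set.uIcc_of_le ht]; exact hU.continuousOn_Icc f t)

/-- The integrated form of the evolution equation. Unlike the limit defining the generator, it
survives passage to limits in q, which is what `isClosed_generatorGraph` needs. The converse
differentiates the integral from the right at 0. -/
theorem mem_generatorGraph_iff (hU : IsC0Semigroup U) (q : StateSpace × StateSpace) :
    q ∈ generatorGraph U ↔ ∀ t : ℝ, 0 ≤ t → U t q.1 - q.1 = ∫ s in (0 : ℝ)..t, U s q.2 := by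
  constructor
  · intro hq t ht
    have := intervalIntegral.integral_eq_sub_of_hasDeriv_right (a := 0) (b := t)
      (f := fun s => U s q.1) (f' := fun s => U s q.2)
      (by rw [Set.uIcc_of_le ht]; exact hU.continuousOn_Icc _ t)
      (fun s hs => ((hU.hasDerivWithinAt hq
        (by rw [min_eq_left ht] at hs; exact hs.1.le)).mono Set.Ioi_subset_Ici_self))
      (hU.intervalIntegrable _ ht)
    simpa [hU.zero] using this.symm
  · intro h
    rw [mem_generatorGraph]
    have hd : HasDerivWithinAt (fun t => ∫ s in (0 : ℝ)..t, U s q.2) (U 0 q.2) (Set.Ici 0) 0 := by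
      refine intervalIntegral.integral_hasDerivWithinAt_right (t := Set.Ioi 0) (by simp) ?_ ?_
      · refine ⟨Set.Ioi 0, self_mem_nhdsWithin, ?_⟩
        exact ((hU.continuousOn q.2).mono Set.Ioi_subset_Ici_self).aestronglyMeasurable
          measurableSet_Ioi
      · exact ((hU.continuousOn q.2) 0 (by simp)).mono Set.Ioi_subset_Ici_self
    rw [hasDerivWithinAt_iff_tendsto_slope, Set.Ici_sdiff_left, hU.zero] at hd
    refine hd.congr' ?_
    filter_upwards [self_mem_nhdsWithin] with s hs
    simp [slope_def_module, h s (le_of_lt hs)]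

theorem isClosed_generatorGraph (hU : IsC0Semigroup U)
    (hc : ∀ t, 0 ≤ t → ∀ f, ‖U t f‖ ≤ ‖f‖) : IsClosed (generatorGraph U) := by
  have : generatorGraph U = ⋂ t ∈ Set.Ici (0 : ℝ),
      {q | U t q.1 - q.1 = ∫ s in (0 : ℝ)..t, U s q.2} := by
    ext q
    simp [hU.mem_generatorGraph_iff]
  rw [this]
  refine isClosed_biInter fun t ht => isClosed_eq (by fun_prop) ?_
  -- Contractivity bounds the integrand by the norm of its argument, so the integral over [0, t] is
  -- t-Lipschitz in that argument.
  have hL : LipschitzWith (Real.toNNReal t) (fun g : StateSpace => ∫ s in (0 : ℝ)..t, U s g) := by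
    refine LipschitzWith.of_dist_le_mul fun f g => ?_
    rw [dist_eq_norm, dist_eq_norm, ← intervalIntegral.integral_sub
      (hU.intervalIntegrable f ht) (hU.intervalIntegrable g ht), Real.coe_toNNReal t ht]
    have := intervalIntegral.norm_integral_le_of_norm_le_const (a := 0) (b := t) (C := ‖f - g‖)
      (f := fun s => U s f - U s g) (fun s hs => by
        rw [Set.uIoc_of_le ht] at hs
        rw [← map_sub]
        exact hc s hs.1.le _)
    rwa [sub_zero, abs_of_nonneg ht, mul_comm] at this
  exact hL.continuous.comp continuous_snd

end IsC0Semigroup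

/-- Dissipativity: contractions have Re⟨f, U t f - f⟩ ≤ 0, so the generator A satisfies Re⟨f, Af⟩ ≤
0, and Cauchy–Schwarz applied to ⟨f, f - Af⟩ gives the bound. -/
theorem norm_le_norm_sub_of_mem_generatorGraph {U : ℝ → StateSpace →L[ℂ] StateSpace}
    (hc : ∀ t, 0 ≤ t → ∀ f, ‖U t f‖ ≤ ‖f‖) {q : StateSpace × StateSpace}
    (hq : q ∈ generatorGraph U) : ‖q.1‖ ≤ ‖q.1 - q.2‖ := by
  have hre : (inner ℂ q.1 q.2).re ≤ 0 := by
    rw [mem_generatorGraph] at hq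
    have h1 : Tendsto (fun t : ℝ => (inner ℂ q.1 (t⁻¹ • (U t q.1 - q.1))).re) (𝓝[>] 0)
        (𝓝 (inner ℂ q.1 q.2).re) :=
      (Complex.continuous_re.tendsto _).comp ((tendsto_const_nhds (x := q.1)).inner hq)
    refine le_of_tendsto h1 ?_
    filter_upwards [self_mem_nhdsWithin] with t ht
    have ht' : (0 : ℝ) < t := ht
    have e : t⁻¹ • (U t q.1 - q.1) = ((t⁻¹ : ℝ) : ℂ) • (U t q.1 - q.1) :=
      (algebraMap_smul ℂ (t⁻¹) _).symm
    rw [e, inner_smul_right, Complex.re_ofReal_mul, inner_sub_right, Complex.sub_re]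
    refine mul_nonpos_of_nonneg_of_nonpos (by positivity) ?_
    have h2 : (inner ℂ q.1 (U t q.1)).re ≤ ‖q.1‖ * ‖q.1‖ :=
      ((Complex.re_le_norm _).trans (norm_inner_le_norm _ _)).trans
        (mul_le_mul_of_nonneg_left (hc t ht'.le _) (norm_nonneg _))
    have h3 : (inner ℂ q.1 q.1).re = ‖q.1‖ * ‖q.1‖ := inner_self_eq_norm_mul_norm (𝕜 := ℂ) q.1
    linarith
  by_cases h0 : ‖q.1‖ = 0
  · rw [h0]; positivity
  have h4 : (inner ℂ q.1 (q.1 - q.2)).re ≤ ‖q.1‖ * ‖q.1 - q.2‖ :=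
    (Complex.re_le_norm _).trans (norm_inner_le_norm _ _)
  have h3 : (inner ℂ q.1 q.1).re = ‖q.1‖ * ‖q.1‖ := inner_self_eq_norm_mul_norm (𝕜 := ℂ) q.1
  rw [inner_sub_right, Complex.sub_re, h3] at h4
  have h5 : 0 < ‖q.1‖ := lt_of_le_of_ne (norm_nonneg _) (Ne.symm h0)
  nlinarith

/-- Differentiability at 0 on a dense set gives continuity at 0 there; the uniform bound ‖U t‖ ≤ 1
extends it to all vectors, and the semigroup law transports it to every time. -/
theorem isC0Semigroup_of_dense {U : ℝ → StateSpace →L[ℂ] StateSpace} {D : Set StateSpace}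
    (hzero : U 0 = 1)
    (hadd : ∀ s t : ℝ, 0 ≤ s → 0 ≤ t → U (s + t) = U s * U t)
    (hcontr : ∀ t, 0 ≤ t → ∀ f, ‖U t f‖ ≤ ‖f‖) (hdense : Dense D)
    (hgen : ∀ f ∈ D, ∃ g, (f, g) ∈ generatorGraph U) : IsC0Semigroup U := by
  refine ⟨hzero, hadd, fun f => ?_⟩
  have hlim : Tendsto (fun t => U t f) (𝓝[≥] 0) (𝓝 f) := by
    rw [Metric.tendsto_nhds]
    intro ε hε
    obtain ⟨g, hg, hfg⟩ := hdense.exists_dist_lt f (show 0 < ε / 3 by positivity)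
    have h1 : ∀ᶠ t : ℝ in 𝓝[>] 0, dist (U t g) g < ε / 3 := by
      obtain ⟨w, hw⟩ := hgen g hg
      have h2 := mem_generatorGraph.1 hw
      have h3 : Tendsto (fun t : ℝ => t • (t⁻¹ • (U t g - g))) (𝓝[>] 0)
          (𝓝 ((0 : ℝ) • w)) :=
        (tendsto_id.mono_left nhdsWithin_le_nhds).smul h2
      rw [zero_smul] at h3
      have h4 := (Metric.tendsto_nhds.1 h3) (ε / 3) (by positivity)
      filter_upwards [h4, self_mem_nhdsWithin] with t ht ht0
      have ht0' : t ≠ 0 := ne_of_gt ht0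
      rwa [smul_inv_smul₀ ht0', dist_zero_right, ← dist_eq_norm] at ht
    have h1' : ∀ᶠ t : ℝ in 𝓝[≥] 0, dist (U t g) g < ε / 3 := by
      rw [← Set.Ioi_insert, nhdsWithin_insert, eventually_sup]
      refine ⟨?_, h1⟩
      simp only [eventually_pure, hzero]
      simpa using hε
    filter_upwards [h1', self_mem_nhdsWithin] with t ht ht0
    have h5 : dist (U t f) (U t g) ≤ dist f g := by
      rw [dist_eq_norm, dist_eq_norm, ← map_sub]
      exact hcontr t ht0 _
    calc dist (U t f) f ≤ dist (U t f) (U t g) + dist (U t g) g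
          + dist g f := dist_triangle4 _ _ _ _
      _ < ε := by rw [dist_comm g f]; linarith
  -- Factoring out the semigroup at the smaller of the two times gives an estimate symmetric in s
  -- and t, so left and right continuity are obtained together.
  have hbound (s t : ℝ) (hs : 0 ≤ s) (ht : 0 ≤ t) :
      dist (U t f) (U s f) ≤ dist (U |t - s| f) f := by
    have aux (s t : ℝ) (hs : 0 ≤ s) (hst : s ≤ t) :
        dist (U t f) (U s f) ≤ dist (U |t - s| f) f := by
      have h1 := hadd s (t - s) hs (by linarith)
      rw [add_sub_cancel] at h1
      rw [abs_of_nonneg (by linarith), h1, dist_eq_norm, dist_eq_norm]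
      change ‖U s (U (t - s) f) - U s f‖ ≤ _
      rw [← map_sub]
      exact hcontr s hs _
    rcases le_total s t with hst | hst
    · exact aux s t hs hst
    · rw [dist_comm, abs_sub_comm]
      exact aux t s ht hst
  intro s hs
  rw [ContinuousWithinAt, tendsto_iff_dist_tendsto_zero]
  have habs := tendsto_abs_sub_nhdsGE s
  refine squeeze_zero' (Eventually.of_forall fun _ => dist_nonneg) ?_
    (tendsto_iff_dist_tendsto_zero.1 (hlim.comp habs))
  filter_upwards [self_mem_nhdsWithin] with t ht
  exact hbound s t hs ht

/-! ### Exponentials realised by contraction semigroups -/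

/-- The closure of `B` generates the contraction semigroup `U`. -/
structure ContractionExp (B : SchwartzOp) (U : ℝ → StateSpace →L[ℂ] StateSpace) : Prop where
  semigroup : IsC0Semigroup U
  contraction : ∀ t, 0 ≤ t → ∀ f, ‖U t f‖ ≤ ‖f‖
  generator : generatorGraph U = closureGraph B

namespace ContractionExp

variable {B : SchwartzOp} {U : ℝ → StateSpace →L[ℂ] StateSpace}

/-- The path s ↦ U(t - s) V(s) f runs from U(t) f to V(t) f and has zero right derivative, because
both generators have the same value at V(s) f. Only U needs to be contractive. -/
theorem semigroup_unique (h : ContractionExp B U) {V : ℝ → StateSpace →L[ℂ] StateSpace}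
    (hV : IsC0Semigroup V) (hgV : generatorGraph V = closureGraph B) {t : ℝ} (ht : 0 ≤ t) :
    V t = U t := by
  have hU := h.semigroup
  have key (f : 𝓢(ℝ, ℂ)) : V t (ket f) = U t (ket f) := by
    set q : StateSpace × StateSpace := (ket f, ket (B f)) with hqdef
    have hq : q ∈ generatorGraph V := by rw [hgV]; exact mem_closureGraph B f
    have hcont : ContinuousOn (fun s => U (t - s) (V s q.1)) (Set.Icc 0 t) := by
      intro s hs
      rw [ContinuousWithinAt, tendsto_iff_norm_sub_tendsto_zero]
      have h1 : Tendsto (fun r => ‖V r q.1 - V s q.1‖) (𝓝[Set.Icc 0 t] s) (𝓝 0) :=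
        tendsto_iff_norm_sub_tendsto_zero.1 (hV.continuousOn_Icc q.1 t s hs)
      have h2 : Tendsto (fun r => ‖U (t - r) (V s q.1) - U (t - s) (V s q.1)‖)
          (𝓝[Set.Icc 0 t] s) (𝓝 0) := by
        refine tendsto_iff_norm_sub_tendsto_zero.1 ?_
        have hc := hU.continuousOn (V s q.1) (t - s) (by simpa using hs.2)
        refine Tendsto.comp hc (tendsto_nhdsWithin_iff.2 ⟨?_, ?_⟩)
        · exact ((continuous_sub_left t).tendsto s).mono_left nhdsWithin_le_nhds
        · filter_upwards [self_mem_nhdsWithin] with r hr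
          simpa using hr.2
      refine squeeze_zero' (Eventually.of_forall fun _ => norm_nonneg _) ?_
        (by simpa using h1.add h2)
      filter_upwards [self_mem_nhdsWithin] with r hr
      have e : U (t - r) (V r q.1) - U (t - s) (V s q.1) = U (t - r) (V r q.1 - V s q.1)
          + (U (t - r) (V s q.1) - U (t - s) (V s q.1)) := by
        rw [map_sub]; abel
      rw [e]
      exact (norm_add_le _ _).trans (add_le_add_left
        (h.contraction _ (by simpa using hr.2) _) _)
    have hderiv : ∀ s ∈ Set.Ico 0 t,
        HasDerivWithinAt (fun s => U (t - s) (V s q.1)) 0 (Set.Ici s) s := by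
      intro s hs
      have hqs : (V s q.1, V s q.2) ∈ generatorGraph V := hV.orbit_mem hq hs.1
      have hqs' : (V s q.1, V s q.2) ∈ generatorGraph U := by
        rw [h.generator, ← hgV]; exact hqs
      rw [mem_generatorGraph] at hqs hqs'
      have hd := hqs.sub hqs'
      simp only [sub_self] at hd
      rw [hasDerivWithinAt_iff_tendsto_slope, Set.Ici_sdiff_left]
      have h1 := tendsto_sub_right_nhdsGT s
      refine squeeze_zero_norm' ?_ (by simpa using (hd.comp h1).norm)
      filter_upwards [Ioo_mem_nhdsGT hs.2] with r hr
      have hrs : 0 ≤ r - s := by linarith [hr.1]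
      have htr : 0 ≤ t - r := by linarith [hr.2]
      have e1 : V r q.1 = V (r - s) (V s q.1) := by
        have := hV.add (r - s) s hrs hs.1
        rw [sub_add_cancel] at this
        rw [this]; rfl
      have e2 : U (t - s) (V s q.1) = U (t - r) (U (r - s) (V s q.1)) := by
        have := hU.add (t - r) (r - s) htr hrs
        rw [sub_add_sub_cancel] at this
        rw [this]; rfl
      -- Pulling out U(t - r), which depends on r, leaves a difference of two difference quotients
      -- with the same limit; contractivity of U(t - r) makes the r-dependence harmless.
      have e3 : slope (fun s => U (t - s) (V s q.1)) s r = U (t - r) ((r - s)⁻¹ •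
          (V (r - s) (V s q.1) - V s q.1) - (r - s)⁻¹ • (U (r - s) (V s q.1) - V s q.1)) := by
        rw [← smul_sub, sub_sub_sub_cancel_right, ContinuousLinearMap.map_smul_of_tower, map_sub,
          slope_def_module, e1,
          e2]
      rw [e3]
      exact h.contraction _ htr _
    have := constant_of_has_deriv_right_zero hcont hderiv t ⟨ht, le_rfl⟩
    simpa [hU.zero, hV.zero, hqdef] using this
  refine ContinuousLinearMap.ext fun f => ?_
  exact congrFun (denseRange_ket.equalizer (V t).continuous (U t).continuous (funext key)) f

theorem isExp (h : ContractionExp B U) : IsExp B (U 1) :=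
  ⟨U, h.semigroup, h.generator, rfl⟩

theorem eq_of_isExp (h : ContractionExp B U) {T : StateSpace →L[ℂ] StateSpace}
    (hT : IsExp B T) : T = U 1 := by
  obtain ⟨V, hV, hg, rfl⟩ := hT
  exact h.semigroup_unique hV hg zero_le_one

theorem hasExp (h : ContractionExp B U) : HasExp B :=
  ⟨U 1, h.isExp, fun _ hT => h.eq_of_isExp hT⟩

theorem opExp_eq (h : ContractionExp B U) : opExp B = U 1 := by
  have hex : ∃ T, IsExp B T := ⟨_, h.isExp⟩
  rw [opExp, dif_pos hex]
  exact h.eq_of_isExp hex.choose_spec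

/-- A contraction semigroup is generated by the closure of `B` if it is differentiable with
derivative `B` on a core on which `1 - B` has dense range. -/
theorem of_core (D : Submodule ℂ 𝓢(ℝ, ℂ)) (hzero : U 0 = 1)
    (hadd : ∀ s t : ℝ, 0 ≤ s → 0 ≤ t → U (s + t) = U s * U t)
    (hcontr : ∀ t, 0 ≤ t → ∀ f, ‖U t f‖ ≤ ‖f‖)
    (hdense : Dense (ket '' (D : Set 𝓢(ℝ, ℂ))))
    (hcore : ∀ f, (ket f, ket (B f)) ∈ closure ((fun f => (ket f, ket (B f))) '' (D : Set 𝓢(ℝ, ℂ))))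
    (hgen : ∀ f ∈ D, (ket f, ket (B f)) ∈ generatorGraph U)
    (hrange : ∀ y : StateSpace, (∀ f ∈ D, inner ℂ y (ket f - ket (B f)) = 0) → y = 0) :
    ContractionExp B U := by
  have hC0 : IsC0Semigroup U := by
    refine isC0Semigroup_of_dense hzero hadd hcontr hdense ?_
    rintro _ ⟨f, hf, rfl⟩
    exact ⟨_, hgen f hf⟩
  have hcl := hC0.isClosed_generatorGraph hcontr
  refine ⟨hC0, hcontr, Set.Subset.antisymm ?_ ?_⟩
  · rintro ⟨f, g⟩ hq
    -- Since (1 - B)D is dense, some u in D has u - Bu close to f - g. Dissipativity applied to (f,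
    -- g) - (u, Bu) then bounds f - u by the same error, and g - Bu by twice the error.
    let L : 𝓢(ℝ, ℂ) →ₗ[ℂ] StateSpace := (ket - ket.comp B).toLinearMap
    have htop : (D.map L).topologicalClosure = ⊤ := by
      rw [Submodule.topologicalClosure_eq_top_iff, Submodule.eq_bot_iff]
      intro y hy
      refine hrange y fun u hu => ?_
      have := (Submodule.mem_orthogonal' _ y).1 hy (L u) (Submodule.mem_map_of_mem hu)
      simpa [L] using this
    have hmem : f - g ∈ closure ((D.map L : Submodule ℂ StateSpace) : Set StateSpace) := by
      rw [← Submodule.topologicalClosure_coe, htop]; trivial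
    rw [closureGraph_eq, Metric.mem_closure_iff]
    intro ε hε
    obtain ⟨_, ⟨u, hu, rfl⟩, hd⟩ := Metric.mem_closure_iff.1 hmem (ε / 2) (by positivity)
    refine ⟨_, ⟨u, rfl⟩, ?_⟩
    have hsub : ((f, g) - (ket u, ket (B u)) : StateSpace × StateSpace) ∈ generatorGraph U :=
      (generatorSubmodule U).sub_mem hq (hgen u hu)
    have h1 := norm_le_norm_sub_of_mem_generatorGraph hcontr hsub
    have h2 : ‖(f - ket u) - (g - ket (B u))‖ < ε / 2 := by
      rw [dist_eq_norm] at hd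
      have e : f - ket u - (g - ket (B u)) = f - g - L u := by
        change _ = f - g - (ket u - ket (B u))
        abel
      rwa [e]
    have h1' : ‖f - ket u‖ < ε / 2 := lt_of_le_of_lt h1 h2
    have h3 : ‖g - ket (B u)‖ < ε := by
      calc ‖g - ket (B u)‖ = ‖(f - ket u) - ((f - ket u) - (g - ket (B u)))‖ := by
            rw [sub_sub_cancel]
        _ ≤ _ := norm_sub_le _ _
        _ < ε := by linarith
    rw [Prod.dist_eq, max_lt_iff, dist_eq_norm, dist_eq_norm]
    exact ⟨by linarith, h3⟩
  · rw [closureGraph_eq]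
    refine closure_minimal ?_ hcl
    rintro _ ⟨f, rfl⟩
    refine (closure_minimal ?_ hcl) (hcore f)
    rintro _ ⟨u, hu, rfl⟩
    exact hgen u hu

/-- A contraction semigroup that leaves the Schwartz space invariant and is differentiable there
is generated by the closure of its derivative. -/
theorem of_invariant (u : ℝ → 𝓢(ℝ, ℂ) → 𝓢(ℝ, ℂ)) (hzero : U 0 = 1)
    (hadd : ∀ s t : ℝ, 0 ≤ s → 0 ≤ t → U (s + t) = U s * U t)
    (hcontr : ∀ t, 0 ≤ t → ∀ f, ‖U t f‖ ≤ ‖f‖)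
    (hu : ∀ t, 0 ≤ t → ∀ f, U t (ket f) = ket (u t f))
    (hgen : ∀ f, (ket f, ket (B f)) ∈ generatorGraph U) :
    ContractionExp B U := by
  have hd : Dense (ket '' ((⊤ : Submodule ℂ 𝓢(ℝ, ℂ)) : Set 𝓢(ℝ, ℂ))) := by
    simpa using! denseRange_ket
  refine of_core ⊤ hzero hadd hcontr hd (fun f => subset_closure ⟨f, trivial, rfl⟩)
    (fun f _ => hgen f) fun y hy => ?_
  -- If y is orthogonal to the range of 1 - B, then ⟨y, Bf⟩ = ⟨y, f⟩, so e^{-t}⟨y, U t f⟩ is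
  -- constant in t. Contractivity makes it decay, hence it vanishes and y = 0.
  have hy' (f : 𝓢(ℝ, ℂ)) : inner ℂ y (ket (B f)) = inner ℂ y (ket f) := by
    have := hy f trivial
    rw [inner_sub_right, sub_eq_zero] at this
    exact this.symm
  have key (f : 𝓢(ℝ, ℂ)) (t : ℝ) (ht : 0 ≤ t) :
      Complex.exp (-t) * inner ℂ y (U t (ket f)) = inner ℂ y (ket f) := by
    have hright (s : ℝ) (hs : 0 ≤ s) : HasDerivWithinAt (fun s => U s (ket f))
        (ket (B (u s f))) (Set.Ici s) s := by
      have h1 := hgen (u s f)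
      rw [← hu s hs, mem_generatorGraph] at h1
      rw [hasDerivWithinAt_iff_tendsto_slope, Set.Ici_sdiff_left]
      have h2 := tendsto_sub_right_nhdsGT s
      refine (h1.comp h2).congr' ?_
      filter_upwards [self_mem_nhdsWithin] with r hr
      have h3 := hadd (r - s) s (sub_pos.2 hr).le hs
      rw [sub_add_cancel] at h3
      simp [slope_def_module, h3]
    have hC0 : IsC0Semigroup U := by
      refine isC0Semigroup_of_dense hzero hadd hcontr denseRange_ket ?_
      rintro _ ⟨f, rfl⟩
      exact ⟨_, hgen f⟩
    have hcont : ContinuousOn (fun s : ℝ => Complex.exp (-s) * inner ℂ y (U s (ket f)))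
        (Set.Icc 0 t) :=
      (by fun_prop : Continuous fun s : ℝ => Complex.exp (-s)).continuousOn.mul
        (continuousOn_const.inner (hC0.continuousOn_Icc _ t))
    have hder : ∀ s ∈ Set.Ico 0 t, HasDerivWithinAt
        (fun s : ℝ => Complex.exp (-s) * inner ℂ y (U s (ket f))) 0 (Set.Ici s) s := by
      intro s hs
      have h1 : HasDerivWithinAt (fun s : ℝ => Complex.exp (-s)) (-Complex.exp (-s))
          (Set.Ici s) s := by
        have := (Complex.ofRealCLM.hasDerivAt (x := s)).neg.cexp.hasDerivWithinAt (s := Set.Ici s)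
        simpa using! this
      have h2 : HasDerivWithinAt (fun s : ℝ => inner ℂ y (U s (ket f)))
          (inner ℂ y (ket (B (u s f)))) (Set.Ici s) s := by
        have := (hasDerivWithinAt_const s (Set.Ici s) y).inner ℂ (hright s hs.1)
        simpa using this
      have h3 := h1.mul h2
      rw [hy', hu s hs.1] at h3
      rw [neg_mul, neg_add_cancel] at h3
      exact h3
    have := constant_of_has_deriv_right_zero hcont hder t ⟨ht, le_rfl⟩
    simpa [hzero] using this
  have hzero' (f : 𝓢(ℝ, ℂ)) : inner ℂ y (ket f) = 0 := by
    have hb (t : ℝ) (ht : 0 ≤ t) :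
        ‖inner ℂ y (ket f)‖ ≤ Real.exp (-t) * (‖y‖ * ‖ket f‖) := by
      rw [← key f t ht, norm_mul]
      have e : ‖Complex.exp (-t)‖ = Real.exp (-t) := by
        rw [Complex.norm_exp]; simp
      rw [e]
      gcongr
      exact (norm_inner_le_norm _ _).trans (mul_le_mul_of_nonneg_left (hcontr t ht _)
        (norm_nonneg _))
    have hlim : Tendsto (fun t : ℝ => Real.exp (-t) * (‖y‖ * ‖ket f‖)) atTop (𝓝 0) := by
      simpa using Real.tendsto_exp_neg_atTop_nhds_zero.mul_const (‖y‖ * ‖ket f‖)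
    refine norm_le_zero_iff.1 (ge_of_tendsto hlim ?_)
    filter_upwards [eventually_ge_atTop 0] with t ht using hb t ht
  have hfun : (fun g : StateSpace => inner ℂ y g) = fun _ => (0 : ℂ) :=
    denseRange_ket.equalizer (by fun_prop) continuous_const (funext hzero')
  exact inner_self_eq_zero.1 (congrFun hfun y)

end ContractionExp

/-! ## Unitary operators that preserve the Schwartz space -/

theorem op_ext {A B : SchwartzOp} (h : ∀ f x, A f x = B f x) : A = B :=
  ContinuousLinearMap.ext fun f => SchwartzMap.ext (h f)

/-- The invertible operators on the Schwartz space that preserve the `L²` norm. -/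
def schwartzUnitary : Subgroup SchwartzOpˣ where
  carrier := {u | ∀ f, ‖ket ((u : SchwartzOp) f)‖ = ‖ket f‖}
  one_mem' f := rfl
  mul_mem' {u v} hu hv f := (hu _).trans (hv f)
  inv_mem' {u} hu f := by
    rw [← hu]
    congr 2
    exact DFunLike.congr_fun (Units.mul_inv u) f

/-- The operator underlying an element of `schwartzUnitary`. -/
abbrev op (u : schwartzUnitary) : SchwartzOp := ((u : SchwartzOpˣ) : SchwartzOp)

theorem op_mul_op_inv (u : schwartzUnitary) : op u * op u⁻¹ = 1 := (u : SchwartzOpˣ).mul_inv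

theorem op_inv_mul_op (u : schwartzUnitary) : op u⁻¹ * op u = 1 := (u : SchwartzOpˣ).inv_mul

theorem op_op_inv (u : schwartzUnitary) (f : 𝓢(ℝ, ℂ)) : op u (op u⁻¹ f) = f :=
  DFunLike.congr_fun (op_mul_op_inv u) f

theorem op_inv_op (u : schwartzUnitary) (f : 𝓢(ℝ, ℂ)) : op u⁻¹ (op u f) = f :=
  DFunLike.congr_fun (op_inv_mul_op u) f

/-- The unitary operator on `L²(ℝ)` that extends an isometric bijection of the Schwartz space. -/
def lift (u : schwartzUnitary) : StateSpace ≃ₗᵢ[ℂ] StateSpace :=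
  LinearEquiv.extendOfIsometry
    ({ toFun := fun f => op u f
       map_add' := map_add _
       map_smul' := map_smul _
       invFun := fun f => op u⁻¹ f
       left_inv := op_inv_op u
       right_inv := op_op_inv u } : 𝓢(ℝ, ℂ) ≃ₗ[ℂ] 𝓢(ℝ, ℂ))
    ket.toLinearMap ket.toLinearMap denseRange_ket denseRange_ket u.2

theorem lift_ket (u : schwartzUnitary) (f : 𝓢(ℝ, ℂ)) :
    lift u (ket f) = ket (op u f) :=
  LinearEquiv.extendOfIsometry_eq _ _ _ _ _ _ f

theorem lift_symm_ket (u : schwartzUnitary) (f : 𝓢(ℝ, ℂ)) :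
    (lift u).symm (ket f) = ket (op u⁻¹ f) :=
  LinearEquiv.extendOfIsometry_symm_eq _ _ _ _ _ _ f

/-- Conjugation of a bounded operator by a unitary operator. -/
def conj (u : schwartzUnitary) (T : StateSpace →L[ℂ] StateSpace) : StateSpace →L[ℂ] StateSpace :=
  (lift u : StateSpace →L[ℂ] StateSpace) * T * ((lift u).symm : StateSpace →L[ℂ] StateSpace)

theorem conj_apply (u : schwartzUnitary) (T : StateSpace →L[ℂ] StateSpace) (f : StateSpace) :
    conj u T f = lift u (T ((lift u).symm f)) := rfl

theorem adjoint_lift (u : schwartzUnitary) :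
    ContinuousLinearMap.adjoint (lift u : StateSpace →L[ℂ] StateSpace)
      = ((lift u).symm : StateSpace →L[ℂ] StateSpace) := by
  rw [eq_comm, ContinuousLinearMap.eq_adjoint_iff]
  intro x y
  have := (lift u).inner_map_map ((lift u).symm x) y
  rw [LinearIsometryEquiv.apply_symm_apply] at this
  exact this.symm

/-- The product of two copies of the unitary is a homeomorphism of the graph space. It carries the
graph of B over the Schwartz space onto that of the conjugated operator, because u permutes the
Schwartz space; closures follow. -/
theorem closureGraph_conj (u : schwartzUnitary) (B : SchwartzOp) (q : StateSpace × StateSpace) :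
    q ∈ closureGraph (op u * B * op u⁻¹) ↔
      ((lift u).symm q.1, (lift u).symm q.2) ∈ closureGraph B := by
  let Φ : StateSpace × StateSpace ≃ₜ StateSpace × StateSpace :=
    (lift u).symm.toHomeomorph.prodCongr (lift u).symm.toHomeomorph
  change _ ∈ _ ↔ Φ q ∈ _
  rw [closureGraph_eq, closureGraph_eq, ← Set.mem_preimage, Φ.preimage_closure]
  congr! 2
  ext ⟨f, g⟩
  simp only [Set.mem_range, Set.mem_preimage]
  have hΦ (f g : StateSpace) : Φ (f, g) = ((lift u).symm f, (lift u).symm g) := rfl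
  simp only [hΦ, Prod.mk.injEq]
  constructor
  · rintro ⟨h, rfl, rfl⟩
    refine ⟨op u⁻¹ h, (lift_symm_ket u h).symm, ?_⟩
    rw [lift_symm_ket]
    congr 1
    exact (op_inv_op u _).symm
  · rintro ⟨h, h1, h2⟩
    refine ⟨op u h, ?_, ?_⟩
    · rw [← lift_ket, h1, LinearIsometryEquiv.apply_symm_apply]
    · rw [← (lift u).apply_symm_apply g, ← h2, lift_ket]
      congr 1
      change op u (B (op u⁻¹
        (op u h))) = _
      rw [op_inv_op]

theorem generatorGraph_conj (u : schwartzUnitary) (U : ℝ → StateSpace →L[ℂ] StateSpace)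
    (q : StateSpace × StateSpace) :
    q ∈ generatorGraph (fun t => conj u (U t)) ↔
      ((lift u).symm q.1, (lift u).symm q.2) ∈ generatorGraph U := by
  rw [mem_generatorGraph, mem_generatorGraph,
    (lift u).symm.toHomeomorph.isInducing.tendsto_nhds_iff]
  refine Filter.tendsto_congr fun t => ?_
  have h (x : StateSpace) : (lift u).symm (t⁻¹ • x) = t⁻¹ • (lift u).symm x :=
    ((lift u).symm : StateSpace →L[ℂ] StateSpace).map_smul_of_tower _ _
  change (lift u).symm (t⁻¹ • (lift u (U t ((lift u).symm q.1)) - q.1)) = _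
  rw [h, map_sub, LinearIsometryEquiv.symm_apply_apply]

theorem ContractionExp.conj {B : SchwartzOp} {U : ℝ → StateSpace →L[ℂ] StateSpace}
    (h : ContractionExp B U) (u : schwartzUnitary) :
    ContractionExp (op u * B * op u⁻¹)
      (fun t => conj u (U t)) := by
  refine ⟨⟨?_, ?_, ?_⟩, ?_, ?_⟩
  · ext1 f
    simp [conj_apply, h.semigroup.zero]
  · intro s t hs ht
    ext1 f
    change _ = SqueezedThermal.conj u (U s) (SqueezedThermal.conj u (U t) f)
    simp [conj_apply, h.semigroup.add s t hs ht]
  · intro f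
    exact (lift u).continuous.comp_continuousOn (h.semigroup.continuousOn _)
  · intro t ht f
    rw [conj_apply, LinearIsometryEquiv.norm_map]
    simpa using h.contraction t ht ((lift u).symm f)
  · ext q
    rw [generatorGraph_conj, closureGraph_conj, h.generator]

/-! ### Linear canonical transformations of position and momentum -/

/-- `u` implements the linear transformation `χ ↦ α χ + β p`, `p ↦ γ χ + δ p`. -/
structure Implements (u : SchwartzOp) (α β γ δ : ℂ) : Prop where
  mul_position : u * position = (α • position + β • momentum) * u
  mul_momentum : u * momentum = (γ • position + δ • momentum) * u

/-- The matrices multiply in the opposite order: the matrix of u * v is that of v times that of u.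
-/
theorem Implements.mul {u v : SchwartzOp} {α β γ δ α' β' γ' δ' : ℂ}
    (hu : Implements u α β γ δ) (hv : Implements v α' β' γ' δ') :
    Implements (u * v) (α' * α + β' * γ) (α' * β + β' * δ) (γ' * α + δ' * γ)
      (γ' * β + δ' * δ) := by
  constructor
  · rw [mul_assoc, hv.mul_position, ← mul_assoc, mul_add, mul_smul_comm, mul_smul_comm,
      hu.mul_position,
      hu.mul_momentum, ← mul_assoc]
    congr 1
    simp only [← smul_mul_assoc, ← add_mul]
    congr 1
    module
  · rw [mul_assoc, hv.mul_momentum, ← mul_assoc, mul_add, mul_smul_comm, mul_smul_comm,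
      hu.mul_position,
      hu.mul_momentum, ← mul_assoc]
    congr 1
    simp only [← smul_mul_assoc, ← add_mul]
    congr 1
    module

theorem Implements.inv {u : schwartzUnitary} {α β γ δ : ℂ} (h : Implements (op u) α β γ δ)
    (hdet : α * δ - β * γ = 1) : Implements (op u⁻¹) δ (-β) (-γ) α := by
  have h1 : op u * (δ • position + -β • momentum) = position * op u := by
    rw [mul_add, mul_smul_comm, mul_smul_comm, h.mul_position, h.mul_momentum]
    simp only [← smul_mul_assoc, ← add_mul]
    congr 1
    match_scalars
    · linear_combination hdet
    · ring
  have h2 : op u * (-γ • position + α • momentum) = momentum * op u := by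
    rw [mul_add, mul_smul_comm, mul_smul_comm, h.mul_position, h.mul_momentum]
    simp only [← smul_mul_assoc, ← add_mul]
    congr 1
    match_scalars
    · ring
    · linear_combination hdet
  have key {A B : SchwartzOp} (hAB : op u * B = A * op u) : op u⁻¹ * A = B * op u⁻¹ := by
    calc op u⁻¹ * A = op u⁻¹ * (A * op u) * op u⁻¹ := by
          rw [mul_assoc, mul_assoc, op_mul_op_inv, mul_one]
      _ = _ := by rw [← hAB, ← mul_assoc, op_inv_mul_op, one_mul]
  exact ⟨key h1, key h2⟩

theorem norm_ket_congr {f g : 𝓢(ℝ, ℂ)} (h : ∀ x, ‖f x‖ = ‖g x‖) : ‖ket f‖ = ‖ket g‖ := by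
  rw [ket_apply, ket_apply, SchwartzMap.norm_toLp, SchwartzMap.norm_toLp]
  exact congrArg _ (eLpNorm_congr_norm_ae (Eventually.of_forall h))

/-! ### Chirps -/

/-- The n-th derivative is I ^ n times the function, hence bounded. Chirps inherit temperate growth
by composition with a polynomial. -/
theorem hasTemperateGrowth_cexp_I_mul :
    (fun y : ℝ => Complex.exp (Complex.I * y)).HasTemperateGrowth := by
  have hd (c : ℂ) (y : ℝ) : HasDerivAt (fun y : ℝ => c * Complex.exp (Complex.I * y))
      (c * Complex.I * Complex.exp (Complex.I * y)) y := by
    have h1 : HasDerivAt (fun y : ℝ => (y : ℂ)) 1 y := Complex.ofRealCLM.hasDerivAt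
    have := ((h1.const_mul Complex.I).cexp).const_mul c
    exact this.congr_deriv (by ring)
  have hit (n : ℕ) : iteratedDeriv n (fun y : ℝ => Complex.exp (Complex.I * y))
      = fun y : ℝ => Complex.I ^ n * Complex.exp (Complex.I * y) := by
    induction n with
    | zero => simp
    | succ n ih =>
      rw [iteratedDeriv_succ, ih]
      funext y
      rw [(hd _ y).deriv, pow_succ]
  refine ⟨?_, fun n => ⟨0, 1, fun y => ?_⟩⟩
  · exact Complex.contDiff_exp.comp (contDiff_const.mul Complex.ofRealCLM.contDiff)
  · rw [norm_iteratedFDeriv_eq_norm_iteratedDeriv, hit]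
    simp [Complex.norm_exp]

theorem hasTemperateGrowth_chirp (s : ℝ) :
    (fun x : ℝ => Complex.exp (Complex.I * ((s * x ^ 2 / 2 : ℝ) : ℂ))).HasTemperateGrowth := by
  have h : (fun x : ℝ => s * x ^ 2 / 2).HasTemperateGrowth := by
    have h1 : (fun x : ℝ => s / 2 * x ^ 2).HasTemperateGrowth :=
      (Function.HasTemperateGrowth.const (s / 2)).mul (Function.HasTemperateGrowth.id'.pow 2)
    convert h1 using 2
    ring
  exact hasTemperateGrowth_cexp_I_mul.comp h

/-- Multiplication by `exp (i s x² / 2)`. -/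
def chirpOp (s : ℝ) : SchwartzOp :=
  SchwartzMap.smulLeftCLM ℂ (fun x : ℝ => Complex.exp (Complex.I * ((s * x ^ 2 / 2 : ℝ) : ℂ)))

theorem chirpOp_apply (s : ℝ) (f : 𝓢(ℝ, ℂ)) (x : ℝ) :
    chirpOp s f x = Complex.exp (Complex.I * ((s * x ^ 2 / 2 : ℝ) : ℂ)) * f x := by
  simp only [chirpOp, SchwartzMap.smulLeftCLM_apply_apply (hasTemperateGrowth_chirp s),
    smul_eq_mul]

theorem chirpOp_mul (s t : ℝ) : chirpOp s * chirpOp t = chirpOp (s + t) := by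
  refine op_ext fun f x => ?_
  change chirpOp s (chirpOp t f) x = _
  rw [chirpOp_apply, chirpOp_apply, chirpOp_apply, ← mul_assoc, ← Complex.exp_add]
  congr 2
  push_cast
  ring

theorem chirpOp_zero : chirpOp 0 = 1 := by
  refine op_ext fun f x => ?_
  simp [chirpOp_apply]

/-- Multiplication by `exp (i s x² / 2)` as a unitary operator. -/
def chirp (s : ℝ) : schwartzUnitary :=
  ⟨⟨chirpOp s, chirpOp (-s), by rw [chirpOp_mul, add_neg_cancel, chirpOp_zero],
    by rw [chirpOp_mul, neg_add_cancel, chirpOp_zero]⟩, fun f => norm_ket_congr fun x => by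
      change ‖chirpOp s f x‖ = _
      rw [chirpOp_apply, norm_mul, mul_comm Complex.I, Complex.norm_exp_ofReal_mul_I, one_mul]⟩

theorem implements_chirp (s : ℝ) :
    Implements (op (chirp s)) 1 0 (-s) 1 := by
  constructor
  · refine op_ext fun f x => ?_
    change chirpOp s (position f) x = ((1 : ℂ) • position + (0 : ℂ) • momentum) (chirpOp s f) x
    simp only [one_smul, zero_smul, add_zero, chirpOp_apply, position_apply]
    ring
  · refine op_ext fun f x => ?_
    change chirpOp s (momentum f) x
      = ((-s : ℂ) • position (chirpOp s f) + (1 : ℂ) • momentum (chirpOp s f)) x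
    have hd : HasDerivAt (chirpOp s f) (Complex.exp (Complex.I * ((s * x ^ 2 / 2 : ℝ) : ℂ)) *
        (Complex.I * (s * x)) * f x + Complex.exp (Complex.I * ((s * x ^ 2 / 2 : ℝ) : ℂ))
        * deriv f x) x := by
      have h1 : HasDerivAt (fun x : ℝ => ((s * x ^ 2 / 2 : ℝ) : ℂ)) ((s * x : ℝ) : ℂ) x := by
        have := ((hasDerivAt_pow 2 x).const_mul s).div_const 2
        have h2 := this.ofReal_comp
        convert h2 using 2
        simp
        ring
      have h2 := (h1.const_mul Complex.I).cexp.mul (f.hasDerivAt x)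
      have e : (chirpOp s f : ℝ → ℂ) = fun x =>
        Complex.exp (Complex.I * ((s * x ^ 2 / 2 : ℝ) : ℂ)) * f x := funext (chirpOp_apply s f)
      rw [e]
      exact h2.congr_deriv (by push_cast; ring)
    rw [add_apply, smul_apply, smul_apply, chirpOp_apply,
      momentum_apply, momentum_apply, position_apply, hd.deriv, chirpOp_apply]
    simp only [smul_eq_mul]
    linear_combination (s * x * Complex.exp (Complex.I * ((s * x ^ 2 / 2 : ℝ) : ℂ)) * f x)
      * Complex.I_mul_I

/-! ### The Fourier transform -/

open FourierTransform in
/-- The Fourier transform as a unitary operator. -/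
def fourierU : schwartzUnitary :=
  ⟨⟨FourierTransform.fourierCLM ℂ 𝓢(ℝ, ℂ), FourierTransform.fourierInvCLM ℂ 𝓢(ℝ, ℂ),
    ContinuousLinearMap.ext fun f => by
      change 𝓕 (𝓕⁻ f) = f
      exact fourier_fourierInv_eq f,
    ContinuousLinearMap.ext fun f => by
      change 𝓕⁻ (𝓕 f) = f
      exact fourierInv_fourier_eq f⟩,
    fun f => SchwartzMap.norm_fourier_toL2_eq f⟩

open FourierTransform LineDeriv in
-- A quarter turn of phase space; the factors 2π come from the convention exp(-2πixξ) of the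
-- transform.
theorem implements_fourierU :
    Implements (op fourierU) 0 (-(1 / (2 * Real.pi))) (2 * Real.pi) 0 := by
  have hpi : (Real.pi : ℂ) ≠ 0 := by exact_mod_cast Real.pi_ne_zero
  have hx (f : 𝓢(ℝ, ℂ)) : SchwartzMap.smulLeftCLM ℂ (inner ℝ · (1 : ℝ)) f = position f := by
    ext x
    rw [SchwartzMap.smulLeftCLM_apply_apply (by fun_prop), position_apply]
    simp
  have hd (f : 𝓢(ℝ, ℂ)) : momentum f = (-Complex.I) • ∂_{(1 : ℝ)} f := by
    ext x
    rw [momentum_apply, smul_apply, SchwartzMap.lineDerivOp_apply_eq_fderiv]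
    simp
  constructor
  · ext1 f
    change 𝓕 (position f) = ((0 : ℂ) • position + (-(1 / (2 * Real.pi)) : ℂ) • momentum) (𝓕 f)
    rw [zero_smul, zero_add, smul_apply, hd,
      SchwartzMap.lineDerivOp_fourier_eq, hx, FourierTransform.fourier_smul, smul_smul, smul_smul]
    rw [eq_comm]
    convert one_smul ℂ _
    field_simp
    simp
  · ext1 f
    change 𝓕 (momentum f) = ((2 * Real.pi : ℂ) • position + (0 : ℂ) • momentum) (𝓕 f)
    rw [zero_smul, add_zero, smul_apply, hd, FourierTransform.fourier_smul,
      SchwartzMap.fourier_lineDerivOp_eq, hx, smul_smul]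
    congr 1
    linear_combination (-(2 * Real.pi : ℂ)) * Complex.I_mul_I

/-! ### Dilations -/

/-- The scaling `x ↦ exp r * x` of the line. -/
def scaling (r : ℝ) : ℝ ≃L[ℝ] ℝ :=
  ContinuousLinearEquiv.smulLeft (Units.mk0 (Real.exp r) (Real.exp_ne_zero r))

/-- The dilation `f ↦ exp (r / 2) f (exp r x)`. -/
def dilationOp (r : ℝ) : SchwartzOp :=
  ((Real.exp (r / 2) : ℝ) : ℂ) • SchwartzMap.compCLMOfContinuousLinearEquiv ℂ (scaling r)

theorem dilationOp_apply (r : ℝ) (f : 𝓢(ℝ, ℂ)) (x : ℝ) :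
    dilationOp r f x = ((Real.exp (r / 2) : ℝ) : ℂ) * f (Real.exp r * x) := rfl

theorem dilationOp_mul (s t : ℝ) : dilationOp s * dilationOp t = dilationOp (s + t) := by
  refine op_ext fun f x => ?_
  change dilationOp s (dilationOp t f) x = _
  rw [dilationOp_apply, dilationOp_apply, dilationOp_apply, ← mul_assoc, ← Complex.ofReal_mul,
    ← Real.exp_add, add_div, ← mul_assoc, ← Real.exp_add, add_comm t s]

theorem dilationOp_zero : dilationOp 0 = 1 := by
  refine op_ext fun f x => ?_
  simp [dilationOp_apply]

theorem norm_ket_sq (f : 𝓢(ℝ, ℂ)) : ‖ket f‖ ^ 2 = ∫ x, ‖f x‖ ^ 2 := by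
  have h := SchwartzMap.inner_toL2_toL2_eq f f
  rw [← ket_apply, inner_self_eq_norm_sq_to_K] at h
  have e : ∀ x, inner ℂ (f x) (f x) = ((‖f x‖ ^ 2 : ℝ) : ℂ) := fun x => by
    rw [inner_self_eq_norm_sq_to_K]; push_cast; rfl
  simp_rw [e] at h
  rw [integral_complex_ofReal] at h
  exact Complex.ofReal_injective (by simpa using! h)

theorem norm_ket_dilationOp (r : ℝ) (f : 𝓢(ℝ, ℂ)) : ‖ket (dilationOp r f)‖ = ‖ket f‖ := by
  rw [← sq_eq_sq₀ (norm_nonneg _) (norm_nonneg _), norm_ket_sq, norm_ket_sq]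
  have e (x : ℝ) : ‖dilationOp r f x‖ ^ 2
      = Real.exp r * (fun y => ‖f y‖ ^ 2) (Real.exp r * x) := by
    rw [dilationOp_apply, norm_mul, mul_pow, Complex.norm_real, Real.norm_eq_abs, sq_abs,
      ← Real.exp_nat_mul]
    congr 2
    push_cast
    ring
  simp_rw [e]
  rw [integral_const_mul, Measure.integral_comp_mul_left (fun y => ‖f y‖ ^ 2), smul_eq_mul,
    abs_of_pos (inv_pos.2 (Real.exp_pos r)), mul_inv_cancel_left₀ (Real.exp_ne_zero r)]

/-- The dilation `f ↦ exp (r / 2) f (exp r x)` as a unitary operator. -/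
def dilation (r : ℝ) : schwartzUnitary :=
  ⟨⟨dilationOp r, dilationOp (-r), by rw [dilationOp_mul, add_neg_cancel, dilationOp_zero],
    by rw [dilationOp_mul, neg_add_cancel, dilationOp_zero]⟩, norm_ket_dilationOp r⟩

theorem hasDerivAt_dilationOp (r : ℝ) (f : 𝓢(ℝ, ℂ)) (x : ℝ) :
    HasDerivAt (dilationOp r f) (((Real.exp (r / 2) : ℝ) : ℂ) * ((Real.exp r : ℝ) *
      deriv f (Real.exp r * x))) x := by
  have h1 : HasDerivAt (fun x : ℝ => Real.exp r * x) (Real.exp r) x := by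
    simpa using (hasDerivAt_id x).const_mul (Real.exp r)
  have h2 := ((f.hasDerivAt (Real.exp r * x)).scomp x h1).const_mul ((Real.exp (r / 2) : ℝ) : ℂ)
  have e : (dilationOp r f : ℝ → ℂ) = fun x => ((Real.exp (r / 2) : ℝ) : ℂ) *
    f (Real.exp r * x) := rfl
  rw [e]
  simpa using! h2

theorem implements_dilation (r : ℝ) :
    Implements (op (dilation r)) (Real.exp r) 0 0 (Real.exp (-r)) := by
  constructor
  · refine op_ext fun f x => ?_
    change dilationOp r (position f) x
      = ((Real.exp r : ℂ) • position + (0 : ℂ) • momentum) (dilationOp r f) x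
    rw [zero_smul, add_zero, smul_apply, smul_apply,
      dilationOp_apply, position_apply, position_apply, dilationOp_apply]
    push_cast [smul_eq_mul]
    ring
  · refine op_ext fun f x => ?_
    change dilationOp r (momentum f) x
      = ((0 : ℂ) • position + (Real.exp (-r) : ℂ) • momentum) (dilationOp r f) x
    rw [zero_smul, zero_add, smul_apply, smul_apply,
      dilationOp_apply, momentum_apply, momentum_apply, (hasDerivAt_dilationOp r f x).deriv,
      Real.exp_neg]
    push_cast [smul_eq_mul]
    have := Complex.exp_ne_zero r
    field_simp

/-! ### Squeezing directions -/

/-- A chirp is a lower shear, and a chirp conjugated by the Fourier transform is an upper shear; the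
matrix is the product of the lower shear with entry γ and the upper shear with entry β. The factor
4π² undoes the scaling of `fourierU`. -/
theorem exists_implements_of_shear (β γ : ℝ) :
    ∃ u : schwartzUnitary, Implements (op u) 1 β γ (1 + β * γ) := by
  have hpi : (Real.pi : ℂ) ≠ 0 := by exact_mod_cast Real.pi_ne_zero
  have hF := implements_fourierU
  have hF' := hF.inv (by field_simp; ring)
  have hs := (hF.mul (implements_chirp (4 * Real.pi ^ 2 * β))).mul hF'
  have h := hs.mul (implements_chirp (-γ))
  refine ⟨fourierU * chirp (4 * Real.pi ^ 2 * β) * fourierU⁻¹ * chirp (-γ), ?_⟩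
  have e : op (fourierU * chirp (4 * Real.pi ^ 2 * β) * fourierU⁻¹ * chirp (-γ))
    = op fourierU * op (chirp (4 * Real.pi ^ 2 * β)) * op fourierU⁻¹ * op (chirp (-γ)) := rfl
  rw [e]
  convert h using 1 <;> push_cast <;> field_simp <;> ring


/-! ### Multiplicativity of the extension to L² -/

theorem lift_eq_of_ket {u : schwartzUnitary} {T : StateSpace →L[ℂ] StateSpace}
    (h : ∀ f, T (ket f) = ket (op u f)) : T = (lift u : StateSpace →L[ℂ] StateSpace) := by
  refine ContinuousLinearMap.ext fun f => ?_
  refine congrFun (denseRange_ket.equalizer T.continuous (lift u).continuous (funext fun g => ?_)) f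
  exact (h g).trans (lift_ket u g).symm

theorem lift_mul (u v : schwartzUnitary) : (lift (u * v) : StateSpace →L[ℂ] StateSpace)
    = (lift u : StateSpace →L[ℂ] StateSpace) * (lift v : StateSpace →L[ℂ] StateSpace) :=
  (lift_eq_of_ket fun f => by
    change lift u (lift v (ket f)) = _
    rw [lift_ket, lift_ket]
    rfl).symm

theorem lift_inv (u : schwartzUnitary) : (lift u⁻¹ : StateSpace →L[ℂ] StateSpace)
    = ((lift u).symm : StateSpace →L[ℂ] StateSpace) :=
  (lift_eq_of_ket fun f => lift_symm_ket u f).symm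

theorem conj_lift (u v : schwartzUnitary) :
    conj u (lift v : StateSpace →L[ℂ] StateSpace)
      = (lift (u * v * u⁻¹) : StateSpace →L[ℂ] StateSpace) := by
  rw [lift_mul, lift_mul, lift_inv, conj]

/-- Conjugation sends χp to (αχ + βp)(γχ + δp), so only the products αδ, βγ, αγ, βδ enter. Their
prescribed values are those for which the dilation generator becomes the squeeze exponent with angle
ψ, when κ = mω; they contain αδ - βγ = 1. -/
theorem exists_implements_rotation {κ : ℝ} (hκ : κ ≠ 0) (ψ : ℝ) :
    ∃ (u : schwartzUnitary) (α β γ δ : ℝ), Implements (op u) α β γ δ ∧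
      α * δ = (1 + Real.cos ψ) / 2 ∧ β * γ = (Real.cos ψ - 1) / 2 ∧
      α * γ = -(κ * Real.sin ψ / 2) ∧ β * δ = Real.sin ψ / (2 * κ) := by
  have hsc := Real.sin_sq_add_cos_sq ψ
  -- Dilations leave the four products unchanged, so α = 1 may be chosen when αδ ≠ 0. When cos ψ =
  -- -1, the prescription forces αδ = 0 and βγ = -1, as for the Fourier transform.
  by_cases h : 1 + Real.cos ψ = 0
  · have hs : Real.sin ψ = 0 := by
      have : Real.cos ψ = -1 := by linarith
      rw [this] at hsc
      nlinarith
    refine ⟨fourierU, 0, -(1 / (2 * Real.pi)), 2 * Real.pi, 0, ?_, ?_, ?_, ?_, ?_⟩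
    · convert implements_fourierU using 1 <;> push_cast <;> rfl
    · rw [h]; simp
    · have : Real.cos ψ = -1 := by linarith
      have := Real.pi_ne_zero
      field_simp
      linarith
    · simp [hs]
    · simp [hs]
  · obtain ⟨u, hu⟩ := exists_implements_of_shear (Real.sin ψ / (κ * (1 + Real.cos ψ)))
      (-(κ * Real.sin ψ / 2))
    have e : 1 + Real.sin ψ / (κ * (1 + Real.cos ψ)) * -(κ * Real.sin ψ / 2)
        = (1 + Real.cos ψ) / 2 := by
      field_simp
      linear_combination (-1 : ℝ) * hsc
    refine ⟨u, 1, Real.sin ψ / (κ * (1 + Real.cos ψ)), -(κ * Real.sin ψ / 2),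
      1 + Real.sin ψ / (κ * (1 + Real.cos ψ)) * -(κ * Real.sin ψ / 2), ?_, ?_, ?_, ?_, ?_⟩
    rotate_left
    · rw [one_mul]; exact e
    · linear_combination e
    · rw [one_mul]
    · rw [e]
      field_simp
    · convert hu using 1 <;> push_cast <;> rfl

/-! ## The dilation group -/

/-- Dominated convergence in L²: the square of (1 + x²)⁻¹ is at most (1 + x²)⁻¹, which is
integrable. -/
theorem tendsto_ket_zero {l : Filter ℝ} [l.IsCountablyGenerated] {h : ℝ → 𝓢(ℝ, ℂ)} {C : ℝ}
    (hb : ∀ᶠ t in l, ∀ x, ‖h t x‖ ≤ C * (1 + x ^ 2)⁻¹)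
    (hlim : ∀ x, Tendsto (fun t => h t x) l (𝓝 0)) : Tendsto (fun t => ket (h t)) l (𝓝 0) := by
  rw [tendsto_zero_iff_norm_tendsto_zero]
  have hsq : Tendsto (fun t => ‖ket (h t)‖ ^ 2) l (𝓝 0) := by
    simp_rw [norm_ket_sq]
    have := tendsto_integral_filter_of_dominated_convergence (μ := volume) (l := l)
      (F := fun t x => ‖h t x‖ ^ 2) (f := fun _ => 0) (fun x => C ^ 2 * (1 + x ^ 2)⁻¹)
      (Eventually.of_forall fun t => by
        have := (h t).continuous
        exact (by fun_prop : Continuous fun x => ‖h t x‖ ^ 2).aestronglyMeasurable)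
      (by
        filter_upwards [hb] with t ht
        refine Eventually.of_forall fun x => ?_
        rw [Real.norm_of_nonneg (by positivity)]
        have h1 : (1 + x ^ 2)⁻¹ ≤ 1 := inv_le_one_of_one_le₀ (by nlinarith [sq_nonneg x])
        have h2 : 0 ≤ (1 + x ^ 2)⁻¹ := by positivity
        calc ‖h t x‖ ^ 2 ≤ (C * (1 + x ^ 2)⁻¹) ^ 2 := by gcongr; exact ht x
          _ = C ^ 2 * ((1 + x ^ 2)⁻¹ * (1 + x ^ 2)⁻¹) := by ring
          _ ≤ C ^ 2 * ((1 + x ^ 2)⁻¹ * 1) := by gcongr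
          _ = _ := by rw [mul_one])
      (integrable_inv_one_add_sq.const_mul _)
      (Eventually.of_forall fun x => by simpa using ((hlim x).norm.pow 2))
    simpa using this
  have := (Real.continuous_sqrt.tendsto 0).comp hsq
  simpa [Function.comp_def, Real.sqrt_sq] using this

/-- The generator `η (x d/dx + 1/2)` of dilations. -/
def dilationGen (η : ℝ) : SchwartzOp :=
  (Complex.I * η) • (position * momentum) + (η / 2 : ℂ) • 1

theorem dilationGen_apply (η : ℝ) (f : 𝓢(ℝ, ℂ)) (x : ℝ) :
    dilationGen η f x = η * (x * deriv f x + f x / 2) := by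
  change (Complex.I * η) • (position (momentum f) x) + (η / 2 : ℂ) • f x = _
  rw [position_apply, momentum_apply]
  simp only [smul_eq_mul]
  linear_combination (-(η * x * deriv f x)) * Complex.I_mul_I

theorem hasDerivAt_dilationOp_param (η : ℝ) (f : 𝓢(ℝ, ℂ)) (x t : ℝ) :
    HasDerivAt (fun t => dilationOp (η * t) f x) (dilationOp (η * t) (dilationGen η f) x) t := by
  simp only [dilationOp_apply, dilationGen_apply]
  have h0 : HasDerivAt (fun t => η * t) η t := by simpa using (hasDerivAt_id t).const_mul η
  have h1 : HasDerivAt (fun t => Real.exp (η * t) * x) (Real.exp (η * t) * η * x) t :=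
    (h0.exp).mul_const x
  have h2 := (f.hasDerivAt (Real.exp (η * t) * x)).scomp t h1
  have h3 : HasDerivAt (fun t => ((Real.exp (η * t / 2) : ℝ) : ℂ))
      ((Real.exp (η * t / 2) * (η / 2) : ℝ) : ℂ) t := ((h0.div_const 2).exp).ofReal_comp
  have h4 := h3.mul h2
  refine h4.congr_deriv ?_
  push_cast [Function.comp_apply, Complex.real_smul]
  ring

theorem exists_decay_bound (f : 𝓢(ℝ, ℂ)) : ∃ C : ℝ, 0 ≤ C ∧ ∀ x, ‖f x‖ ≤ C * (1 + x ^ 2)⁻¹ := by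
  refine ⟨SchwartzMap.seminorm ℂ 0 0 f + SchwartzMap.seminorm ℂ 2 0 f, by positivity, fun x => ?_⟩
  have h1 := SchwartzMap.norm_pow_mul_le_seminorm ℂ f 0 x
  have h2 := SchwartzMap.norm_pow_mul_le_seminorm ℂ f 2 x
  rw [← div_eq_mul_inv, le_div_iff₀ (by positivity)]
  rw [Real.norm_eq_abs, sq_abs] at h2
  rw [pow_zero, one_mul] at h1
  nlinarith

theorem exists_dilationOp_bound (η : ℝ) (f : 𝓢(ℝ, ℂ)) : ∃ C : ℝ, 0 ≤ C ∧
    ∀ t ∈ Set.Icc (0 : ℝ) 1, ∀ x, ‖dilationOp (η * t) f x‖ ≤ C * (1 + x ^ 2)⁻¹ := by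
  obtain ⟨C, hC, hf⟩ := exists_decay_bound f
  -- The factor exp |η| absorbs the prefactor exp(ηt/2), and exp(2|η|) pays for the change of
  -- argument, since 1 + x² ≤ exp(2|η|)(1 + exp(2ηt)x²) for |ηt| ≤ |η|.
  refine ⟨Real.exp |η| * (C * Real.exp (2 * |η|)), by positivity, fun t ht x => ?_⟩
  have hη : |η * t| ≤ |η| := by
    rw [abs_mul, abs_of_nonneg ht.1]
    exact mul_le_of_le_one_right (abs_nonneg _) ht.2
  obtain ⟨h1, h2⟩ := abs_le.1 hη
  rw [dilationOp_apply, norm_mul, Complex.norm_real, Real.norm_of_nonneg (Real.exp_pos _).le,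
    mul_assoc]
  gcongr
  · linarith [abs_nonneg η]
  · refine (hf _).trans ?_
    rw [mul_assoc]
    gcongr
    rw [← div_eq_mul_inv, le_div_iff₀ (by positivity), inv_mul_le_iff₀ (by positivity)]
    have e1 : (1 : ℝ) ≤ Real.exp (2 * |η|) := Real.one_le_exp (by positivity)
    have e2 : (1 : ℝ) ≤ (Real.exp (η * t)) ^ 2 * Real.exp (2 * |η|) := by
      rw [← Real.exp_nat_mul, ← Real.exp_add]
      refine Real.one_le_exp ?_
      push_cast
      linarith
    have : x ^ 2 * 1 ≤ x ^ 2 * ((Real.exp (η * t)) ^ 2 * Real.exp (2 * |η|)) := by gcongr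
    nlinarith

theorem contractionExp_dilation (η : ℝ) :
    ContractionExp (dilationGen η)
      (fun t => (lift (dilation (η * t)) : StateSpace →L[ℂ] StateSpace)) := by
  refine ContractionExp.of_invariant (fun t => op (dilation (η * t))) ?_ ?_ ?_ ?_ ?_
  · refine (lift_eq_of_ket fun f => ?_).symm
    change ket f = ket (dilationOp (η * 0) f)
    rw [mul_zero, dilationOp_zero]
    rfl
  · intro s t _ _
    rw [← lift_mul]
    refine (lift_eq_of_ket fun f => ?_).symm
    refine (lift_ket _ f).trans ?_
    congr 1
    change dilationOp (η * s) (dilationOp (η * t) f) = dilationOp (η * (s + t)) f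
    rw [mul_add, ← dilationOp_mul]
    rfl
  · intro t _ f
    exact ((lift (dilation (η * t))).norm_map f).le
  · intro t _ f
    exact lift_ket _ f
  · intro f
    rw [mem_generatorGraph]
    obtain ⟨C, hC, hb⟩ := exists_dilationOp_bound η (dilationGen η f)
    have hb0 (x : ℝ) : ‖dilationGen η f x‖ ≤ C * (1 + x ^ 2)⁻¹ := by
      simpa [dilationOp_zero] using hb 0 (by simp) x
    have hz : Tendsto (fun t : ℝ => ket (((t⁻¹ : ℝ) : ℂ) • (dilationOp (η * t) f - f)
        - dilationGen η f)) (𝓝[>] 0) (𝓝 0) := by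
      refine tendsto_ket_zero (C := C + C) ?_ ?_
      · filter_upwards [Ioc_mem_nhdsGT (zero_lt_one' ℝ)] with t ht x
        -- The t-derivative of a dilated function is the dilate of `dilationGen η f`, which `hb`
        -- bounds uniformly on [0, 1]. By the mean value inequality the difference quotients obey
        -- the same bound, so pointwise convergence becomes L² convergence.
        have hmv := norm_image_sub_le_of_norm_deriv_le_segment' (a := 0) (b := t)
          (f := fun t => dilationOp (η * t) f x) (C := C * (1 + x ^ 2)⁻¹)
          (fun s _ => (hasDerivAt_dilationOp_param η f x s).hasDerivWithinAt)
          (fun s hs => hb s ⟨hs.1, hs.2.le.trans ht.2⟩ x) t (Set.right_mem_Icc.2 ht.1.le)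
        rw [mul_zero, dilationOp_zero, sub_zero] at hmv
        change ‖((t⁻¹ : ℝ) : ℂ) • (dilationOp (η * t) f x - f x) - dilationGen η f x‖ ≤ _
        refine (norm_sub_le _ _).trans ?_
        rw [add_mul]
        refine add_le_add ?_ (hb0 x)
        rw [norm_smul, Complex.norm_real, Real.norm_of_nonneg (inv_nonneg.2 ht.1.le),
          inv_mul_le_iff₀ ht.1, mul_comm t]
        exact hmv
      · intro x
        have hd := hasDerivAt_dilationOp_param η f x 0
        rw [hasDerivAt_iff_tendsto_slope_zero] at hd
        have hd' := (hd.mono_left (nhdsWithin_mono 0 (fun t (ht : 0 < t) => ht.ne'))).sub_const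
          (dilationOp (η * 0) (dilationGen η f) x)
        rw [sub_self] at hd'
        refine hd'.congr fun t => ?_
        rw [mul_zero, dilationOp_zero, zero_add, ← Complex.coe_smul]
        rfl
    have := hz.add_const (ket (dilationGen η f))
    rw [zero_add] at this
    refine this.congr fun t => ?_
    rw [map_sub, sub_add_cancel, map_smul, map_sub]
    have e : lift (dilation (η * t)) (ket f) = ket (dilationOp (η * t) f) := lift_ket _ f
    refine (algebraMap_smul ℂ (t⁻¹) _).trans ?_
    exact congrArg (fun z => t⁻¹ • (z - ket f)) e.symm

/-! ## Algebra of the canonical operators -/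

theorem position_mul_momentum : position * momentum = momentum * position + Complex.I • 1 := by
  refine op_ext fun f x => ?_
  change position (momentum f) x = momentum (position f) x + Complex.I • f x
  have hd : HasDerivAt (position f) (f x + x * deriv f x) x := by
    have h1 : HasDerivAt (fun y : ℝ => (y : ℂ)) 1 x := Complex.ofRealCLM.hasDerivAt
    have e : (position f : ℝ → ℂ) = fun y : ℝ => (y : ℂ) * f y := funext (position_apply f)
    rw [e]
    exact (h1.mul (f.hasDerivAt x)).congr_deriv (by ring)
  rw [position_apply, momentum_apply, momentum_apply, hd.deriv, smul_eq_mul]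
  ring

theorem conj_eq_of_mul_eq {u : schwartzUnitary} {A B : SchwartzOp} (h : op u * A = B * op u) :
    op u * A * op u⁻¹ = B := by
  rw [h, mul_assoc, op_mul_op_inv, mul_one]

theorem conj_mul (u : schwartzUnitary) (A B : SchwartzOp) :
    op u * (A * B) * op u⁻¹ = (op u * A * op u⁻¹) * (op u * B * op u⁻¹) := by
  have : (op u * A * op u⁻¹) * (op u * B * op u⁻¹)
    = op u * A * (op u⁻¹ * op u) * B * op u⁻¹ := by simp only [mul_assoc]
  rw [this, op_inv_mul_op]
  simp only [mul_assoc, one_mul]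

theorem Implements.conj_position {u : schwartzUnitary} {α β γ δ : ℂ}
    (h : Implements (op u) α β γ δ) :
    op u * position * op u⁻¹ = α • position + β • momentum :=
  conj_eq_of_mul_eq h.mul_position

theorem Implements.conj_momentum {u : schwartzUnitary} {α β γ δ : ℂ}
    (h : Implements (op u) α β γ δ) :
    op u * momentum * op u⁻¹ = γ • position + δ • momentum :=
  conj_eq_of_mul_eq h.mul_momentum

theorem sqrt_relations {m ω : ℝ} (hm : 0 < m) (hω : 0 < ω) :
    ((√(m * ω / 2) : ℝ) : ℂ) * ((√(m * ω / 2) : ℝ) : ℂ) = m * ω / 2 ∧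
    ((1 / √(2 * m * ω) : ℝ) : ℂ) * ((1 / √(2 * m * ω) : ℝ) : ℂ) = 1 / (2 * (m * ω)) ∧
    ((√(m * ω / 2) : ℝ) : ℂ) * ((1 / √(2 * m * ω) : ℝ) : ℂ) = 1 / 2 := by
  have h1 : √(m * ω / 2) * √(m * ω / 2) = m * ω / 2 := Real.mul_self_sqrt (by positivity)
  have h2 : √(2 * m * ω) * √(2 * m * ω) = 2 * m * ω := Real.mul_self_sqrt (by positivity)
  have h3 : √(m * ω / 2) ≠ 0 := (Real.sqrt_pos.2 (by positivity)).ne'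
  refine ⟨by exact_mod_cast h1, ?_, ?_⟩
  · have : 1 / √(2 * m * ω) * (1 / √(2 * m * ω)) = 1 / (2 * (m * ω)) := by
      rw [div_mul_div_comm, h2, mul_one, mul_assoc]
    exact_mod_cast this
  · have : √(m * ω / 2) * (1 / √(2 * m * ω)) = 1 / 2 := by
      rw [sqrt_two_mul]
      field_simp
    rw [← Complex.ofReal_mul, this]
    norm_num

/-- Momentum is moved to the left of position, so that operators can be compared coefficient by
coefficient. -/
theorem squeezeExponent_eq {m ω : ℝ} (hm : 0 < m) (hω : 0 < ω) (η ψ : ℝ) :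
    squeezeExponent m ω ((η : ℂ) * Complex.exp (Complex.I * (ψ : ℂ))) =
      (-(Complex.I * η * (m * ω * Real.sin ψ / 2 : ℝ))) • (position * position)
      + (Complex.I * η * (Real.sin ψ / (2 * (m * ω)) : ℝ)) • (momentum * momentum)
      + (Complex.I * η * Real.cos ψ) • (momentum * position)
      + (-(η * Real.cos ψ / 2) : ℂ) • 1 := by
  obtain ⟨hs, hr, hsr⟩ := sqrt_relations hm hω
  have hζ : (η : ℂ) * Complex.exp (Complex.I * (ψ : ℂ))
      = η * (Real.cos ψ + Complex.I * Real.sin ψ) := by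
    rw [mul_comm Complex.I, Complex.exp_mul_I]
    push_cast
    ring
  have hζ' : (starRingEnd ℂ) ((η : ℂ) * Complex.exp (Complex.I * (ψ : ℂ)))
      = η * (Real.cos ψ - Complex.I * Real.sin ψ) := by
    rw [hζ]
    simp only [map_mul, map_add, Complex.conj_ofReal, Complex.conj_I]
    ring
  rw [squeezeExponent, hζ', hζ, annihilation, creation]
  generalize ((√(m * ω / 2) : ℝ) : ℂ) = s at *
  generalize ((1 / √(2 * m * ω) : ℝ) : ℂ) = r at *
  simp only [pow_two, mul_add, add_mul, mul_sub, sub_mul, smul_mul_smul_comm,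
    position_mul_momentum]
  have hI := Complex.I_mul_I
  match_scalars
  · linear_combination (-(Complex.I * η * Complex.sin ψ)) * hs
  · linear_combination (2 * η * Complex.cos ψ * Complex.I) * hsr
  · linear_combination (η * Complex.cos ψ * s * r) * hI - η * Complex.cos ψ * hsr
  · linear_combination (Complex.I * η * Complex.sin ψ) * hr
      - (η * Complex.I * Complex.sin ψ * r * r) * hI

/-- The squeeze operator exists, preserves the Schwartz space and acts linearly on the canonical
operators. -/
theorem exists_squeeze {m ω : ℝ} (hm : 0 < m) (hω : 0 < ω) (η ψ : ℝ) :
    ∃ (S : schwartzUnitary) (U : ℝ → StateSpace →L[ℂ] StateSpace),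
      ContractionExp (squeezeExponent m ω ((η : ℂ) * Complex.exp (Complex.I * (ψ : ℂ)))) U ∧
      U 1 = (lift S : StateSpace →L[ℂ] StateSpace) ∧
      Implements (op S) (Real.cosh η + Real.cos ψ * Real.sinh η : ℝ)
        (Real.sin ψ * Real.sinh η / (m * ω) : ℝ) (m * ω * Real.sin ψ * Real.sinh η : ℝ)
        (Real.cosh η - Real.cos ψ * Real.sinh η : ℝ) := by
  obtain ⟨V, α, β, γ, δ, hV, h1, h2, h3, h4⟩ :=
    exists_implements_rotation (mul_pos hm hω).ne' ψ
  refine ⟨V * dilation (η * 1) * V⁻¹, fun t => conj V (lift (dilation (η * t)) :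
    StateSpace →L[ℂ] StateSpace), ?_, conj_lift V _, ?_⟩
  · convert (contractionExp_dilation η).conj V using 1
    have e : op V * dilationGen η * op V⁻¹ = (Complex.I * η) • (op V * (position * momentum)
        * op V⁻¹) + (η / 2 : ℂ) • 1 := by
      rw [dilationGen, mul_add, add_mul, mul_smul_comm, smul_mul_assoc, mul_smul_comm,
        smul_mul_assoc, mul_one, op_mul_op_inv]
    change _ = op V * dilationGen η * op V⁻¹
    rw [e, conj_mul, hV.conj_position, hV.conj_momentum, squeezeExponent_eq hm hω]
    simp only [add_mul, mul_add, smul_mul_smul_comm, position_mul_momentum]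
    have h1' : (α : ℂ) * δ = (1 + Real.cos ψ) / 2 := by exact_mod_cast h1
    have h2' : (β : ℂ) * γ = (Real.cos ψ - 1) / 2 := by exact_mod_cast h2
    have h3' : (α : ℂ) * γ = -(m * ω * Real.sin ψ / 2) := by exact_mod_cast h3
    have h4' : (β : ℂ) * δ = Real.sin ψ / (2 * (m * ω)) := by exact_mod_cast h4
    rw [h1', h2', h3', h4']
    match_scalars
    · ring
    · ring
    · ring
    · linear_combination (-(η * (1 + Complex.cos ψ) / 2)) * Complex.I_mul_I
  -- The matrix of V D V⁻¹ is the conjugate of diag(e^η, e^{-η}); it depends on V only through the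
  -- four prescribed products.
  · have hd : (α : ℂ) * δ - β * γ = 1 := by
      have : α * δ - β * γ = 1 := by rw [h1, h2]; ring
      exact_mod_cast this
    have h := (hV.mul (implements_dilation (η * 1))).mul (hV.inv hd)
    have e : op (V * dilation (η * 1) * V⁻¹) = op V * op (dilation (η * 1)) * op V⁻¹ := rfl
    rw [e]
    rw [mul_one] at *
    have hm' : (m * ω) ≠ 0 := (mul_pos hm hω).ne'
    have hc := Real.cosh_eq η
    have hs := Real.sinh_eq η
    convert h using 1 <;> norm_cast
    · rw [hc, hs]; linear_combination (-Real.exp η) * h1 + Real.exp (-η) * h2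
    · rw [hs]; linear_combination (-(Real.exp η - Real.exp (-η))) * h4
    · rw [hs]; linear_combination (Real.exp η - Real.exp (-η)) * h3
    · rw [hc, hs]; linear_combination Real.exp η * h2 - Real.exp (-η) * h1


/-! ## Gaussians -/

theorem abs_pow_mul_gaussian_le (n : ℕ) (x : ℝ) :
    |x| ^ n * Real.exp (-(x ^ 2 / 2)) ≤ n.factorial * Real.exp (1 / 2) := by
  have h1 : |x| ^ n ≤ n.factorial * Real.exp |x| := by
    have := Real.pow_div_factorial_le_exp |x| (abs_nonneg x) n
    rwa [div_le_iff₀' (by positivity)] at this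
  calc |x| ^ n * Real.exp (-(x ^ 2 / 2))
      ≤ n.factorial * Real.exp |x| * Real.exp (-(x ^ 2 / 2)) := by gcongr
    _ = n.factorial * Real.exp (|x| + -(x ^ 2 / 2)) := by rw [mul_assoc, Real.exp_add]
    _ ≤ n.factorial * Real.exp (1 / 2) := by
      gcongr
      nlinarith [sq_abs x, sq_nonneg (|x| - 1)]

theorem exists_polynomial_mul_gaussian_le (p : Polynomial ℝ) :
    ∃ C, ∀ x : ℝ, |p.eval x| * Real.exp (-(x ^ 2 / 2)) ≤ C := by
  induction p using Polynomial.induction_on' with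
  | add p q hp hq =>
    obtain ⟨C, hC⟩ := hp
    obtain ⟨D, hD⟩ := hq
    refine ⟨C + D, fun x => ?_⟩
    rw [Polynomial.eval_add]
    calc |p.eval x + q.eval x| * Real.exp (-(x ^ 2 / 2))
        ≤ (|p.eval x| + |q.eval x|) * Real.exp (-(x ^ 2 / 2)) := by gcongr; exact abs_add_le _ _
      _ ≤ C + D := by rw [add_mul]; exact add_le_add (hC x) (hD x)
  | monomial n a =>
    refine ⟨|a| * (n.factorial * Real.exp (1 / 2)), fun x => ?_⟩
    rw [Polynomial.eval_monomial, abs_mul, abs_pow, mul_assoc]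
    exact mul_le_mul_of_nonneg_left (abs_pow_mul_gaussian_le n x) (abs_nonneg a)

/-- The function `exp (-x² / 2)`. -/
def stdGaussian : 𝓢(ℝ, ℝ) where
  toFun x := Real.exp (-(x ^ 2 / 2))
  smooth' := by fun_prop
  decay' k n := by
    -- The n-th derivative of the Gaussian is, up to sign, the n-th Hermite polynomial times the
    -- Gaussian, so each seminorm is a bound on a polynomial times a Gaussian.
    obtain ⟨C, hC⟩ := exists_polynomial_mul_gaussian_le
      (Polynomial.X ^ k * (Polynomial.hermite n).map (Int.castRingHom ℝ))
    refine ⟨C, fun x => le_trans (le_of_eq ?_) (hC x)⟩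
    rw [norm_iteratedFDeriv_eq_norm_iteratedDeriv, iteratedDeriv_eq_iterate,
      Polynomial.deriv_gaussian_eq_hermite_mul_gaussian, Polynomial.eval_mul, Polynomial.eval_pow,
      Polynomial.eval_X, Polynomial.eval_map, abs_mul, abs_pow, norm_mul, norm_mul, norm_pow,
      norm_neg, norm_one, one_pow, one_mul, Real.norm_eq_abs, Real.norm_eq_abs, Real.norm_eq_abs,
      abs_of_pos (Real.exp_pos _), mul_assoc, Polynomial.aeval_def]
    rfl

/-- A positive multiple of the function `exp (-κ x² / 2)`. -/
def gaussian (κ : ℝ) : 𝓢(ℝ, ℂ) :=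
  dilationOp (Real.log κ / 2) (SchwartzMap.postcompCLM Complex.ofRealCLM stdGaussian)

theorem gaussian_apply {κ : ℝ} (hκ : 0 < κ) (x : ℝ) :
    gaussian κ x = ((Real.exp (Real.log κ / 4) * Real.exp (-(κ * x ^ 2 / 2)) : ℝ) : ℂ) := by
  have e : Real.exp (Real.log κ / 2) ^ 2 = κ := by
    rw [← Real.exp_nat_mul]
    push_cast
    rw [mul_div_cancel₀ _ two_ne_zero, Real.exp_log hκ]
  rw [gaussian, dilationOp_apply, SchwartzMap.postcompCLM_apply]
  change _ * ((Real.exp (-((Real.exp (Real.log κ / 2) * x) ^ 2 / 2)) : ℝ) : ℂ) = _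
  rw [mul_pow, e, ← Complex.ofReal_mul]
  congr 3
  ring

theorem hasDerivAt_gaussian {κ : ℝ} (hκ : 0 < κ) (x : ℝ) :
    HasDerivAt (gaussian κ) (-(κ * x) * gaussian κ x) x := by
  rw [show (gaussian κ : ℝ → ℂ) = fun x => ((Real.exp (Real.log κ / 4) *
    Real.exp (-(κ * x ^ 2 / 2)) : ℝ) : ℂ) from funext (gaussian_apply hκ)]
  have h1 : HasDerivAt (fun x : ℝ => -(κ * x ^ 2 / 2)) (-(κ * x)) x := by
    refine ((((hasDerivAt_pow 2 x).const_mul κ).div_const 2).neg).congr_deriv ?_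
    simp
    ring
  refine ((h1.exp.const_mul (Real.exp (Real.log κ / 4))).ofReal_comp).congr_deriv ?_
  push_cast
  ring

theorem gaussian_ne_zero {κ : ℝ} (hκ : 0 < κ) : gaussian κ ≠ 0 := by
  intro h
  have h0 := gaussian_apply hκ 0
  rw [h] at h0
  have : Real.exp (Real.log κ / 4) * Real.exp (-(κ * 0 ^ 2 / 2)) = 0 :=
    Complex.ofReal_injective (by simpa using! h0.symm)
  exact (mul_pos (Real.exp_pos _) (Real.exp_pos _)).ne' this

/-! ## Adjoint relations on the Schwartz space -/

theorem inner_ket (f g : 𝓢(ℝ, ℂ)) : inner ℂ (ket f) (ket g) = ∫ x, inner ℂ (f x) (g x) :=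
  SchwartzMap.inner_toL2_toL2_eq f g

theorem inner_position (f g : 𝓢(ℝ, ℂ)) :
    inner ℂ (ket (position f)) (ket g) = inner ℂ (ket f) (ket (position g)) := by
  rw [inner_ket, inner_ket]
  congr 1
  funext x
  rw [position_apply, position_apply]
  simp only [RCLike.inner_apply, map_mul, Complex.conj_ofReal]
  ring

theorem inner_momentum (f g : 𝓢(ℝ, ℂ)) :
    inner ℂ (ket (momentum f)) (ket g) = inner ℂ (ket f) (ket (momentum g)) := by
  rw [inner_ket, inner_ket]
  have h := SchwartzMap.integral_bilinear_deriv_right_eq_neg_left f g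
    (isBoundedBilinearMap_inner (𝕜 := ℂ) (E := ℂ)).toContinuousLinearMap
  have h' : ∫ x, inner ℂ (f x) (deriv g x) = -∫ x, inner ℂ (deriv f x) (g x) := h
  have e1 (x : ℝ) : inner ℂ (momentum f x) (g x) = Complex.I * inner ℂ (deriv f x) (g x) := by
    rw [momentum_apply]
    simp only [RCLike.inner_apply, map_mul, map_neg, Complex.conj_I]
    ring
  have e2 (x : ℝ) : inner ℂ (f x) (momentum g x) = -Complex.I * inner ℂ (f x) (deriv g x) := by
    rw [momentum_apply]
    simp only [RCLike.inner_apply]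
    ring
  simp_rw [e1, e2]
  rw [integral_const_mul, integral_const_mul, h']
  ring

variable {m ω : ℝ}

theorem annihilation_apply' (f : 𝓢(ℝ, ℂ)) : annihilation m ω f =
    ((√(m * ω / 2) : ℝ) : ℂ) • position f
      + (Complex.I * ((1 / √(2 * m * ω) : ℝ) : ℂ)) • momentum f := rfl

theorem creation_apply' (f : 𝓢(ℝ, ℂ)) : creation m ω f =
    ((√(m * ω / 2) : ℝ) : ℂ) • position f
      - (Complex.I * ((1 / √(2 * m * ω) : ℝ) : ℂ)) • momentum f := rfl

theorem inner_annihilation (f g : 𝓢(ℝ, ℂ)) :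
    inner ℂ (ket (annihilation m ω f)) (ket g) = inner ℂ (ket f) (ket (creation m ω g)) := by
  rw [annihilation_apply', creation_apply']
  simp only [map_add, map_sub, map_smul, inner_add_left, inner_sub_right, inner_smul_left,
    inner_smul_right, map_mul, Complex.conj_ofReal, Complex.conj_I, inner_position, inner_momentum]
  ring

theorem inner_creation (f g : 𝓢(ℝ, ℂ)) :
    inner ℂ (ket (creation m ω f)) (ket g) = inner ℂ (ket f) (ket (annihilation m ω g)) := by
  rw [annihilation_apply', creation_apply']
  simp only [map_add, map_sub, map_smul, inner_add_right, inner_sub_left, inner_smul_left,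
    inner_smul_right, map_mul, Complex.conj_ofReal, Complex.conj_I, inner_position, inner_momentum]
  ring

/-! ## Hermite functions -/

theorem annihilation_mul_creation (hm : 0 < m) (hω : 0 < ω) :
    annihilation m ω * creation m ω = creation m ω * annihilation m ω + 1 := by
  obtain ⟨-, -, hsr⟩ := sqrt_relations hm hω
  rw [annihilation, creation]
  generalize ((√(m * ω / 2) : ℝ) : ℂ) = s at *
  generalize ((1 / √(2 * m * ω) : ℝ) : ℂ) = r at *
  simp only [mul_add, add_mul, mul_sub, sub_mul, smul_mul_smul_comm,
    position_mul_momentum]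
  match_scalars
  · ring
  · ring
  · linear_combination (-2 * s * r) * Complex.I_mul_I + 2 * hsr
  · ring

theorem annihilation_gaussian (hm : 0 < m) (hω : 0 < ω) :
    annihilation m ω (gaussian (m * ω)) = 0 := by
  obtain ⟨-, hr, hsr⟩ := sqrt_relations hm hω
  ext x
  have hr' : (m * ω : ℂ) * (((1 / √(2 * m * ω) : ℝ) : ℂ) * ((1 / √(2 * m * ω) : ℝ) : ℂ))
      = 1 / 2 := by
    have hm' : (m : ℂ) ≠ 0 := by exact_mod_cast hm.ne'
    have hω' : (ω : ℂ) ≠ 0 := by exact_mod_cast hω.ne'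
    rw [hr]
    field_simp
  have hs : ((√(m * ω / 2) : ℝ) : ℂ) = m * ω * ((1 / √(2 * m * ω) : ℝ) : ℂ) := by
    have h0 : ((1 / √(2 * m * ω) : ℝ) : ℂ) ≠ 0 := right_ne_zero_of_mul_eq_one
      (a := 2 * ((√(m * ω / 2) : ℝ) : ℂ)) (by linear_combination 2 * hsr)
    apply mul_right_cancel₀ h0
    rw [hsr, mul_assoc, hr']
  change ((√(m * ω / 2) : ℝ) : ℂ) * position (gaussian (m * ω)) x
      + (Complex.I * ((1 / √(2 * m * ω) : ℝ) : ℂ)) * momentum (gaussian (m * ω)) x = 0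
  rw [position_apply, momentum_apply, (hasDerivAt_gaussian (mul_pos hm hω) x).deriv, hs,
    Complex.ofReal_mul m ω]
  linear_combination (m * ω * x * ((1 / √(2 * m * ω) : ℝ) : ℂ) * gaussian (m * ω) x)
    * Complex.I_mul_I

/-- The Hermite functions, the normalised eigenfunctions of the oscillator. -/
def hermite (m ω : ℝ) : ℕ → 𝓢(ℝ, ℂ)
  | 0 => ((‖ket (gaussian (m * ω))‖⁻¹ : ℝ) : ℂ) • gaussian (m * ω)
  | n + 1 => ((1 / √(n + 1) : ℝ) : ℂ) • creation m ω (hermite m ω n)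

theorem creation_hermite (n : ℕ) :
    creation m ω (hermite m ω n) = ((√(n + 1) : ℝ) : ℂ) • hermite m ω (n + 1) := by
  rw [hermite, smul_smul, ← Complex.ofReal_mul, mul_one_div_cancel (by positivity),
    Complex.ofReal_one, one_smul]

theorem annihilation_hermite_zero (hm : 0 < m) (hω : 0 < ω) :
    annihilation m ω (hermite m ω 0) = 0 := by
  rw [hermite, map_smul, annihilation_gaussian hm hω, smul_zero]

theorem sqrt_mul_sqrt_succ (n : ℕ) : ((√(n + 1) : ℝ) : ℂ) * ((√(n + 1) : ℝ) : ℂ) = n + 1 := by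
  rw [← Complex.ofReal_mul, Real.mul_self_sqrt (by positivity)]
  push_cast
  ring

theorem annihilation_creation_apply (hm : 0 < m) (hω : 0 < ω) (f : 𝓢(ℝ, ℂ)) :
    annihilation m ω (creation m ω f) = creation m ω (annihilation m ω f) + f :=
  DFunLike.congr_fun (annihilation_mul_creation hm hω) f

theorem natCast_smul_add_self (n : ℕ) (f : 𝓢(ℝ, ℂ)) :
    (n : ℂ) • f + f = (n + 1 : ℂ) • f := by
  rw [add_smul, one_smul]

theorem creation_annihilation_hermite (hm : 0 < m) (hω : 0 < ω) (n : ℕ) :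
    creation m ω (annihilation m ω (hermite m ω n)) = (n : ℂ) • hermite m ω n := by
  induction n with
  | zero => rw [annihilation_hermite_zero hm hω, map_zero]; simp
  | succ n ih =>
    rw [hermite, map_smul, annihilation_creation_apply hm hω, ih, map_smul, map_add, map_smul,
      natCast_smul_add_self, smul_comm]
    push_cast
    rfl

theorem annihilation_hermite_succ (hm : 0 < m) (hω : 0 < ω) (n : ℕ) :
    annihilation m ω (hermite m ω (n + 1)) = ((√(n + 1) : ℝ) : ℂ) • hermite m ω n := by
  rw [hermite, map_smul, annihilation_creation_apply hm hω, creation_annihilation_hermite hm hω,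
    natCast_smul_add_self, smul_smul, ← sqrt_mul_sqrt_succ, ← mul_assoc, ← Complex.ofReal_mul,
    one_div_mul_cancel (by positivity), Complex.ofReal_one, one_mul]

theorem number_hermite (hm : 0 < m) (hω : 0 < ω) (n : ℕ) :
    number m ω (hermite m ω n) = (n + 1 / 2 : ℂ) • hermite m ω n := by
  change creation m ω (annihilation m ω (hermite m ω n)) + (1 / 2 : ℂ) • hermite m ω n = _
  rw [creation_annihilation_hermite hm hω, add_smul]

theorem inner_number (f g : 𝓢(ℝ, ℂ)) :
    inner ℂ (ket (number m ω f)) (ket g) = inner ℂ (ket f) (ket (number m ω g)) := by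
  change inner ℂ (ket (creation m ω (annihilation m ω f) + (1 / 2 : ℂ) • f)) (ket g) =
    inner ℂ (ket f) (ket (creation m ω (annihilation m ω g) + (1 / 2 : ℂ) • g))
  simp only [map_add, map_smul, inner_add_left, inner_add_right, inner_smul_left,
    inner_smul_right, inner_creation, ← inner_annihilation, map_div₀, map_one, map_ofNat]

theorem norm_ket_hermite (hm : 0 < m) (hω : 0 < ω) (n : ℕ) : ‖ket (hermite m ω n)‖ = 1 := by
  induction n with
  | zero =>
    have h0 : ‖ket (gaussian (m * ω))‖ ≠ 0 := by
      rw [norm_ne_zero_iff]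
      intro h
      exact gaussian_ne_zero (mul_pos hm hω) (ket_injective (h.trans (map_zero ket).symm))
    rw [hermite, map_smul, norm_smul, Complex.norm_real, norm_inv, norm_norm, inv_mul_cancel₀ h0]
  | succ n ih =>
    have h : inner ℂ (ket (creation m ω (hermite m ω n))) (ket (creation m ω (hermite m ω n)))
        = (n + 1 : ℂ) := by
      rw [inner_creation, annihilation_creation_apply hm hω, creation_annihilation_hermite hm hω,
        natCast_smul_add_self, map_smul, inner_smul_right, inner_self_eq_norm_sq_to_K, ih]
      simp
    rw [inner_self_eq_norm_sq_to_K] at h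
    have h' : ‖ket (creation m ω (hermite m ω n))‖ ^ 2 = n + 1 := by
      apply Complex.ofReal_injective
      push_cast
      exact h
    rw [hermite, map_smul, norm_smul, Complex.norm_real, Real.norm_of_nonneg (by positivity),
      ← Real.sqrt_sq (norm_nonneg (ket (creation m ω (hermite m ω n)))), h',
      one_div_mul_cancel (by positivity)]

/-- Orthogonality comes from distinct eigenvalues of the symmetric number operator. -/
theorem orthonormal_hermite (hm : 0 < m) (hω : 0 < ω) :
    Orthonormal ℂ (fun n => ket (hermite m ω n)) := by
  refine ⟨norm_ket_hermite hm hω, fun i j hij => ?_⟩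
  have h := inner_number (m := m) (ω := ω) (hermite m ω i) (hermite m ω j)
  rw [number_hermite hm hω, number_hermite hm hω, map_smul, map_smul, inner_smul_left,
    inner_smul_right] at h
  have h2 : ((i : ℂ) - j) * inner ℂ (ket (hermite m ω i)) (ket (hermite m ω j)) = 0 := by
    simp only [map_add, map_natCast, map_div₀, map_one, map_ofNat] at h
    linear_combination h
  rcases mul_eq_zero.1 h2 with h3 | h3
  · exact absurd (by exact_mod_cast sub_eq_zero.1 h3) hij
  · exact h3


/-! ## Completeness of the Hermite functions -/

open FourierTransform in
-- Every test function is the Fourier transform of a Schwartz function K, and the transform can be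
-- moved from K to H under the integral.
theorem ae_eq_zero_of_fourier_eq_zero {H : ℝ → ℂ} (hH : Integrable H)
    (h : ∀ t, 𝓕 H t = 0) : H =ᵐ[volume] 0 := by
  refine ae_eq_zero_of_integral_contDiff_smul_eq_zero hH.locallyIntegrable fun g hg hgs => ?_
  have hgs' : HasCompactSupport (fun x => (g x : ℂ)) := hgs.comp_left Complex.ofReal_zero
  let G : 𝓢(ℝ, ℂ) := hgs'.toSchwartzMap (Complex.ofRealCLM.contDiff.comp hg)
  let K : 𝓢(ℝ, ℂ) := 𝓕⁻ G
  have h1 := VectorFourier.integral_fourierIntegral_smul_eq_flip (L := innerₗ ℝ)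
    Real.continuous_fourierChar continuous_inner K.integrable hH (μ := volume) (ν := volume)
  have h2 (x : ℝ) : VectorFourier.fourierIntegral Real.fourierChar volume (innerₗ ℝ).flip H x
      = 0 := by
    rw [← h x]
    simp [VectorFourier.fourierIntegral, Real.fourier_eq]
  simp only [h2, smul_zero, integral_zero] at h1
  rw [← h1]
  congr 1
  funext x
  have h3 : VectorFourier.fourierIntegral Real.fourierChar volume (innerₗ ℝ) K x
      = (𝓕 K : 𝓢(ℝ, ℂ)) x := rfl
  have h4 : 𝓕 K = G := fourier_fourierInv_eq G
  rw [h3, h4]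
  rfl

open FourierTransform in
-- Exponential integrability permits expanding exp(-2πixt) under the integral, so the Fourier
-- transform of H is a power series whose coefficients are multiples of the moments.
theorem ae_eq_zero_of_moments_eq_zero {H : ℝ → ℂ} (hm : AEStronglyMeasurable H volume)
    (hint : ∀ c : ℝ, Integrable (fun x => Real.exp (c * |x|) * ‖H x‖))
    (h : ∀ k : ℕ, ∫ x : ℝ, (x : ℂ) ^ k * H x = 0) : H =ᵐ[volume] 0 := by
  have hH : Integrable H := by
    have := hint 0
    simp only [zero_mul, Real.exp_zero, one_mul] at this
    exact (integrable_norm_iff hm).1 this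
  refine ae_eq_zero_of_fourier_eq_zero hH fun t => ?_
  rw [Real.fourier_real_eq_integral_exp_smul]
  set z : ℂ := -2 * Real.pi * t * Complex.I with hz
  have hs (x : ℝ) : HasSum (fun n : ℕ => z ^ n / n.factorial * ((x : ℂ) ^ n * H x))
      (Complex.exp (((-2 * Real.pi * x * t : ℝ) : ℂ) * Complex.I) • H x) := by
    have h1 := (NormedSpace.expSeries_div_hasSum_exp (z * x)).mul_right (H x)
    rw [← Complex.exp_eq_exp_ℂ] at h1
    have e : ((-2 * Real.pi * x * t : ℝ) : ℂ) * Complex.I = z * x := by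
      rw [hz]; push_cast; ring
    rw [e, smul_eq_mul]
    have e2 : (fun n : ℕ => z ^ n / n.factorial * ((x : ℂ) ^ n * H x))
        = fun n : ℕ => (z * x) ^ n / n.factorial * H x := by
      funext n
      rw [mul_pow]
      ring
    rw [e2]
    exact h1
  have hb (x : ℝ) : HasSum (fun n : ℕ => (‖z‖ * |x|) ^ n / n.factorial * ‖H x‖)
      (Real.exp (‖z‖ * |x|) * ‖H x‖) := by
    have h1 := (NormedSpace.expSeries_div_hasSum_exp (‖z‖ * |x|)).mul_right (‖H x‖)
    rwa [← Real.exp_eq_exp_ℝ] at h1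
  have key := hasSum_integral_of_dominated_convergence (μ := volume)
    (F := fun (n : ℕ) (x : ℝ) => z ^ n / n.factorial * ((x : ℂ) ^ n * H x))
    (fun n x => (‖z‖ * |x|) ^ n / n.factorial * ‖H x‖)
    (fun n => by
      have : Continuous fun x : ℝ => (x : ℂ) ^ n := by fun_prop
      exact (this.aestronglyMeasurable.mul hm).const_mul _)
    (fun n => Eventually.of_forall fun x => by
      rw [norm_mul, norm_mul, norm_div, norm_pow, norm_pow, Complex.norm_real, Real.norm_eq_abs,
        Complex.norm_natCast]
      exact le_of_eq (by ring))
    (Eventually.of_forall fun x => (hb x).summable)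
    (by simp_rw [(hb _).tsum_eq]; exact hint _)
    (Eventually.of_forall hs)
  simp_rw [integral_const_mul, h, mul_zero] at key
  exact key.unique hasSum_zero

variable {m ω : ℝ}

theorem position_mem_span_hermite (hm : 0 < m) (hω : 0 < ω) {f : 𝓢(ℝ, ℂ)}
    (hf : f ∈ Submodule.span ℂ (Set.range (hermite m ω))) :
    position f ∈ Submodule.span ℂ (Set.range (hermite m ω)) := by
  induction hf using Submodule.span_induction with
  | mem f hf =>
    obtain ⟨n, rfl⟩ := hf
    have hmem (k : ℕ) : hermite m ω k ∈ Submodule.span ℂ (Set.range (hermite m ω)) :=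
      Submodule.subset_span ⟨k, rfl⟩
    rw [position_eq hm hω]
    refine Submodule.smul_mem _ _ (Submodule.add_mem _ ?_ ?_)
    · change creation m ω (hermite m ω n) ∈ _
      rw [creation_hermite]
      exact Submodule.smul_mem _ _ (hmem _)
    · cases n with
      | zero =>
        change annihilation m ω (hermite m ω 0) ∈ _
        rw [annihilation_hermite_zero hm hω]; exact Submodule.zero_mem _
      | succ n =>
        change annihilation m ω (hermite m ω (n + 1)) ∈ _
        rw [annihilation_hermite_succ hm hω]
        exact Submodule.smul_mem _ _ (hmem _)
  | zero => rw [map_zero]; exact Submodule.zero_mem _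
  | add f g _ _ hf hg => rw [map_add]; exact Submodule.add_mem _ hf hg
  | smul c f _ hf => rw [map_smul]; exact Submodule.smul_mem _ _ hf

theorem pow_position_apply (k : ℕ) (f : 𝓢(ℝ, ℂ)) (x : ℝ) :
    (position ^ k) f x = (x : ℂ) ^ k * f x := by
  induction k with
  | zero => simp
  | succ k ih =>
    rw [pow_succ']
    change position ((position ^ k) f) x = _
    rw [position_apply, ih]
    ring

theorem pow_position_gaussian_mem (hm : 0 < m) (hω : 0 < ω) (k : ℕ) :
    (position ^ k) (gaussian (m * ω)) ∈ Submodule.span ℂ (Set.range (hermite m ω)) := by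
  induction k with
  | zero =>
    have h0 : ‖ket (gaussian (m * ω))‖ ≠ 0 := by
      rw [norm_ne_zero_iff]
      intro h
      exact gaussian_ne_zero (mul_pos hm hω) (ket_injective (h.trans (map_zero ket).symm))
    have e : gaussian (m * ω) = ((‖ket (gaussian (m * ω))‖ : ℝ) : ℂ) • hermite m ω 0 := by
      rw [hermite, smul_smul, ← Complex.ofReal_mul, mul_inv_cancel₀ h0, Complex.ofReal_one,
        one_smul]
    change gaussian (m * ω) ∈ _
    rw [e]
    exact Submodule.smul_mem _ _ (Submodule.subset_span ⟨0, rfl⟩)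
  | succ k ih =>
    rw [pow_succ']
    exact position_mem_span_hermite hm hω ih

theorem inner_ket_left (f : 𝓢(ℝ, ℂ)) (y : StateSpace) :
    inner ℂ (ket f) y = ∫ x, inner ℂ (f x) (y x) := by
  rw [L2.inner_def]
  refine integral_congr_ae ?_
  filter_upwards [f.coeFn_toLp 2 volume] with x hx
  rw [ket_apply, hx]

/-- Completing the square, c|x| ≤ c²/κ + κx²/4: half of the Gaussian decay pays for the exponential.
-/
theorem exp_mul_gaussian_le {κ : ℝ} (hκ : 0 < κ) (c : ℝ) :
    ∃ C : ℝ, ∀ x, Real.exp (c * |x|) * ‖gaussian κ x‖ ≤ C * ‖gaussian (κ / 2) x‖ := by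
  refine ⟨Real.exp (c ^ 2 / κ) * Real.exp (Real.log κ / 4) / Real.exp (Real.log (κ / 2) / 4),
    fun x => ?_⟩
  rw [gaussian_apply hκ, gaussian_apply (half_pos hκ), Complex.norm_real, Complex.norm_real,
    Real.norm_of_nonneg (by positivity), Real.norm_of_nonneg (by positivity)]
  have e : c * |x| + -(κ * x ^ 2 / 2) ≤ c ^ 2 / κ + -(κ / 2 * x ^ 2 / 2) := by
    have h1 : c ^ 2 / κ + -(κ / 2 * x ^ 2 / 2) - (c * |x| + -(κ * x ^ 2 / 2))
        = (c - κ * |x| / 2) ^ 2 / κ := by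
      rw [← sq_abs x]
      field_simp
      ring
    have h2 : 0 ≤ (c - κ * |x| / 2) ^ 2 / κ := by positivity
    linarith
  have e' := Real.exp_le_exp.2 e
  rw [Real.exp_add, Real.exp_add] at e'
  calc Real.exp (c * |x|) * (Real.exp (Real.log κ / 4) * Real.exp (-(κ * x ^ 2 / 2)))
      = Real.exp (Real.log κ / 4) * (Real.exp (c * |x|) * Real.exp (-(κ * x ^ 2 / 2))) := by ring
    _ ≤ Real.exp (Real.log κ / 4) * (Real.exp (c ^ 2 / κ) *
        Real.exp (-(κ / 2 * x ^ 2 / 2))) := by gcongr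
    _ = _ := by
      have := (Real.exp_pos (Real.log (κ / 2) / 4)).ne'
      field_simp

theorem integrable_schwartz_mul (f : 𝓢(ℝ, ℂ)) (y : StateSpace) :
    Integrable (fun x => f x * y x) :=
  (f.memLp 2 volume).integrable_mul (Lp.memLp y)

/-- The Hermite span contains every monomial times the ground-state Gaussian, so all moments of
Gaussian · y vanish. This product has all exponential moments, hence vanishes almost everywhere, and
the Gaussian has no zeros. -/
theorem eq_zero_of_inner_hermite (hm : 0 < m) (hω : 0 < ω) {y : StateSpace}
    (hy : ∀ n, inner ℂ (ket (hermite m ω n)) y = 0) : y = 0 := by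
  have hκ := mul_pos hm hω
  have hspan (f : 𝓢(ℝ, ℂ)) (hf : f ∈ Submodule.span ℂ (Set.range (hermite m ω))) :
      inner ℂ (ket f) y = 0 := by
    induction hf using Submodule.span_induction with
    | mem f hf => obtain ⟨n, rfl⟩ := hf; exact hy n
    | zero => rw [map_zero, inner_zero_left]
    | add f g _ _ hf hg => rw [map_add, inner_add_left, hf, hg, add_zero]
    | smul c f _ hf => rw [map_smul, inner_smul_left, hf, mul_zero]
  have hH : (fun x => gaussian (m * ω) x * y x) =ᵐ[volume] 0 := by
    refine ae_eq_zero_of_moments_eq_zero (integrable_schwartz_mul _ y).aestronglyMeasurable ?_ ?_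
    · intro c
      obtain ⟨C, hC⟩ := exp_mul_gaussian_le hκ c
      refine ((integrable_schwartz_mul (gaussian (m * ω / 2)) y).norm.const_mul C).mono' ?_ ?_
      · exact (by fun_prop : Continuous fun x : ℝ => Real.exp (c * |x|)).aestronglyMeasurable.mul
          (integrable_schwartz_mul _ y).aestronglyMeasurable.norm
      · refine Eventually.of_forall fun x => ?_
        rw [Real.norm_of_nonneg (by positivity), norm_mul, norm_mul, ← mul_assoc, ← mul_assoc]
        exact mul_le_mul_of_nonneg_right (hC x) (norm_nonneg _)
    · intro k
      rw [← hspan _ (pow_position_gaussian_mem hm hω k), inner_ket_left]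
      refine integral_congr_ae (Eventually.of_forall fun x => ?_)
      change (x : ℂ) ^ k * (gaussian (m * ω) x * y x)
        = inner ℂ ((position ^ k) (gaussian (m * ω)) x) (y x)
      rw [pow_position_apply, gaussian_apply hκ]
      simp only [RCLike.inner_apply, map_mul, map_pow, Complex.conj_ofReal]
      ring
  rw [Lp.eq_zero_iff_ae_eq_zero]
  filter_upwards [hH] with x hx
  rw [gaussian_apply hκ] at hx
  refine (mul_eq_zero.1 hx).resolve_left ?_
  exact Complex.ofReal_ne_zero.2 (by positivity)

/-- The Hilbert basis of Hermite functions. -/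
def hermiteBasis (hm : 0 < m) (hω : 0 < ω) : HilbertBasis ℕ ℂ StateSpace :=
  HilbertBasis.mkOfOrthogonalEqBot (orthonormal_hermite hm hω) (by
    rw [Submodule.eq_bot_iff]
    intro y hy
    refine eq_zero_of_inner_hermite hm hω fun n => ?_
    exact (Submodule.mem_orthogonal _ y).1 hy _ (Submodule.subset_span ⟨n, rfl⟩))

theorem hermiteBasis_apply (hm : 0 < m) (hω : 0 < ω) (n : ℕ) :
    hermiteBasis hm hω n = ket (hermite m ω n) :=
  congrFun (HilbertBasis.coe_mkOfOrthogonalEqBot _ _) n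


/-! ## Diagonal operators -/

/-- The operator that is diagonal in a Hilbert basis, with the given eigenvalues. -/
def diag (e : HilbertBasis ℕ ℂ StateSpace) (μ : ℕ → ℂ) (hμ : ∀ n, ‖μ n‖ ≤ 1) :
    StateSpace →L[ℂ] StateSpace :=
  have hle (f : StateSpace) (n : ℕ) : ‖μ n * e.repr f n‖ ≤ ‖e.repr f n‖ := by
    rw [norm_mul]
    exact mul_le_of_le_one_left (norm_nonneg _) (hμ n)
  have hmem (f : StateSpace) : Memℓp (fun n => μ n * e.repr f n) 2 :=
    (lp.memℓp (e.repr f)).mono' (hle f)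
  LinearMap.mkContinuous
    { toFun := fun f => e.repr.symm ⟨fun n => μ n * e.repr f n, hmem f⟩
      map_add' := fun f g => by
        rw [← map_add]
        congr 1
        ext n
        simp [mul_add]
        rfl
      map_smul' := fun c f => by
        rw [← map_smul]
        congr 1
        ext n
        simp [mul_left_comm] } 1 fun f => by
    rw [one_mul, ← e.repr.norm_map f]
    refine (e.repr.symm.norm_map _).le.trans ?_
    exact lp.norm_mono two_ne_zero (hle f)

variable {e : HilbertBasis ℕ ℂ StateSpace} {μ : ℕ → ℂ} {hμ : ∀ n, ‖μ n‖ ≤ 1}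

theorem inner_diag (f : StateSpace) (n : ℕ) :
    inner ℂ (e n) (diag e μ hμ f) = μ n * inner ℂ (e n) f := by
  rw [← e.repr_apply_apply, ← e.repr_apply_apply]
  exact congrArg (fun v : lp (fun _ : ℕ => ℂ) 2 => v n) (e.repr.apply_symm_apply _)

theorem norm_diag_apply_le (f : StateSpace) : ‖diag e μ hμ f‖ ≤ ‖f‖ := by
  rw [← e.repr.norm_map, ← e.repr.norm_map f]
  refine lp.norm_mono two_ne_zero fun n => ?_
  rw [e.repr_apply_apply, e.repr_apply_apply, inner_diag, norm_mul]
  exact mul_le_of_le_one_left (norm_nonneg _) (hμ n)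

theorem eq_of_inner_basis {f g : StateSpace} (h : ∀ n, inner ℂ (e n) f = inner ℂ (e n) g) :
    f = g := by
  apply e.repr.injective
  ext n
  rw [e.repr_apply_apply, e.repr_apply_apply, h]

theorem diag_apply_basis (n : ℕ) : diag e μ hμ (e n) = μ n • e n := by
  refine eq_of_inner_basis (e := e) fun k => ?_
  rw [inner_diag, inner_smul_right]
  by_cases h : k = n
  · rw [h]
  · rw [e.orthonormal.2 h, mul_zero, mul_zero]

/-- A Schwartz operator with an eigenbasis generates a semigroup of diagonal operators. -/
theorem contractionExp_diag {B : SchwartzOp} {h : ℕ → 𝓢(ℝ, ℂ)} {l : ℕ → ℂ}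
    (he : ∀ n, e n = ket (h n)) (hB : ∀ n, B (h n) = l n • h n)
    (hsymm : ∀ n f, inner ℂ (e n) (ket (B f)) = l n * inner ℂ (e n) (ket f))
    (hl : ∀ n, (l n).re ≤ 0) (ν : ℝ → ℕ → ℂ) (hν : ∀ t n, ‖ν t n‖ ≤ 1)
    (hexp : ∀ t, 0 ≤ t → ∀ n, ν t n = Complex.exp (t * l n)) :
    ContractionExp B (fun t => diag e (ν t) (hν t)) := by
  set D : Submodule ℂ 𝓢(ℝ, ℂ) := Submodule.span ℂ (Set.range h) with hD
  have hmem (n : ℕ) : h n ∈ D := Submodule.subset_span ⟨n, rfl⟩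
  have hsum (f : StateSpace) : HasSum (fun n => inner ℂ (e n) f • e n) f := by
    simpa [e.repr_apply_apply] using e.hasSum_repr f
  refine ContractionExp.of_core D ?_ ?_ ?_ ?_ ?_ ?_ ?_
  · refine ContinuousLinearMap.ext fun f => eq_of_inner_basis (e := e) fun n => ?_
    rw [inner_diag, hexp 0 le_rfl]
    simp
  · intro s t hs ht
    refine ContinuousLinearMap.ext fun f => eq_of_inner_basis (e := e) fun n => ?_
    change _ = inner ℂ (e n) (diag e (ν s) (hν s) (diag e (ν t) (hν t) f))
    rw [inner_diag, inner_diag, inner_diag, hexp _ (add_nonneg hs ht), hexp s hs, hexp t ht,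
      Complex.ofReal_add, add_mul, Complex.exp_add, mul_assoc]
  · intro t _ f
    exact norm_diag_apply_le f
  · intro f
    refine mem_closure_of_tendsto (hsum f) (Eventually.of_forall fun s => ?_)
    refine ⟨∑ n ∈ s, inner ℂ (e n) f • h n, Submodule.sum_mem _ fun n _ =>
      Submodule.smul_mem _ _ (hmem n), ?_⟩
    simp [map_sum, map_smul, he]
  · intro f
    -- By `hsymm`, B maps the partial sums of the expansion of f to the partial sums of the
    -- expansion of Bf, so the span of the eigenvectors is a core.
    have h1 : Tendsto (fun s : Finset ℕ => (∑ n ∈ s, inner ℂ (e n) (ket f) • e n,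
        ∑ n ∈ s, inner ℂ (e n) (ket (B f)) • e n)) atTop (𝓝 (ket f, ket (B f))) :=
      (hsum (ket f)).prodMk_nhds (hsum (ket (B f)))
    refine mem_closure_of_tendsto h1 (Eventually.of_forall fun s => ?_)
    refine ⟨∑ n ∈ s, inner ℂ (e n) (ket f) • h n, Submodule.sum_mem _ fun n _ =>
      Submodule.smul_mem _ _ (hmem n), ?_⟩
    simp only [map_sum, map_smul, he, hB, Prod.mk.injEq, true_and]
    refine Finset.sum_congr rfl fun n _ => ?_
    rw [← he, hsymm, smul_smul, mul_comm]
  · intro f hf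
    induction hf using Submodule.span_induction with
    | mem f hf =>
      obtain ⟨n, rfl⟩ := hf
      rw [mem_generatorGraph, hB, map_smul, ← he]
      have hd : HasDerivAt (fun t : ℝ => Complex.exp (t * l n)) (l n) 0 := by
        have h1 : HasDerivAt (fun t : ℝ => (t : ℂ)) 1 0 := Complex.ofRealCLM.hasDerivAt
        refine ((h1.mul_const (l n)).cexp).congr_deriv ?_
        simp
      rw [hasDerivAt_iff_tendsto_slope_zero] at hd
      have hd' := (hd.mono_left (nhdsWithin_mono 0 (fun t (ht : 0 < t) => ht.ne'))).smul_const
        (e n)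
      refine hd'.congr' ?_
      filter_upwards [self_mem_nhdsWithin] with t ht
      rw [diag_apply_basis, hexp t (le_of_lt ht)]
      simp only [zero_add, Complex.ofReal_zero, zero_mul, Complex.exp_zero]
      rw [smul_assoc, sub_smul, one_smul]
    | zero =>
      rw [map_zero, map_zero]
      exact (generatorSubmodule fun t => diag e (ν t) (hν t)).zero_mem
    | add f g _ _ hf hg =>
      rw [map_add, map_add, map_add]
      exact (generatorSubmodule fun t => diag e (ν t) (hν t)).add_mem hf hg
    | smul c f _ hf =>
      rw [map_smul, map_smul, map_smul]
      exact (generatorSubmodule fun t => diag e (ν t) (hν t)).smul_mem c hf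
  · intro y hy
    refine eq_of_inner_basis (e := e) fun n => ?_
    have h1 := hy (h n) (hmem n)
    rw [hB, map_smul, ← he, inner_sub_right, inner_smul_right] at h1
    have h2 : (1 - l n) * inner ℂ y (e n) = 0 := by linear_combination h1
    -- The range of 1 - B contains (1 - l n) e_n, and Re (l n) ≤ 0 keeps this coefficient away from
    -- zero.
    have h3 : 1 - l n ≠ 0 := by
      intro h0
      have := congrArg Complex.re h0
      simp at this
      linarith [hl n]
    rw [inner_zero_right, ← inner_conj_symm, (mul_eq_zero.1 h2).resolve_left h3, map_zero]

/-! ## Exponentials of the number operator -/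

variable {m ω : ℝ}

theorem norm_exp_number_le {z : ℂ} (hz : z.re ≤ 0) (n : ℕ) :
    ‖Complex.exp (z * (n + 1 / 2))‖ ≤ 1 := by
  rw [Complex.norm_exp, Real.exp_le_one_iff]
  have : z * (n + 1 / 2) = z * ((n + 1 / 2 : ℝ) : ℂ) := by push_cast; ring
  rw [this, Complex.re_mul_ofReal]
  exact mul_nonpos_of_nonpos_of_nonneg hz (by positivity)

/-- The operator `exp (z (a† a + 1/2))`. -/
def numberExp (hm : 0 < m) (hω : 0 < ω) (z : ℂ) (hz : z.re ≤ 0) : StateSpace →L[ℂ] StateSpace :=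
  diag (hermiteBasis hm hω) (fun n => Complex.exp (z * (n + 1 / 2))) (norm_exp_number_le hz)

theorem contractionExp_number (hm : 0 < m) (hω : 0 < ω) (z : ℂ) (hz : z.re ≤ 0) :
    ∃ U, ContractionExp (z • number m ω) U ∧ U 1 = numberExp hm hω z hz := by
  -- `diag` requires entries of modulus at most one at every real time, so time is clamped to max t
  -- 0; negative times play no role in the semigroup.
  have hz' (t : ℝ) : (((max t 0 : ℝ) : ℂ) * z).re ≤ 0 := by
    rw [Complex.re_ofReal_mul]
    exact mul_nonpos_of_nonneg_of_nonpos (le_max_right _ _) hz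
  refine ⟨_, contractionExp_diag (e := hermiteBasis hm hω) (h := hermite m ω)
    (l := fun n => z * (n + 1 / 2)) (hermiteBasis_apply hm hω) (fun n => ?_) (fun n f => ?_)
    (fun n => ?_) (fun t n => Complex.exp (((max t 0 : ℝ) : ℂ) * z * (n + 1 / 2)))
    (fun t => norm_exp_number_le (hz' t)) (fun t ht n => ?_), ?_⟩
  · rw [smul_apply, number_hermite hm hω, smul_smul]
  · rw [hermiteBasis_apply, smul_apply, map_smul, inner_smul_right, ← inner_number,
      number_hermite hm hω, map_smul, inner_smul_left]
    simp only [map_add, map_natCast, map_div₀, map_one, map_ofNat]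
    ring
  · have : z * (n + 1 / 2) = z * ((n + 1 / 2 : ℝ) : ℂ) := by push_cast; ring
    rw [this, Complex.re_mul_ofReal]
    exact mul_nonpos_of_nonpos_of_nonneg hz (by positivity)
  · rw [max_eq_left ht, mul_assoc]
  · simp only [numberExp]
    congr 1
    funext n
    rw [max_eq_left zero_le_one, Complex.ofReal_one, one_mul]

theorem inner_numberExp (hm : 0 < m) (hω : 0 < ω) {z : ℂ} (hz : z.re ≤ 0) (f : StateSpace) (n : ℕ) :
    inner ℂ (hermiteBasis hm hω n) (numberExp hm hω z hz f)
      = Complex.exp (z * (n + 1 / 2)) * inner ℂ (hermiteBasis hm hω n) f :=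
  inner_diag f n

theorem adjoint_numberExp (hm : 0 < m) (hω : 0 < ω) {z w : ℂ} (hz : z.re ≤ 0) (hw : w.re ≤ 0)
    (hzw : w = (starRingEnd ℂ) z) :
    ContinuousLinearMap.adjoint (numberExp hm hω z hz) = numberExp hm hω w hw := by
  refine ContinuousLinearMap.ext fun f => eq_of_inner_basis (e := hermiteBasis hm hω) fun n => ?_
  rw [ContinuousLinearMap.adjoint_inner_right, inner_numberExp, numberExp, diag_apply_basis,
    inner_smul_left, ← Complex.exp_conj, hzw]
  simp only [map_mul, map_add, map_natCast, map_div₀, map_one, map_ofNat]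


/-! ## Traces -/

theorem hasSum_of_eq {α : Type*} [AddCommMonoid α] [TopologicalSpace α] {f g : ℕ → α} {x y : α}
    (h : HasSum g y) (hf : ∀ n, f n = g n) (hx : x = y) : HasSum f x := by
  rwa [hx, funext hf]

section Trace

variable {ι : Type} (e : HilbertBasis ℕ ℂ StateSpace) (b : HilbertBasis ι ℂ StateSpace)

/-- Cauchy–Schwarz for the finite sum, followed by Bessel's inequality for both factors. -/
theorem sum_norm_inner_mul_le (x y : StateSpace) (s : Finset ι) :
    ∑ i ∈ s, ‖inner ℂ x (b i) * inner ℂ (b i) y‖ ≤ ‖x‖ * ‖y‖ := by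
  have hx := b.orthonormal.sum_inner_products_le (x := x) (s := s)
  have hy := b.orthonormal.sum_inner_products_le (x := y) (s := s)
  calc ∑ i ∈ s, ‖inner ℂ x (b i) * inner ℂ (b i) y‖
      = ∑ i ∈ s, ‖inner ℂ (b i) x‖ * ‖inner ℂ (b i) y‖ := by
        refine Finset.sum_congr rfl fun i _ => ?_
        rw [norm_mul, norm_inner_symm]
    _ ≤ √(∑ i ∈ s, ‖inner ℂ (b i) x‖ ^ 2) * √(∑ i ∈ s, ‖inner ℂ (b i) y‖ ^ 2) :=
        Real.sum_mul_le_sqrt_mul_sqrt _ _ _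
    _ ≤ √(‖x‖ ^ 2) * √(‖y‖ ^ 2) := by gcongr
    _ = ‖x‖ * ‖y‖ := by rw [Real.sqrt_sq (norm_nonneg _), Real.sqrt_sq (norm_nonneg _)]

theorem hasSum_inner_smul (f : StateSpace) : HasSum (fun n => inner ℂ (e n) f • e n) f := by
  simpa [e.repr_apply_apply] using e.hasSum_repr f

variable {e}

/-- The double series ⟨e_n, b_i⟩⟨b_i, T e_n⟩ converges absolutely, with bound ∑ ‖T e_n‖. Summing
over i first gives the diagonal sum in e, summing over n first the one in b. -/
theorem hasTrace_of_summable {T : StateSpace →L[ℂ] StateSpace}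
    (hT : Summable fun n => ‖T (e n)‖) {τ : ℂ}
    (hτ : HasSum (fun n => inner ℂ (e n) (T (e n))) τ) : HasTrace T τ := by
  intro ι b
  have hn (n : ℕ) := summable_of_sum_le (fun i => norm_nonneg _)
    (sum_norm_inner_mul_le b (e n) (T (e n)))
  have hF : Summable fun p : ℕ × ι => inner ℂ (e p.1) (b p.2) * inner ℂ (b p.2) (T (e p.1)) := by
    refine Summable.of_norm ((summable_prod_of_nonneg fun _ => norm_nonneg _).2 ⟨hn, ?_⟩)
    refine hT.of_nonneg_of_le (fun n => tsum_nonneg fun _ => norm_nonneg _) fun n => ?_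
    refine (hn n).tsum_le_of_sum_le fun s => ?_
    have := sum_norm_inner_mul_le b (e n) (T (e n)) s
    rwa [e.orthonormal.1 n, one_mul] at this
  obtain ⟨σ, hσ⟩ := hF
  have h1 := hσ.prod_fiberwise fun n => b.hasSum_inner_mul_inner (e n) (T (e n))
  have h2 := ((Equiv.prodComm ι ℕ).hasSum_iff.2 hσ).prod_fiberwise
    (g := fun i => inner ℂ (b i) (T (b i))) fun i => by
      have h3 := ((hasSum_inner_smul e (b i)).mapL T).mapL (innerSL ℂ (b i))
      simpa using h3
  rwa [hτ.unique h1]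

/-- `HasTrace` quantifies over all bases, so uniqueness of the value needs one to exist; `e`
provides it. -/
theorem HasTrace.opTrace_eq {T : StateSpace →L[ℂ] StateSpace} {τ : ℂ} (h : HasTrace T τ)
    (e : HilbertBasis ℕ ℂ StateSpace) : opTrace T = τ := by
  have hex : ∃ τ, HasTrace T τ := ⟨τ, h⟩
  rw [opTrace, dif_pos hex]
  exact (hex.choose_spec ℕ e).unique (h ℕ e)

/-- The expectation of an observable in a state with a known eigenbasis. -/
theorem hasExpectation_of_eigenbasis {g : ℕ → 𝓢(ℝ, ℂ)} {l : ℕ → ℂ}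
    {ρ : StateSpace →L[ℂ] StateSpace} {B : SchwartzOp} {τ : ℂ} (he : ∀ n, e n = ket (g n))
    (hρ : ∀ n, ρ (e n) = l n • e n) (hs : Summable fun n => ‖l n‖ * ‖ket (B (g n))‖)
    (hτ : HasSum (fun n => l n * inner ℂ (e n) (ket (B (g n)))) τ) : HasExpectation ρ B τ := by
  -- Bρ is built as the norm-convergent series of the rank-one operators l_n |B g_n⟩⟨e_n|. The pairs
  -- (ρf, Bρf) are limits of graph points of B along finite partial sums.
  let t : ℕ → StateSpace →L[ℂ] StateSpace :=
    fun n => (innerSL ℂ (e n)).smulRight (l n • ket (B (g n)))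
  have ht : Summable t := by
    refine Summable.of_norm (hs.congr fun n => ?_)
    rw [ContinuousLinearMap.norm_smulRight_apply, innerSL_apply_norm, e.orthonormal.1 n, one_mul,
      norm_smul]
  obtain ⟨T, hT⟩ := ht
  have hTf (f : StateSpace) : HasSum (fun n => inner ℂ (e n) f • l n • ket (B (g n))) (T f) := by
    simpa [t] using hT.mapL (ContinuousLinearMap.apply ℂ StateSpace f)
  have hTe (n : ℕ) : T (e n) = l n • ket (B (g n)) := by
    have h1 := hasSum_single (f := fun k => inner ℂ (e k) (e n) • l k • ket (B (g k))) n
      fun k hk => by rw [e.orthonormal.2 hk, zero_smul]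
    rw [(hTf (e n)).unique h1, inner_self_eq_norm_sq_to_K, e.orthonormal.1 n]
    simp
  have hρ' (n : ℕ) : ρ (ket (g n)) = l n • ket (g n) := by rw [← he, hρ]
  refine ⟨T, fun f => ?_, hasTrace_of_summable (e := e) (hs.congr fun n => ?_) ?_⟩
  · have h1 := (((hasSum_inner_smul e f).mapL ρ)).prodMk (hTf f)
    rw [closureGraph_eq]
    refine mem_closure_of_tendsto h1 (Eventually.of_forall fun s => ?_)
    refine ⟨∑ n ∈ s, inner ℂ (e n) f • l n • g n, ?_⟩
    simp [map_sum, map_smul, Prod.fst_sum, Prod.snd_sum, Prod.ext_iff, hρ', he]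
  · rw [hTe, norm_smul]
  · simpa only [hTe, inner_smul_right] using hτ

end Trace

/-! ## Thermal sums -/

theorem hasSum_exp_thermal {ϑ : ℝ} (hϑ : 0 < ϑ) :
    HasSum (fun n : ℕ => Real.exp (-ϑ * (n + 1 / 2))) (1 / (2 * Real.sinh (ϑ / 2))) := by
  have hq : Real.exp (-ϑ) < 1 := by rw [Real.exp_lt_one_iff]; linarith
  have h := (hasSum_geometric_of_lt_one (Real.exp_pos _).le hq).mul_left (Real.exp (-(ϑ / 2)))
  have hx : 0 < Real.exp (ϑ / 2) := Real.exp_pos _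
  have h1 : 1 < Real.exp (ϑ / 2) := by rw [Real.one_lt_exp_iff]; linarith
  refine hasSum_of_eq h (fun n => ?_) ?_
  · rw [← Real.exp_nat_mul, ← Real.exp_add]
    congr 1
    ring
  · have e : Real.exp (-ϑ) = (Real.exp (ϑ / 2) ^ 2)⁻¹ := by
      rw [← Real.exp_nat_mul, ← Real.exp_neg]
      congr 1
      push_cast
      ring
    rw [Real.sinh_eq, e, Real.exp_neg]
    set x := Real.exp (ϑ / 2)
    have h2 : x ^ 2 - 1 ≠ 0 := by nlinarith
    field_simp

theorem hasSum_number_thermal {ϑ : ℝ} (hϑ : 0 < ϑ) :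
    HasSum (fun n : ℕ => Real.exp (-ϑ * (n + 1 / 2)) * (n + 1 / 2))
      (coth (ϑ / 2) / 2 * (1 / (2 * Real.sinh (ϑ / 2)))) := by
  have hq : Real.exp (-ϑ) < 1 := by rw [Real.exp_lt_one_iff]; linarith
  have h := (((hasSum_coe_mul_geometric_of_norm_lt_one (r := Real.exp (-ϑ))
    (by rwa [Real.norm_of_nonneg (Real.exp_pos _).le])).mul_left (Real.exp (-(ϑ / 2))))).add
    ((hasSum_exp_thermal hϑ).mul_right (1 / 2))
  have hx : 0 < Real.exp (ϑ / 2) := Real.exp_pos _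
  have h1 : 1 < Real.exp (ϑ / 2) := by rw [Real.one_lt_exp_iff]; linarith
  refine hasSum_of_eq h (fun n => ?_) ?_
  · have : Real.exp (-ϑ * (n + 1 / 2)) = Real.exp (-(ϑ / 2)) * Real.exp (-ϑ) ^ n := by
      rw [← Real.exp_nat_mul, ← Real.exp_add]
      congr 1
      ring
    rw [this]
    ring
  · have e : Real.exp (-ϑ) = (Real.exp (ϑ / 2) ^ 2)⁻¹ := by
      rw [← Real.exp_nat_mul, ← Real.exp_neg]
      congr 1
      push_cast
      ring
    rw [coth, Real.sinh_eq, Real.cosh_eq, e, Real.exp_neg]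
    set x := Real.exp (ϑ / 2)
    have h2 : x ^ 2 - 1 ≠ 0 := by nlinarith
    field_simp
    ring

theorem summable_linear_thermal {ϑ : ℝ} (hϑ : 0 < ϑ) (C : ℝ) :
    Summable fun n : ℕ => Real.exp (-ϑ * (n + 1 / 2)) * (C * (n + 2)) := by
  have h := ((hasSum_number_thermal hϑ).summable.add
    ((hasSum_exp_thermal hϑ).summable.mul_right (3 / 2))).mul_left C
  refine h.congr fun n => ?_
  ring

/-! ## Quadratic observables in the number basis -/

variable {m ω : ℝ}

theorem creation_creation_hermite (n : ℕ) : creation m ω (creation m ω (hermite m ω n)) =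
    ((√(n + 1) * √(n + 1 + 1) : ℝ) : ℂ) • hermite m ω (n + 2) := by
  have h := creation_hermite (m := m) (ω := ω) (n + 1)
  push_cast at h
  rw [creation_hermite, map_smul, h, smul_smul]
  push_cast
  rfl

theorem sqrt_mul_sqrt_le (n : ℕ) : √((n : ℝ) + 1) * √((n : ℝ) + 1 + 1) ≤ n + 2 := by
  have h1 : √((n : ℝ) + 1) ≤ √((n : ℝ) + 1 + 1) := Real.sqrt_le_sqrt (by linarith)
  have h2 := Real.mul_self_sqrt (by positivity : (0 : ℝ) ≤ (n : ℝ) + 1 + 1)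
  nlinarith [Real.sqrt_nonneg ((n : ℝ) + 1 + 1)]

theorem norm_creation_creation_hermite_le (hm : 0 < m) (hω : 0 < ω) (n : ℕ) :
    ‖ket (creation m ω (creation m ω (hermite m ω n)))‖ ≤ n + 2 := by
  rw [creation_creation_hermite, map_smul, norm_smul, norm_ket_hermite hm hω, mul_one,
    Complex.norm_real, Real.norm_of_nonneg (by positivity)]
  exact sqrt_mul_sqrt_le n

theorem norm_annihilation_annihilation_hermite_le (hm : 0 < m) (hω : 0 < ω) (n : ℕ) :
    ‖ket (annihilation m ω (annihilation m ω (hermite m ω n)))‖ ≤ n + 2 := by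
  match n with
  | 0 =>
    rw [annihilation_hermite_zero hm hω, map_zero, map_zero, norm_zero]
    positivity
  | 1 =>
    rw [annihilation_hermite_succ hm hω, map_smul, annihilation_hermite_zero hm hω, smul_zero,
      map_zero, norm_zero]
    positivity
  | n + 2 =>
    have h := annihilation_hermite_succ hm hω (n + 1)
    rw [h, map_smul, annihilation_hermite_succ hm hω, smul_smul, map_smul, norm_smul,
      norm_ket_hermite hm hω, mul_one, ← Complex.ofReal_mul, Complex.norm_real,
      Real.norm_of_nonneg (by positivity), mul_comm]
    have := sqrt_mul_sqrt_le n
    push_cast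
    linarith

theorem inner_creation_creation_hermite (hm : 0 < m) (hω : 0 < ω) (n : ℕ) :
    inner ℂ (ket (hermite m ω n)) (ket (creation m ω (creation m ω (hermite m ω n)))) = 0 := by
  rw [creation_creation_hermite, map_smul, inner_smul_right,
    (orthonormal_hermite hm hω).2 (by omega), mul_zero]

theorem inner_annihilation_annihilation_hermite (hm : 0 < m) (hω : 0 < ω) (n : ℕ) :
    inner ℂ (ket (hermite m ω n)) (ket (annihilation m ω (annihilation m ω (hermite m ω n))))
      = 0 := by
  rw [← inner_creation, ← inner_creation, ← inner_conj_symm,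
    inner_creation_creation_hermite hm hω, map_zero]

/-- The quadratic operator `u χ² + v p² + w {χ, p}` in terms of ladder operators. -/
theorem quadratic_eq_ladder (hm : 0 < m) (hω : 0 < ω) (u v w : ℂ) :
    ∃ α β : ℂ, u • (position * position) + v • (momentum * momentum)
        + w • anticomm position momentum
      = α • (annihilation m ω * annihilation m ω) + β • (creation m ω * creation m ω)
        + (u / (m * ω) + v * (m * ω)) • number m ω := by
  obtain ⟨hs, hr, hsr⟩ := sqrt_relations hm hω
  have hm' : (m : ℂ) ≠ 0 := by exact_mod_cast hm.ne'
  have hω' : (ω : ℂ) ≠ 0 := by exact_mod_cast hω.ne'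
  -- Only the coefficient of `number` affects expectations: a² and a†² have zero diagonal in the
  -- Hermite basis, so these two witnesses enter later only through norm bounds.
  refine ⟨u / (2 * (m * ω)) - v * (m * ω / 2) - w * Complex.I,
    u / (2 * (m * ω)) - v * (m * ω / 2) + w * Complex.I, ?_⟩
  have hac := annihilation_mul_creation hm hω
  rw [anticomm, position_eq hm hω, momentum_eq hm hω, number]
  generalize ((√(m * ω / 2) : ℝ) : ℂ) = s at *
  generalize ((1 / √(2 * m * ω) : ℝ) : ℂ) = r at *
  generalize annihilation m ω = A at *
  generalize creation m ω = C at *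
  simp only [mul_add, add_mul, mul_sub, sub_mul, smul_mul_smul_comm, hac]
  have hI := Complex.I_mul_I
  match_scalars
  · linear_combination u * hr + (v * s * s) * hI - v * hs + (2 * w * Complex.I) * hsr
  · linear_combination 2 * u * hr - (2 * v * s * s) * hI + 2 * v * hs
  · linear_combination u * hr - (v * s * s) * hI + v * hs
  · linear_combination u * hr + (v * s * s) * hI - v * hs - (2 * w * Complex.I) * hsr

theorem norm_quadratic_hermite_le (hm : 0 < m) (hω : 0 < ω) (α β γ : ℂ) (n : ℕ) :
    ‖ket ((α • (annihilation m ω * annihilation m ω) + β • (creation m ω * creation m ω)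
        + γ • number m ω) (hermite m ω n))‖ ≤ (‖α‖ + ‖β‖ + ‖γ‖) * (n + 2) := by
  change ‖ket (α • annihilation m ω (annihilation m ω (hermite m ω n))
    + β • creation m ω (creation m ω (hermite m ω n)) + γ • number m ω (hermite m ω n))‖ ≤ _
  rw [map_add, map_add, map_smul, map_smul, map_smul, number_hermite hm hω, map_smul]
  refine (norm_add₃_le).trans ?_
  rw [norm_smul, norm_smul, norm_smul, norm_smul, norm_ket_hermite hm hω, add_mul, add_mul]
  have h1 := norm_annihilation_annihilation_hermite_le hm hω n
  have h2 := norm_creation_creation_hermite_le hm hω n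
  have h3 : ‖(n + 1 / 2 : ℂ)‖ * 1 ≤ n + 2 := by
    have : (n + 1 / 2 : ℂ) = ((n + 1 / 2 : ℝ) : ℂ) := by push_cast; ring
    rw [mul_one, this, Complex.norm_real, Real.norm_of_nonneg (by positivity)]
    linarith
  gcongr

theorem inner_quadratic_hermite (hm : 0 < m) (hω : 0 < ω) (α β γ : ℂ) (n : ℕ) :
    inner ℂ (ket (hermite m ω n))
      (ket ((α • (annihilation m ω * annihilation m ω) + β • (creation m ω * creation m ω)
        + γ • number m ω) (hermite m ω n))) = γ * (n + 1 / 2) := by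
  change inner ℂ (ket (hermite m ω n)) (ket (α • annihilation m ω (annihilation m ω
    (hermite m ω n)) + β • creation m ω (creation m ω (hermite m ω n))
    + γ • number m ω (hermite m ω n))) = _
  rw [map_add, map_add, map_smul, map_smul, map_smul, number_hermite hm hω, map_smul,
    inner_add_right, inner_add_right, inner_smul_right, inner_smul_right, inner_smul_right,
    inner_smul_right, inner_creation_creation_hermite hm hω,
    inner_annihilation_annihilation_hermite hm hω, inner_self_eq_norm_sq_to_K,
    norm_ket_hermite hm hω]
  simp

/-! ## Squeezed thermal states -/

/-- The image of the Hermite basis under a unitary operator. -/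
def transformedBasis (hm : 0 < m) (hω : 0 < ω) (S : schwartzUnitary) :
    HilbertBasis ℕ ℂ StateSpace :=
  HilbertBasis.ofRepr ((lift S).symm.trans (hermiteBasis hm hω).repr)

theorem transformedBasis_apply (hm : 0 < m) (hω : 0 < ω) (S : schwartzUnitary) (n : ℕ) :
    transformedBasis hm hω S n = ket (op S (hermite m ω n)) := by
  classical
  rw [← lift_ket, ← hermiteBasis_apply hm hω, ← HilbertBasis.repr_symm_single,
    ← HilbertBasis.repr_symm_single]
  rfl

theorem re_neg_ofReal_nonpos {ϑ : ℝ} (hϑ : 0 < ϑ) : (-(ϑ : ℂ)).re ≤ 0 := by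
  simpa using hϑ.le

theorem numberExp_hermite (hm : 0 < m) (hω : 0 < ω) {ϑ : ℝ} (hϑ : 0 < ϑ) (n : ℕ) :
    numberExp hm hω (-(ϑ : ℂ)) (re_neg_ofReal_nonpos hϑ) (ket (hermite m ω n))
      = ((Real.exp (-ϑ * (n + 1 / 2)) : ℝ) : ℂ) • ket (hermite m ω n) := by
  rw [← hermiteBasis_apply hm hω, numberExp, diag_apply_basis]
  congr 1
  push_cast
  rfl

theorem hasTrace_numberExp (hm : 0 < m) (hω : 0 < ω) {ϑ : ℝ} (hϑ : 0 < ϑ) :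
    HasTrace (numberExp hm hω (-(ϑ : ℂ)) (re_neg_ofReal_nonpos hϑ))
      ((1 / (2 * Real.sinh (ϑ / 2)) : ℝ) : ℂ) := by
  refine hasTrace_of_summable (e := hermiteBasis hm hω)
    ((hasSum_exp_thermal hϑ).summable.congr fun n => ?_) ?_
  · rw [hermiteBasis_apply, numberExp_hermite hm hω hϑ, norm_smul, norm_ket_hermite hm hω, mul_one,
      Complex.norm_real, Real.norm_of_nonneg (Real.exp_pos _).le]
  · convert Complex.hasSum_ofReal.2 (hasSum_exp_thermal hϑ) using 2 with n
    rw [hermiteBasis_apply, numberExp_hermite hm hω hϑ, inner_smul_right,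
      inner_self_eq_norm_sq_to_K, norm_ket_hermite hm hω]
    simp

/-- The normalised thermal state, transformed by `S`. -/
def transformedThermal (hm : 0 < m) (hω : 0 < ω) (S : schwartzUnitary) {ϑ : ℝ} (hϑ : 0 < ϑ) :
    StateSpace →L[ℂ] StateSpace :=
  ((2 * Real.sinh (ϑ / 2) : ℝ) : ℂ) •
    conj S (numberExp hm hω (-(ϑ : ℂ)) (re_neg_ofReal_nonpos hϑ))

theorem transformedThermal_apply (hm : 0 < m) (hω : 0 < ω) (S : schwartzUnitary) {ϑ : ℝ}
    (hϑ : 0 < ϑ) (n : ℕ) : transformedThermal hm hω S hϑ (ket (op S (hermite m ω n))) =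
      ((2 * Real.sinh (ϑ / 2) * Real.exp (-ϑ * (n + 1 / 2)) : ℝ) : ℂ) •
        ket (op S (hermite m ω n)) := by
  change ((2 * Real.sinh (ϑ / 2) : ℝ) : ℂ) • conj S _ _ = _
  rw [conj_apply, lift_symm_ket, op_inv_op, numberExp_hermite hm hω hϑ, map_smul, lift_ket,
    smul_smul, ← Complex.ofReal_mul]

/-- The Heisenberg picture: the mean of B in the transformed state is the thermal mean of S⁻¹BS. Its
number component contributes through ⟨a†a + 1/2⟩ = coth(ϑ/2)/2. -/
theorem hasExpectation_transformedThermal (hm : 0 < m) (hω : 0 < ω) (S : schwartzUnitary) {ϑ : ℝ}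
    (hϑ : 0 < ϑ) {B : SchwartzOp} {u v w : ℂ}
    (hB : op S⁻¹ * B * op S = u • (position * position) + v • (momentum * momentum)
      + w • anticomm position momentum) :
    HasExpectation (transformedThermal hm hω S hϑ) B
      ((u / (m * ω) + v * (m * ω)) * (coth (ϑ / 2) / 2 : ℝ)) := by
  obtain ⟨α, β, h⟩ := quadratic_eq_ladder hm hω u v w
  rw [h] at hB
  have hBS (n : ℕ) : B (op S (hermite m ω n)) = op S ((op S⁻¹ * B * op S) (hermite m ω n)) :=
    (op_op_inv S _).symm
  have hsinh : 0 < Real.sinh (ϑ / 2) := Real.sinh_pos_iff.2 (half_pos hϑ)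
  refine hasExpectation_of_eigenbasis (e := transformedBasis hm hω S)
    (transformedBasis_apply hm hω S)
    (l := fun n => ((2 * Real.sinh (ϑ / 2) * Real.exp (-ϑ * (n + 1 / 2)) : ℝ) : ℂ))
    (fun n => ?_) ?_ ?_
  · rw [transformedBasis_apply, transformedThermal_apply]
  · refine ((summable_linear_thermal hϑ (‖α‖ + ‖β‖ + ‖u / (m * ω) + v * (m * ω)‖)).mul_left
      (2 * Real.sinh (ϑ / 2))).of_nonneg_of_le (fun n => by positivity) fun n => ?_
    rw [hBS, ← lift_ket, LinearIsometryEquiv.norm_map, hB, Complex.norm_real,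
      Real.norm_of_nonneg (by positivity), mul_assoc]
    gcongr
    exact norm_quadratic_hermite_le hm hω _ _ _ n
  · have h1 := (Complex.hasSum_ofReal.2 ((hasSum_number_thermal hϑ).mul_left
      (2 * Real.sinh (ϑ / 2)))).mul_left (u / (m * ω) + v * (m * ω))
    refine hasSum_of_eq h1 (fun n => ?_) ?_
    · rw [transformedBasis_apply, hBS, ← lift_ket, ← lift_ket, LinearIsometryEquiv.inner_map_map,
        hB, inner_quadratic_hermite hm hω]
      push_cast
      ring
    · congr 2
      field_simp


/-! ## Integral kernels -/

theorem integrable_mul_coe {g : ℝ → ℂ} (hg : MemLp g 2) (f : StateSpace) :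
    Integrable (fun y => g y * f y) :=
  hg.integrable_mul (Lp.memLp f)

theorem continuous_integral_mul {g : ℝ → ℂ} (hg : MemLp g 2) :
    Continuous fun f : StateSpace => ∫ y, g y * f y := by
  have hg' : MemLp (fun y => (starRingEnd ℂ) (g y)) 2 :=
    hg.of_le (Complex.continuous_conj.comp_aestronglyMeasurable hg.1)
      (Eventually.of_forall fun y => by simp)
  have e : (fun f : StateSpace => ∫ y, g y * f y) = fun f => inner ℂ (hg'.toLp _) f := by
    funext f
    rw [L2.inner_def]
    refine integral_congr_ae ?_
    filter_upwards [hg'.coeFn_toLp] with y hy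
    rw [hy, RCLike.inner_apply, RCLike.conj_conj, mul_comm]
  rw [e]
  fun_prop

/-- An operator has the kernel `k` if it acts as the integral operator on an orthonormal basis. -/
theorem hasKernel_of_basis (e : HilbertBasis ℕ ℂ StateSpace) {k : ℝ → ℝ → ℂ}
    {T : StateSpace →L[ℂ] StateSpace} (hk : ∀ x, MemLp (k x) 2)
    (h : ∀ n, ∀ᵐ x : ℝ, T (e n) x = ∫ y, k x y * e n y) : HasKernel T k := by
  let P : Submodule ℂ StateSpace :=
    { carrier := {f | ∀ᵐ x : ℝ, T f x = ∫ y, k x y * f y}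
      zero_mem' := by
        have h0 : ∀ᵐ y : ℝ, (0 : StateSpace) y = 0 := Lp.coeFn_zero ℂ 2 volume
        have (x : ℝ) : ∫ y, k x y * (0 : StateSpace) y = 0 := by
          rw [← integral_zero ℝ ℂ]
          refine integral_congr_ae ?_
          filter_upwards [h0] with y hy
          rw [hy, mul_zero]
        simp only [Set.mem_ofPred_eq, map_zero, this]
        exact h0
      add_mem' := by
        intro f g hf hg
        have h1 := Lp.coeFn_add (T f) (T g)
        filter_upwards [hf, hg, h1] with x hfx hgx hx
        rw [map_add, hx, Pi.add_apply, hfx, hgx,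
          ← integral_add (integrable_mul_coe (hk x) f) (integrable_mul_coe (hk x) g)]
        refine integral_congr_ae ?_
        filter_upwards [Lp.coeFn_add f g] with y hy
        rw [hy, Pi.add_apply, mul_add]
      smul_mem' := by
        intro c f hf
        filter_upwards [hf, Lp.coeFn_smul c (T f)] with x hfx hx
        rw [map_smul, hx, Pi.smul_apply, hfx, ← integral_smul]
        refine integral_congr_ae ?_
        filter_upwards [Lp.coeFn_smul c f] with y hy
        rw [hy, Pi.smul_apply, smul_eq_mul, smul_eq_mul]
        ring }
  -- If f_n → g in L², a subsequence of T f_n converges almost everywhere to T g, while for each x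
  -- the integrals converge because k x is in L². A closed subspace containing the basis is
  -- everything.
  have hP : IsClosed (P : Set StateSpace) := by
    refine IsSeqClosed.isClosed fun f g hf hfg => ?_
    have hT := (T.continuous.tendsto g).comp hfg
    obtain ⟨ns, hns, hlim⟩ := (tendstoInMeasure_of_tendsto_Lp hT).exists_seq_tendsto_ae
    have hae : ∀ᵐ x : ℝ, ∀ n, T (f n) x = ∫ y, k x y * f n y := ae_all_iff.2 hf
    change ∀ᵐ x : ℝ, T g x = ∫ y, k x y * g y
    filter_upwards [hlim, hae] with x hx hfx
    refine tendsto_nhds_unique hx ?_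
    have h2 := ((continuous_integral_mul (hk x)).tendsto g).comp
      (hfg.comp hns.tendsto_atTop)
    refine h2.congr fun n => ?_
    exact (hfx _).symm
  have htop : P = ⊤ := by
    rw [eq_top_iff, ← e.dense_span]
    refine Submodule.topologicalClosure_minimal _ (Submodule.span_le.2 ?_) hP
    rintro _ ⟨n, rfl⟩
    exact h n
  intro f
  have hf : f ∈ P := htop ▸ Submodule.mem_top
  filter_upwards [show ∀ᵐ x : ℝ, T f x = ∫ y, k x y * f y from hf] with x hx
  exact ⟨integrable_mul_coe (hk x) f, hx⟩

/-- The kernel `exp (-A x² + C x y - D y²)`. -/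
def gaussianKernel (A C D : ℂ) (x y : ℝ) : ℂ :=
  Complex.exp (-(A * (x : ℂ) ^ 2) + C * x * y - D * (y : ℂ) ^ 2)

section GaussianKernel

variable {A C D : ℂ}

theorem hasDerivAt_gaussianKernel_left (x y : ℝ) :
    HasDerivAt (fun x => gaussianKernel A C D x y)
      ((-(2 * A * x) + C * y) * gaussianKernel A C D x y) x := by
  have hx : HasDerivAt (fun x : ℝ => (x : ℂ)) 1 x := Complex.ofRealCLM.hasDerivAt
  have h := ((((hx.pow 2).const_mul A).neg.add ((hx.const_mul C).mul_const (y : ℂ))).sub_const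
    (D * (y : ℂ) ^ 2)).cexp
  refine h.congr_deriv ?_
  simp only [gaussianKernel, Pi.add_apply, Pi.neg_apply, Pi.pow_apply]
  push_cast
  ring

theorem hasDerivAt_gaussianKernel_right (x y : ℝ) :
    HasDerivAt (fun y => gaussianKernel A C D x y)
      ((C * x - 2 * D * y) * gaussianKernel A C D x y) y := by
  have hy : HasDerivAt (fun x : ℝ => (x : ℂ)) 1 y := Complex.ofRealCLM.hasDerivAt
  have h := (((hy.const_mul (C * x)).const_add (-(A * (x : ℂ) ^ 2))).sub
    ((hy.pow 2).const_mul D)).cexp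
  refine h.congr_deriv ?_
  simp only [gaussianKernel, Pi.sub_apply, Pi.pow_apply]
  push_cast
  ring

theorem norm_gaussianKernel_le (hD : 0 < D.re) (R : ℝ) : ∃ K : ℝ, 0 ≤ K ∧ ∀ x y : ℝ, |x| ≤ R →
    ‖gaussianKernel A C D x y‖ ≤ K * Real.exp (-(D.re / 2) * y ^ 2) := by
  refine ⟨Real.exp (‖A‖ * R ^ 2 + (‖C‖ * R) ^ 2 / (2 * D.re)), (Real.exp_pos _).le,
    fun x y hx => ?_⟩
  rw [gaussianKernel, Complex.norm_exp, ← Real.exp_add, Real.exp_le_exp, Complex.sub_re,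
    Complex.add_re, Complex.neg_re]
  have h1 : -(A * (x : ℂ) ^ 2).re ≤ ‖A‖ * R ^ 2 := by
    refine (neg_le_abs _).trans ((Complex.abs_re_le_norm _).trans ?_)
    rw [norm_mul, norm_pow, Complex.norm_real, Real.norm_eq_abs]
    gcongr
  have h2 : (C * x * y).re ≤ ‖C‖ * R * |y| := by
    refine (le_abs_self _).trans ((Complex.abs_re_le_norm _).trans ?_)
    rw [norm_mul, norm_mul, Complex.norm_real, Complex.norm_real, Real.norm_eq_abs,
      Real.norm_eq_abs]
    gcongr
  have h3 : (D * (y : ℂ) ^ 2).re = D.re * |y| ^ 2 := by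
    rw [sq_abs, ← Complex.ofReal_pow, Complex.re_mul_ofReal]
  -- Half of Re D is spent on absorbing the cross term; the remaining half gives the Gaussian bound
  -- in y, uniformly for |x| ≤ R.
  have h4 : ‖C‖ * R * |y| ≤ (‖C‖ * R) ^ 2 / (2 * D.re) + D.re / 2 * |y| ^ 2 := by
    have h5 : (‖C‖ * R) ^ 2 / (2 * D.re) + D.re / 2 * |y| ^ 2 - ‖C‖ * R * |y|
        = (‖C‖ * R - D.re * |y|) ^ 2 / (2 * D.re) := by
      field_simp
      ring
    have h6 : 0 ≤ (‖C‖ * R - D.re * |y|) ^ 2 / (2 * D.re) := by positivity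
    linarith
  rw [h3, ← sq_abs y]
  linarith

theorem continuous_gaussianKernel (x : ℝ) : Continuous (gaussianKernel A C D x) := by
  unfold gaussianKernel
  fun_prop

theorem integrable_gaussianKernel_mul (hD : 0 < D.re) (x : ℝ) (f : 𝓢(ℝ, ℂ)) :
    Integrable (fun y => gaussianKernel A C D x y * f y) := by
  obtain ⟨K, -, hK⟩ := norm_gaussianKernel_le (A := A) (C := C) hD |x|
  obtain ⟨M, hM⟩ := f.decay 0 0
  refine ((integrable_exp_neg_mul_sq (half_pos hD)).const_mul (K * M)).mono'
    ((continuous_gaussianKernel x).mul f.continuous).aestronglyMeasurable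
    (Eventually.of_forall fun y => ?_)
  have h1 := hK x y le_rfl
  have h2 : ‖f y‖ ≤ M := by simpa using hM.2 y
  rw [norm_mul, mul_right_comm]
  gcongr
  exact (norm_nonneg _).trans h1

theorem memLp_gaussianKernel (hD : 0 < D.re) (x : ℝ) : MemLp (gaussianKernel A C D x) 2 := by
  obtain ⟨K, hK0, hK⟩ := norm_gaussianKernel_le (A := A) (C := C) hD |x|
  refine (memLp_two_iff_integrable_sq_norm
    (continuous_gaussianKernel x).aestronglyMeasurable).2 ?_
  refine ((integrable_exp_neg_mul_sq hD).const_mul (K ^ 2)).mono'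
    ((continuous_gaussianKernel x).norm.pow 2).aestronglyMeasurable
    (Eventually.of_forall fun y => ?_)
  have h1 := pow_le_pow_left₀ (norm_nonneg _) (hK x y le_rfl) 2
  rw [mul_pow, ← Real.exp_nat_mul] at h1
  rw [Real.norm_of_nonneg (by positivity)]
  refine h1.trans_eq ?_
  congr 2
  push_cast
  ring

theorem integral_gaussianKernel_mul_deriv (hD : 0 < D.re) (x : ℝ) (f : 𝓢(ℝ, ℂ)) :
    ∫ y, gaussianKernel A C D x y * deriv f y =
      -∫ y, (C * x - 2 * D * y) * gaussianKernel A C D x y * f y := by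
  refine integral_mul_deriv_eq_deriv_mul_of_integrable
    (fun y _ => hasDerivAt_gaussianKernel_right x y) (fun y _ => (f.differentiableAt).hasDerivAt)
    (integrable_gaussianKernel_mul hD x (SchwartzMap.derivCLM ℂ ℂ f)) ?_
    (integrable_gaussianKernel_mul hD x f)
  have h := ((integrable_gaussianKernel_mul (A := A) (C := C) hD x f).const_mul (C * x)).sub
    ((integrable_gaussianKernel_mul (A := A) (C := C) hD x (position f)).const_mul (2 * D))
  refine h.congr (Eventually.of_forall fun y => ?_)
  simp only [Pi.sub_apply, Pi.mul_apply, position_apply]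
  ring

theorem hasDerivAt_integral_gaussianKernel (hD : 0 < D.re) (x : ℝ) (f : 𝓢(ℝ, ℂ)) :
    HasDerivAt (fun x => ∫ y, gaussianKernel A C D x y * f y)
      (∫ y, (-(2 * A * x) + C * y) * gaussianKernel A C D x y * f y) x := by
  -- The radius |x| + 1 covers the unit ball around x. The factor y produced by differentiation is
  -- absorbed by the bound M' on y f(y).
  obtain ⟨K, hK0, hK⟩ := norm_gaussianKernel_le (A := A) (C := C) hD (|x| + 1)
  obtain ⟨M, hM⟩ := f.decay 0 0
  obtain ⟨M', hM'⟩ := (position f).decay 0 0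
  have h0 := integrable_exp_neg_mul_sq (half_pos hD)
  refine (hasDerivAt_integral_of_dominated_loc_of_deriv_le (Metric.ball_mem_nhds x one_pos)
    (bound := fun y => (2 * ‖A‖ * (|x| + 1) * M + ‖C‖ * M') *
      (K * Real.exp (-(D.re / 2) * y ^ 2)))
    (Eventually.of_forall fun x => (integrable_gaussianKernel_mul hD x f).1)
    (integrable_gaussianKernel_mul hD x f) ?_ (Eventually.of_forall fun y z hz => ?_)
    ((h0.const_mul K).const_mul _) (Eventually.of_forall fun y z _ =>
      (hasDerivAt_gaussianKernel_left z y).mul_const _)).2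
  · refine Continuous.aestronglyMeasurable ?_
    have := continuous_gaussianKernel (A := A) (C := C) (D := D) x
    have := f.continuous
    fun_prop
  · have hz' : |z| ≤ |x| + 1 := by
      rw [Metric.mem_ball, Real.dist_eq] at hz
      have := abs_sub_abs_le_abs_sub z x
      linarith
    have h1 : ‖f y‖ ≤ M := by simpa using hM.2 y
    have h2 : ‖(y : ℂ) * f y‖ ≤ M' := by simpa [position_apply] using hM'.2 y
    have e : (-(2 * A * z) + C * y) * gaussianKernel A C D z y * f y
        = (-(2 * A * z) * f y + C * (y * f y)) * gaussianKernel A C D z y := by ring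
    have hM0 := hM.1.le
    have hM0' := hM'.1.le
    rw [e, norm_mul]
    refine mul_le_mul ?_ (hK z y hz') (norm_nonneg _) (by positivity)
    refine (norm_add_le _ _).trans ?_
    rw [norm_mul, norm_neg, norm_mul, norm_mul, Complex.norm_real, Real.norm_eq_abs, norm_mul C,
      Complex.norm_two]
    gcongr

/-- A Gaussian kernel intertwines a linear combination of position and momentum with a multiple
of itself. -/
theorem integral_gaussianKernel_ladder (hD : 0 < D.re) {u w q l : ℂ}
    (h1 : u - 2 * Complex.I * w * D = -(Complex.I * w * C * q))
    (h2 : Complex.I * w * C = q * (u + 2 * Complex.I * w * A)) {f : 𝓢(ℝ, ℂ)}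
    (hf : ∀ x, ∫ y, gaussianKernel A C D x y * f y = l * f x) (x : ℝ) :
    ∫ y, gaussianKernel A C D x y * (u • position + w • momentum) f y =
      q * l * (u • position + w • momentum) f x := by
  have happ (x : ℝ) : (u • position + w • momentum) f x
      = u * (x * f x) + w * (-Complex.I * deriv f x) := by
    rw [← position_apply, ← momentum_apply]
    rfl
  have hint := integrable_gaussianKernel_mul (A := A) (C := C) hD x f
  have hintx := integrable_gaussianKernel_mul (A := A) (C := C) hD x (position f)
  have hintd := integrable_gaussianKernel_mul (A := A) (C := C) hD x (SchwartzMap.derivCLM ℂ ℂ f)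
  simp only [position_apply] at hintx
  simp only [SchwartzMap.derivCLM_apply] at hintd
  have hder := hasDerivAt_integral_gaussianKernel (A := A) (C := C) hD x f
  have e1 : (fun x => ∫ y, gaussianKernel A C D x y * f y) = fun x => l * f x := funext hf
  rw [e1] at hder
  have hder' := hder.unique ((f.differentiableAt (x := x)).hasDerivAt.const_mul l)
  have hparts := integral_gaussianKernel_mul_deriv (A := A) (C := C) hD x f
  set J := ∫ y, gaussianKernel A C D x y * (y * f y) with hJ
  have i1 : ∫ y, (-(2 * A * x) + C * y) * gaussianKernel A C D x y * f y
      = -(2 * A * x) * (l * f x) + C * J := by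
    rw [← hf, hJ, ← integral_const_mul, ← integral_const_mul,
      ← integral_add (hint.const_mul _) (hintx.const_mul _)]
    congr 1
    funext y
    ring
  have i2 : ∫ y, (C * x - 2 * D * y) * gaussianKernel A C D x y * f y
      = C * x * (l * f x) - 2 * D * J := by
    rw [← hf, hJ, ← integral_const_mul, ← integral_const_mul,
      ← integral_sub (hint.const_mul _) (hintx.const_mul _)]
    congr 1
    funext y
    ring
  have i3 : ∫ y, gaussianKernel A C D x y * (u • position + w • momentum) f y
      = u * J + -(Complex.I * w) * ∫ y, gaussianKernel A C D x y * deriv f y := by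
    rw [hJ, ← integral_const_mul, ← integral_const_mul,
      ← integral_add (hintx.const_mul _) (hintd.const_mul _)]
    congr 1
    funext y
    rw [happ]
    ring
  rw [i1] at hder'
  rw [i3, hparts, i2, happ]
  -- Integration by parts and `hder'` eliminate both derivatives of f. What remains is linear in the
  -- first moment J and in x l f(x): `h1` matches the former coefficient and `h2` the latter.
  linear_combination J * h1 + x * (l * f x) * h2 - q * Complex.I * w * hder'

end GaussianKernel

/-! ## The position kernel of the transformed thermal state -/

section Kernel

variable {m ω : ℝ}

/-- A Schwartz function with logarithmic derivative `-σ x` is a Gaussian. -/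
theorem eq_gaussian_of_deriv {f : 𝓢(ℝ, ℂ)} {σ : ℂ} (hf : ∀ x : ℝ, deriv f x = -(σ * x) * f x)
    (x : ℝ) : f x = f 0 * Complex.exp (-(σ / 2) * (x : ℂ) ^ 2) := by
  have hd (x : ℝ) : HasDerivAt (fun x : ℝ => f x * Complex.exp (σ / 2 * (x : ℂ) ^ 2)) 0 x := by
    have hx : HasDerivAt (fun x : ℝ => (x : ℂ)) 1 x := Complex.ofRealCLM.hasDerivAt
    have h := (f.differentiableAt (x := x)).hasDerivAt.mul ((hx.pow 2).const_mul (σ / 2)).cexp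
    refine h.congr_deriv ?_
    rw [hf]
    push_cast
    ring
  have h := is_const_of_deriv_eq_zero (fun x => (hd x).differentiableAt) (fun x => (hd x).deriv) x 0
  simp only [Complex.ofReal_zero, ne_eq, OfNat.ofNat_ne_zero, not_false_eq_true, zero_pow,
    mul_zero, Complex.exp_zero, mul_one] at h
  rw [← h, mul_assoc, ← Complex.exp_add, neg_mul, add_neg_cancel, Complex.exp_zero, mul_one]

theorem conj_creation {S : schwartzUnitary} {α β γ δ : ℂ} (hS : Implements (op S) α β γ δ) :
    op S * creation m ω * op S⁻¹
      = (((√(m * ω / 2) : ℝ) : ℂ) * α - Complex.I * ((1 / √(2 * m * ω) : ℝ) : ℂ) * γ) • position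
      + (((√(m * ω / 2) : ℝ) : ℂ) * β - Complex.I * ((1 / √(2 * m * ω) : ℝ) : ℂ) * δ)
        • momentum := by
  rw [creation, mul_sub, sub_mul, mul_smul_comm, mul_smul_comm, smul_mul_assoc, smul_mul_assoc,
    hS.conj_position, hS.conj_momentum]
  module

theorem conj_annihilation {S : schwartzUnitary} {α β γ δ : ℂ} (hS : Implements (op S) α β γ δ) :
    op S * annihilation m ω * op S⁻¹
      = (((√(m * ω / 2) : ℝ) : ℂ) * α + Complex.I * ((1 / √(2 * m * ω) : ℝ) : ℂ) * γ) • position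
      + (((√(m * ω / 2) : ℝ) : ℂ) * β + Complex.I * ((1 / √(2 * m * ω) : ℝ) : ℂ) * δ)
        • momentum := by
  rw [annihilation, mul_add, add_mul, mul_smul_comm, mul_smul_comm, smul_mul_assoc,
    smul_mul_assoc, hS.conj_position, hS.conj_momentum]
  module

/-- The ladder operators of a transformed oscillator in terms of the covariances `b` and `c`. -/
theorem ladder_covariance (hm : 0 < m) (hω : 0 < ω) {α β γ δ Ξ b c : ℝ}
    (hdet : α * δ - β * γ = 1) (hb : b = Ξ / 2 * (δ ^ 2 / (m * ω) + β ^ 2 * (m * ω)))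
    (hc : c = -(Ξ / 2) * (δ * γ / (m * ω) + α * β * (m * ω))) (hb0 : 0 < b)
    {s r : ℂ} (hs : s = ((√(m * ω / 2) : ℝ) : ℂ)) (hr : r = ((1 / √(2 * m * ω) : ℝ) : ℂ)) :
    (b * (s * α - Complex.I * r * γ) =
      Complex.I * (s * β - Complex.I * r * δ) * (Ξ / 2 + Complex.I * c)) ∧
    (b * (s * α + Complex.I * r * γ) =
      -(Complex.I * (s * β + Complex.I * r * δ) * (Ξ / 2 - Complex.I * c))) ∧
    s * β + Complex.I * r * δ ≠ 0 := by
  obtain ⟨hss, hrr, hsr⟩ := sqrt_relations hm hω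
  rw [← hs, ← hr] at *
  have hb' : (b : ℂ) = Ξ * (r * r * δ ^ 2 + s * s * β ^ 2) := by
    rw [hrr, hss, hb]
    push_cast
    ring
  have hc' : (c : ℂ) = -Ξ * (r * r * (δ * γ) + s * s * (α * β)) := by
    rw [hrr, hss, hc]
    push_cast
    ring
  have hdet' : (α : ℂ) * δ - β * γ = 1 := by exact_mod_cast hdet
  -- Since sr = 1/2 and the determinant is one, Ξ/2 can be written homogeneously in the matrix
  -- entries; both identities then hold as polynomials modulo I² = -1.
  have hΞ : (Ξ : ℂ) / 2 = Ξ * (s * r) * (α * δ - β * γ) := by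
    rw [hsr, hdet']
    ring
  refine ⟨?_, ?_, fun h0 => ?_⟩
  · rw [hΞ, hb', hc']
    linear_combination (Ξ * (s * β - Complex.I * r * δ) * (r * r * (δ * γ) + s * s * (α * β))
      + Ξ * s * r ^ 2 * δ * (α * δ - β * γ)) * Complex.I_mul_I
  · rw [hΞ, hb', hc']
    linear_combination (Ξ * r * δ * s ^ 2 * β * α * Complex.I + Ξ * r ^ 2 * δ ^ 2 * s * α
      + Ξ * r ^ 3 * δ ^ 2 * Complex.I * γ + Ξ * s ^ 3 * β ^ 2 * α) * Complex.I_mul_I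
  -- Here b = Ξ(sβ + irδ)(sβ - irδ), so a vanishing factor would contradict b > 0.
  · have : (b : ℂ) = 0 := by
      rw [hb']
      linear_combination (Ξ * (s * β - Complex.I * r * δ)) * h0 + Ξ * (r * δ) ^ 2 * Complex.I_mul_I
    exact hb0.ne' (by exact_mod_cast this)

/-- The action of the Gaussian kernel on the transformed ground state. -/
theorem integral_gaussianKernel_gaussian {Ξ b c : ℝ} (hΞ : 1 < Ξ) (hb : 0 < b) (z : ℂ) (x : ℝ) :
    ∫ y : ℝ, gaussianKernel ((Ξ ^ 2 / 4 + 1 / 4 - Complex.I * c) / (2 * b)) ((Ξ ^ 2 - 1) / (4 * b))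
        ((Ξ ^ 2 / 4 + 1 / 4 + Complex.I * c) / (2 * b)) x y *
        (z * Complex.exp (-((Ξ / 2 - Complex.I * c) / b / 2) * (y : ℂ) ^ 2)) =
      ((2 / (Ξ + 1) * √(2 * Real.pi * b) : ℝ) : ℂ) *
        (z * Complex.exp (-((Ξ / 2 - Complex.I * c) / b / 2) * (x : ℂ) ^ 2)) := by
  have hb' : (b : ℂ) ≠ 0 := by exact_mod_cast hb.ne'
  have hΞ' : (Ξ : ℂ) + 1 ≠ 0 := by exact_mod_cast (by linarith : Ξ + 1 ≠ 0)
  -- In the coefficient of y² the two terms ±ic cancel, and Ξ²/4 + 1/4 + Ξ/2 is a perfect square;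
  -- the quadratic coefficient is therefore real.
  have hτ : 0 < (Ξ + 1) ^ 2 / (8 * b) := by positivity
  have h := integral_cexp_quadratic (b := ((-((Ξ + 1) ^ 2 / (8 * b)) : ℝ) : ℂ))
    (by rw [Complex.ofReal_re]; linarith) ((Ξ ^ 2 - 1) / (4 * b) * x)
    (-((Ξ ^ 2 / 4 + 1 / 4 - Complex.I * c) / (2 * b) * (x : ℂ) ^ 2))
  have e1 (y : ℝ) : gaussianKernel ((Ξ ^ 2 / 4 + 1 / 4 - Complex.I * c) / (2 * b))
      ((Ξ ^ 2 - 1) / (4 * b)) ((Ξ ^ 2 / 4 + 1 / 4 + Complex.I * c) / (2 * b)) x y *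
        (z * Complex.exp (-((Ξ / 2 - Complex.I * c) / b / 2) * (y : ℂ) ^ 2)) =
      z * Complex.exp (((-((Ξ + 1) ^ 2 / (8 * b)) : ℝ) : ℂ) * (y : ℂ) ^ 2
        + (Ξ ^ 2 - 1) / (4 * b) * x * y
        + -((Ξ ^ 2 / 4 + 1 / 4 - Complex.I * c) / (2 * b) * (x : ℂ) ^ 2)) := by
    rw [gaussianKernel, mul_left_comm, ← Complex.exp_add]
    congr 2
    push_cast
    field_simp
    ring
  have e2 : ((Real.pi : ℂ) / -((-((Ξ + 1) ^ 2 / (8 * b)) : ℝ) : ℂ)) ^ (1 / 2 : ℂ)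
      = ((2 / (Ξ + 1) * √(2 * Real.pi * b) : ℝ) : ℂ) := by
    have h1 : 2 / (Ξ + 1) * √(2 * Real.pi * b)
        = (Real.pi / ((Ξ + 1) ^ 2 / (8 * b))) ^ (1 / 2 : ℝ) := by
      rw [← Real.sqrt_eq_rpow]
      symm
      rw [Real.sqrt_eq_iff_mul_self_eq (by positivity) (by positivity), mul_mul_mul_comm,
        Real.mul_self_sqrt (by positivity)]
      field_simp
      ring
    rw [h1, Complex.ofReal_cpow (by positivity)]
    push_cast
    congr 1
    ring
  simp_rw [e1]
  rw [integral_const_mul, h, e2, mul_left_comm]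
  congr 3
  push_cast
  field_simp
  ring

theorem re_gaussianKernel_pos {Ξ b c : ℝ} (hb : 0 < b) :
    0 < ((Ξ ^ 2 / 4 + 1 / 4 + Complex.I * c) / (2 * b) : ℂ).re := by
  have : ((Ξ ^ 2 / 4 + 1 / 4 + Complex.I * c) / (2 * b) : ℂ)
      = (((Ξ ^ 2 / 4 + 1 / 4) / (2 * b) : ℝ) : ℂ) + Complex.I * ((c / (2 * b) : ℝ) : ℂ) := by
    push_cast
    ring
  rw [this, Complex.add_re, Complex.ofReal_re, Complex.I_mul_re, Complex.ofReal_im, neg_zero,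
    add_zero]
  positivity

/-- These are the two hypotheses of `integral_gaussianKernel_ladder` with q = (Ξ - 1)/(Ξ + 1). The
assumption on u and w is the one that `ladder_covariance` provides for the transformed creation
operator. -/
theorem gaussianKernel_ladder_relations {Ξ b c : ℝ} (hΞ : 1 < Ξ) (hb : 0 < b) {u w : ℂ}
    (h : b * u = Complex.I * w * (Ξ / 2 + Complex.I * c)) :
    u - 2 * Complex.I * w * ((Ξ ^ 2 / 4 + 1 / 4 + Complex.I * c) / (2 * b))
      = -(Complex.I * w * ((Ξ ^ 2 - 1) / (4 * b)) * ((Ξ - 1) / (Ξ + 1))) ∧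
    Complex.I * w * ((Ξ ^ 2 - 1) / (4 * b)) = (Ξ - 1) / (Ξ + 1) *
      (u + 2 * Complex.I * w * ((Ξ ^ 2 / 4 + 1 / 4 - Complex.I * c) / (2 * b))) := by
  have hb' : (b : ℂ) ≠ 0 := by exact_mod_cast hb.ne'
  have hΞ' : (Ξ : ℂ) + 1 ≠ 0 := by exact_mod_cast (by linarith : Ξ + 1 ≠ 0)
  have hu : u = Complex.I * w * (Ξ / 2 + Complex.I * c) / b := by
    rw [← h, mul_div_cancel_left₀ _ hb']
  rw [hu]
  constructor
  · field_simp
    ring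
  · field_simp
    ring

/-- The transformed annihilation operator kills S h_0, a first-order equation that makes S h_0 a
Gaussian and settles n = 0. Each application of the transformed creation operator then multiplies
the eigenvalue by (Ξ - 1)/(Ξ + 1). -/
theorem integral_gaussianKernel_hermite (hm : 0 < m) (hω : 0 < ω) {S : schwartzUnitary}
    {α β γ δ Ξ b c : ℝ} (hS : Implements (op S) α β γ δ) (hdet : α * δ - β * γ = 1)
    (hb : b = Ξ / 2 * (δ ^ 2 / (m * ω) + β ^ 2 * (m * ω)))
    (hc : c = -(Ξ / 2) * (δ * γ / (m * ω) + α * β * (m * ω))) (hΞ : 1 < Ξ) (hb0 : 0 < b)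
    (n : ℕ) (x : ℝ) :
    ∫ y : ℝ, gaussianKernel ((Ξ ^ 2 / 4 + 1 / 4 - Complex.I * c) / (2 * b)) ((Ξ ^ 2 - 1) / (4 * b))
        ((Ξ ^ 2 / 4 + 1 / 4 + Complex.I * c) / (2 * b)) x y * op S (hermite m ω n) y =
      (((Ξ - 1) / (Ξ + 1)) ^ n * (2 / (Ξ + 1) * √(2 * Real.pi * b)) : ℝ) *
        op S (hermite m ω n) x := by
  obtain ⟨hcr, han, hw⟩ := ladder_covariance hm hω hdet hb hc hb0 rfl rfl
  have hb' : (b : ℂ) ≠ 0 := by exact_mod_cast hb0.ne'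
  have hΞ' : (Ξ : ℂ) + 1 ≠ 0 := by exact_mod_cast (by linarith : Ξ + 1 ≠ 0)
  have hD := re_gaussianKernel_pos (Ξ := Ξ) (c := c) hb0
  induction n generalizing x with
  | zero =>
    have hd (x : ℝ) : deriv (op S (hermite m ω 0)) x
        = -((Ξ / 2 - Complex.I * c) / b * x) * op S (hermite m ω 0) x := by
      have h0 : (op S * annihilation m ω * op S⁻¹) (op S (hermite m ω 0)) x = 0 := by
        change op S (annihilation m ω (op S⁻¹ (op S (hermite m ω 0)))) x = 0
        rw [op_inv_op, annihilation_hermite_zero hm hω, map_zero]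
        rfl
      rw [conj_annihilation hS] at h0
      change _ * position (op S (hermite m ω 0)) x + _ * momentum (op S (hermite m ω 0)) x = 0 at h0
      rw [position_apply, momentum_apply] at h0
      -- The differential equation is solved for the derivative by dividing by the momentum
      -- coefficient, nonzero by `ladder_covariance`.
      refine mul_left_cancel₀ (mul_ne_zero (mul_ne_zero Complex.I_ne_zero hw) hb') ?_
      have e : (b : ℂ) * ((Ξ / 2 - Complex.I * c) / b * x) = (Ξ / 2 - Complex.I * c) * x := by
        field_simp
      linear_combination -b * h0 + x * op S (hermite m ω 0) x * han + Complex.I *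
        (((√(m * ω / 2) : ℝ) : ℂ) * β + Complex.I * ((1 / √(2 * m * ω) : ℝ) : ℂ) * δ) *
        op S (hermite m ω 0) x * e
    have hg := eq_gaussian_of_deriv hd
    rw [pow_zero, one_mul, hg x, ← integral_gaussianKernel_gaussian hΞ hb0]
    congr 1
    funext y
    rw [← hg y]
  | succ n ih =>
    obtain ⟨h1, h2⟩ := gaussianKernel_ladder_relations hΞ hb0 hcr
    have h := integral_gaussianKernel_ladder hD h1 h2 ih x
    rw [← conj_creation hS] at h
    have e : (op S * creation m ω * op S⁻¹) (op S (hermite m ω n))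
        = ((√(n + 1) : ℝ) : ℂ) • op S (hermite m ω (n + 1)) := by
      change op S (creation m ω (op S⁻¹ (op S (hermite m ω n)))) = _
      rw [op_inv_op, creation_hermite, map_smul]
    have hn : ((√(n + 1) : ℝ) : ℂ) ≠ 0 := by
      exact_mod_cast (Real.sqrt_pos.2 (by positivity : (0 : ℝ) < n + 1)).ne'
    rw [e] at h
    simp only [smul_apply, smul_eq_mul, mul_left_comm _ ((√(n + 1) : ℝ) : ℂ)] at h
    rw [integral_const_mul] at h
    rw [mul_left_cancel₀ hn h]
    push_cast
    ring

/-- These identities match the spectrum of the kernel with that of the state: the ratio of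
successive eigenvalues is e^{-ϑ}, and the lowest one is 2 sinh(ϑ/2) e^{-ϑ/2}. -/
theorem thermal_relations {ϑ : ℝ} (hϑ : 0 < ϑ) : 1 < coth (ϑ / 2) ∧
    (coth (ϑ / 2) - 1) / (coth (ϑ / 2) + 1) = Real.exp (-ϑ) ∧
    2 / (coth (ϑ / 2) + 1) = 2 * Real.sinh (ϑ / 2) * Real.exp (-(ϑ / 2)) := by
  have hs : 0 < Real.sinh (ϑ / 2) := Real.sinh_pos_iff.2 (half_pos hϑ)
  have e1 := Real.cosh_add_sinh (ϑ / 2)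
  have e2 := Real.cosh_sub_sinh (ϑ / 2)
  have h1 : coth (ϑ / 2) + 1 = Real.exp (ϑ / 2) / Real.sinh (ϑ / 2) := by
    rw [coth, ← e1]
    field_simp
  have h2 : coth (ϑ / 2) - 1 = Real.exp (-(ϑ / 2)) / Real.sinh (ϑ / 2) := by
    rw [coth, ← e2]
    field_simp
  have h3 : Real.exp (-ϑ) = Real.exp (-(ϑ / 2)) / Real.exp (ϑ / 2) := by
    rw [← Real.exp_sub]
    congr 1
    ring
  refine ⟨?_, ?_, ?_⟩
  · have : 0 < coth (ϑ / 2) - 1 := by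
      rw [h2]
      positivity
    linarith
  · rw [h1, h2, h3]
    field_simp
  · rw [h1, Real.exp_neg]
    field_simp

/-- The position matrix elements of a transformed thermal state. -/
theorem hasKernel_transformedThermal (hm : 0 < m) (hω : 0 < ω) {S : schwartzUnitary} {ϑ : ℝ}
    (hϑ : 0 < ϑ) {α β γ δ b c : ℝ} (hS : Implements (op S) α β γ δ) (hdet : α * δ - β * γ = 1)
    (hb : b = coth (ϑ / 2) / 2 * (δ ^ 2 / (m * ω) + β ^ 2 * (m * ω)))
    (hc : c = -(coth (ϑ / 2) / 2) * (δ * γ / (m * ω) + α * β * (m * ω)))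
    (hb0 : 0 < b) :
    HasKernel (transformedThermal hm hω S hϑ) (fun x y => ((1 / √(2 * Real.pi * b) : ℝ) : ℂ) *
      gaussianKernel ((coth (ϑ / 2) ^ 2 / 4 + 1 / 4 - Complex.I * c) / (2 * b))
        ((coth (ϑ / 2) ^ 2 - 1) / (4 * b))
        ((coth (ϑ / 2) ^ 2 / 4 + 1 / 4 + Complex.I * c) / (2 * b)) x y) := by
  set Ξ := coth (ϑ / 2) with hΞdef
  obtain ⟨hΞ, hq, hl⟩ := thermal_relations hϑ
  rw [← hΞdef] at hΞ hq hl
  have hD := re_gaussianKernel_pos (Ξ := Ξ) (c := c) hb0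
  refine hasKernel_of_basis (transformedBasis hm hω S)
    (fun x => (memLp_gaussianKernel hD x).const_mul _) fun n => ?_
  rw [transformedBasis_apply, transformedThermal_apply, ← map_smul]
  have hk (x : ℝ) : ∫ y, ((1 / √(2 * Real.pi * b) : ℝ) : ℂ) *
      gaussianKernel ((Ξ ^ 2 / 4 + 1 / 4 - Complex.I * c) / (2 * b)) ((Ξ ^ 2 - 1) / (4 * b))
        ((Ξ ^ 2 / 4 + 1 / 4 + Complex.I * c) / (2 * b)) x y * ket (op S (hermite m ω n)) y =
      ((1 / √(2 * Real.pi * b) : ℝ) : ℂ) *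
        ((((Ξ - 1) / (Ξ + 1)) ^ n * (2 / (Ξ + 1) * √(2 * Real.pi * b)) : ℝ) *
        op S (hermite m ω n) x) := by
    rw [← integral_gaussianKernel_hermite hm hω hS hdet hb hc hΞ hb0, ← integral_const_mul]
    refine integral_congr_ae ?_
    filter_upwards [(op S (hermite m ω n)).coeFn_toLp 2 volume] with y hy
    rw [ket_apply, hy, mul_assoc]
  filter_upwards [(((2 * Real.sinh (ϑ / 2) * Real.exp (-ϑ * (n + 1 / 2)) : ℝ) : ℂ) •
    op S (hermite m ω n)).coeFn_toLp 2 volume] with x hx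
  rw [ket_apply, hx, hk, smul_apply, smul_eq_mul, ← mul_assoc, ← Complex.ofReal_mul]
  congr 2
  have h1 : Real.exp (-ϑ * (n + 1 / 2)) = Real.exp (-ϑ) ^ n * Real.exp (-(ϑ / 2)) := by
    rw [← Real.exp_nat_mul, ← Real.exp_add]
    congr 1
    ring
  have h2 : √(2 * Real.pi * b) ≠ 0 := (Real.sqrt_pos.2 (by positivity)).ne'
  rw [hq, hl, h1]
  field_simp

end Kernel


/-! ## Quadratic operators -/

theorem Implements.conj_quadratic {S : schwartzUnitary} {α β γ δ : ℂ}
    (h : Implements (op S) α β γ δ) (u v w : ℂ) :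
    op S * (u • (position * position) + v • (momentum * momentum)
        + w • anticomm position momentum) * op S⁻¹
      = (u * α ^ 2 + v * γ ^ 2 + 2 * w * α * γ) • (position * position)
        + (u * β ^ 2 + v * δ ^ 2 + 2 * w * β * δ) • (momentum * momentum)
        + (u * α * β + v * γ * δ + w * (α * δ + β * γ)) • anticomm position momentum := by
  simp only [anticomm, mul_add, add_mul (c := op S⁻¹), mul_smul_comm, smul_mul_assoc, smul_add,
    conj_mul, h.conj_position, h.conj_momentum]
  simp only [add_mul, smul_add, smul_mul_assoc]
  module

variable {m ω : ℝ}

theorem number_eq_quadratic (hm : 0 < m) (hω : 0 < ω) :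
    number m ω = (m * ω / 2 : ℂ) • (position * position)
      + (1 / (2 * (m * ω)) : ℂ) • (momentum * momentum) + (0 : ℂ) • anticomm position momentum := by
  obtain ⟨hs, hr, hsr⟩ := sqrt_relations hm hω
  rw [number, creation, annihilation, ← hs, ← hr]
  generalize ((√(m * ω / 2) : ℝ) : ℂ) = s at *
  generalize ((1 / √(2 * m * ω) : ℝ) : ℂ) = r at *
  simp only [sub_mul, mul_add, smul_mul_smul_comm, position_mul_momentum]
  have hI := Complex.I_mul_I
  match_scalars
  · ring
  · ring
  · linear_combination (s * r) * hI - hsr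
  · linear_combination (-r * r) * hI
  · ring

/-! ## Hyperbolic identities -/

theorem exp_eq_coth {ϑ φ : ℝ} (hϑ : 0 < ϑ) (hφ : Real.exp (2 * φ) = coth (ϑ / 2) ^ 2) :
    Real.exp φ = coth (ϑ / 2) := by
  have h1 := (thermal_relations hϑ).1
  refine (pow_left_inj₀ (Real.exp_pos _).le (by linarith) two_ne_zero).1 ?_
  rw [← hφ, ← Real.exp_nat_mul]
  norm_num

theorem sqrt_coth_sq_sub_one {ϑ : ℝ} (hϑ : 0 < ϑ) :
    √(coth (ϑ / 2) ^ 2 - 1) = 1 / Real.sinh (ϑ / 2) := by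
  have hs : 0 < Real.sinh (ϑ / 2) := Real.sinh_pos_iff.2 (half_pos hϑ)
  have h : coth (ϑ / 2) ^ 2 - 1 = (1 / Real.sinh (ϑ / 2)) ^ 2 := by
    rw [coth, div_pow, Real.cosh_sq]
    field_simp
    ring
  rw [h, Real.sqrt_sq (by positivity)]

/-- With e^φ = Ξ = coth(ϑ/2), coth φ = (Ξ² + 1)/(Ξ² - 1) = cosh²(ϑ/2) + sinh²(ϑ/2) = cosh ϑ. -/
theorem arcosh_coth {ϑ φ : ℝ} (hϑ : 0 < ϑ) (hφ : Real.exp (2 * φ) = coth (ϑ / 2) ^ 2) :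
    Real.arcosh (coth φ) = ϑ := by
  have hs : 0 < Real.sinh (ϑ / 2) := Real.sinh_pos_iff.2 (half_pos hϑ)
  have h1 := (thermal_relations hϑ).1
  have h2 := exp_eq_coth hϑ hφ
  have h3 : coth φ = (coth (ϑ / 2) ^ 2 + 1) / (coth (ϑ / 2) ^ 2 - 1) := by
    rw [coth, Real.cosh_eq, Real.sinh_eq, Real.exp_neg, h2]
    have : coth (ϑ / 2) ^ 2 - 1 ≠ 0 := by nlinarith
    have : coth (ϑ / 2) ≠ 0 := by linarith
    field_simp
  have h4 : coth φ = Real.cosh ϑ := by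
    have e : Real.cosh ϑ = Real.cosh (ϑ / 2) ^ 2 + Real.sinh (ϑ / 2) ^ 2 := by
      rw [← Real.cosh_two_mul, mul_div_cancel₀ _ two_ne_zero]
    have e1 : coth (ϑ / 2) ^ 2 - 1 = 1 / Real.sinh (ϑ / 2) ^ 2 := by
      rw [coth, div_pow, Real.cosh_sq]
      field_simp
      ring
    rw [h3, e, e1, coth]
    field_simp
  rw [h4, Real.arcosh_cosh hϑ.le]

/-! ## Assembling the squeezed thermal state -/

theorem re_neg_I_mul_nonpos (θ : ℝ) : (-Complex.I * (θ : ℂ)).re ≤ 0 := by simp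

theorem rotation_eq (hm : 0 < m) (hω : 0 < ω) (θ : ℝ) :
    HasExp (rotationExponent m ω θ) ∧
      rotation m ω θ = numberExp hm hω (-Complex.I * θ) (re_neg_I_mul_nonpos θ) := by
  obtain ⟨U, hU, h1⟩ := contractionExp_number hm hω (-Complex.I * θ) (re_neg_I_mul_nonpos θ)
  exact ⟨hU.hasExp, hU.opExp_eq.trans h1⟩

theorem opExp_thermalExponent (hm : 0 < m) (hω : 0 < ω) {ϑ : ℝ} (hϑ : 0 < ϑ) :
    HasExp (thermalExponent m ω ϑ) ∧ opExp (thermalExponent m ω ϑ)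
      = numberExp hm hω (-(ϑ : ℂ)) (re_neg_ofReal_nonpos hϑ) := by
  obtain ⟨U, hU, h1⟩ := contractionExp_number hm hω (-(ϑ : ℂ)) (re_neg_ofReal_nonpos hϑ)
  exact ⟨hU.hasExp, hU.opExp_eq.trans h1⟩

/-- All three factors are diagonal in the Hermite basis, and the phases of the rotation and its
adjoint cancel. This is why θ disappears from the state. -/
theorem numberExp_conj_rotation (hm : 0 < m) (hω : 0 < ω) (θ : ℝ) {z : ℂ} (hz : z.re ≤ 0) :
    rotation m ω θ * numberExp hm hω z hz * ContinuousLinearMap.adjoint (rotation m ω θ)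
      = numberExp hm hω z hz := by
  have hw : (Complex.I * θ).re ≤ 0 := by simp
  have hzw : Complex.I * θ = (starRingEnd ℂ) (-Complex.I * θ) := by simp
  rw [(rotation_eq hm hω θ).2, adjoint_numberExp hm hω (re_neg_I_mul_nonpos θ) hw hzw]
  refine ContinuousLinearMap.ext fun f => eq_of_inner_basis (e := hermiteBasis hm hω) fun n => ?_
  rw [ContinuousLinearMap.mul_def, ContinuousLinearMap.mul_def, ContinuousLinearMap.comp_apply,
    ContinuousLinearMap.comp_apply]
  rw [inner_numberExp, inner_numberExp, inner_numberExp, inner_numberExp, mul_left_comm,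
    ← mul_assoc (Complex.exp _) (Complex.exp _) (inner ℂ _ f), ← Complex.exp_add, neg_mul, neg_mul,
    neg_add_cancel, Complex.exp_zero, one_mul]

theorem squeezedThermalState_eq (hm : 0 < m) (hω : 0 < ω) (θ : ℝ) {ϑ : ℝ} (hϑ : 0 < ϑ) {ζ : ℂ}
    {S : schwartzUnitary} (hS : squeeze m ω ζ = (lift S : StateSpace →L[ℂ] StateSpace)) :
    squeezedThermalState m ω ζ θ ϑ = transformedThermal hm hω S hϑ := by
  have hZ : (partitionFunction m ω ϑ)⁻¹ = ((2 * Real.sinh (ϑ / 2) : ℝ) : ℂ) := by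
    rw [partitionFunction, (opExp_thermalExponent hm hω hϑ).2,
      (hasTrace_numberExp hm hω hϑ).opTrace_eq (hermiteBasis hm hω), ← Complex.ofReal_inv,
      one_div, inv_inv]
  rw [squeezedThermalState, thermalState, hZ, (opExp_thermalExponent hm hω hϑ).2, hS,
    adjoint_lift, mul_smul_comm, smul_mul_assoc, smul_mul_assoc,
    mul_assoc (lift S : StateSpace →L[ℂ] StateSpace),
    mul_assoc (lift S : StateSpace →L[ℂ] StateSpace), numberExp_conj_rotation, transformedThermal,
    conj]

/-- The exponent is transported by S, whereas the covariances are computed with S⁻¹. Inverting a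
matrix of determinant one swaps its diagonal entries and negates the others, so a = ⟨p²⟩ becomes the
coefficient of χ², b that of p², and c changes sign. -/
theorem gaussianExponent_eq (hm : 0 < m) (hω : 0 < ω) {ϑ φ : ℝ} (hϑ : 0 < ϑ)
    (hφ : Real.exp (2 * φ) = coth (ϑ / 2) ^ 2) {S : schwartzUnitary} {α β γ δ a b c : ℝ}
    (hS : Implements (op S) α β γ δ)
    (ha : a = coth (ϑ / 2) / 2 * (γ ^ 2 / (m * ω) + α ^ 2 * (m * ω)))
    (hb : b = coth (ϑ / 2) / 2 * (δ ^ 2 / (m * ω) + β ^ 2 * (m * ω)))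
    (hc : c = -(coth (ϑ / 2) / 2) * (δ * γ / (m * ω) + α * β * (m * ω))) :
    gaussianExponent a b c φ = op S * ((-(ϑ : ℂ)) • number m ω) * op S⁻¹ := by
  have hΞ : (coth (ϑ / 2) : ℂ) ≠ 0 := by
    have := (thermal_relations hϑ).1
    exact_mod_cast (by linarith : coth (ϑ / 2) ≠ 0)
  have hm' : (m : ℂ) ≠ 0 := by exact_mod_cast hm.ne'
  have hω' : (ω : ℂ) ≠ 0 := by exact_mod_cast hω.ne'
  rw [gaussianExponent, quadraticOp, arcosh_coth hϑ hφ, Real.exp_neg, exp_eq_coth hϑ hφ,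
    mul_smul_comm, smul_mul_assoc, number_eq_quadratic hm hω, hS.conj_quadratic, ha, hb, hc,
    pow_two position, pow_two momentum]
  push_cast
  generalize (coth (ϑ / 2) : ℂ) = Ξ at *
  match_scalars <;> field_simp <;> ring

/-- Lagrange's identity for the vectors (γ/√κ, α√κ) and (δ/√κ, β√κ) when κ > 0: their Gram
determinant is the square of αδ - βγ. -/
theorem covariance_det {κ : ℝ} (hκ : κ ≠ 0) (Ξ α β γ δ : ℝ) :
    4 * (Ξ / 2 * (γ ^ 2 / κ + α ^ 2 * κ) * (Ξ / 2 * (δ ^ 2 / κ + β ^ 2 * κ))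
      - (-(Ξ / 2) * (δ * γ / κ + α * β * κ)) ^ 2) = Ξ ^ 2 * (α * δ - β * γ) ^ 2 := by
  field_simp
  ring

/-- The covariances of a transformed thermal state. -/
theorem hasExpectation_covariance (hm : 0 < m) (hω : 0 < ω) {ϑ : ℝ} (hϑ : 0 < ϑ)
    {S : schwartzUnitary} {α β γ δ : ℝ} (hS : Implements (op S) α β γ δ)
    (hdet : α * δ - β * γ = 1) :
    HasExpectation (transformedThermal hm hω S hϑ) (momentum ^ 2)
      ((coth (ϑ / 2) / 2 * (γ ^ 2 / (m * ω) + α ^ 2 * (m * ω)) : ℝ) : ℂ) ∧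
    HasExpectation (transformedThermal hm hω S hϑ) (position ^ 2)
      ((coth (ϑ / 2) / 2 * (δ ^ 2 / (m * ω) + β ^ 2 * (m * ω)) : ℝ) : ℂ) ∧
    HasExpectation (transformedThermal hm hω S hϑ) ((1 / 2 : ℂ) • anticomm position momentum)
      ((-(coth (ϑ / 2) / 2) * (δ * γ / (m * ω) + α * β * (m * ω)) : ℝ) : ℂ) := by
  -- The roles of S and S⁻¹ are exchanged, so that `conj_quadratic` computes S⁻¹BS from the inverse
  -- matrix.
  have key (u v w : ℂ) := (hS.inv (by exact_mod_cast hdet)).conj_quadratic u v w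
  rw [inv_inv] at key
  have key' (u v w : ℂ) := hasExpectation_transformedThermal hm hω S hϑ (key u v w)
  refine ⟨?_, ?_, ?_⟩
  · have h := key' 0 1 0
    rw [zero_smul, zero_smul, zero_add, add_zero, one_smul, ← pow_two] at h
    refine Eq.mp (congrArg _ ?_) h
    push_cast
    ring
  · have h := key' 1 0 0
    rw [zero_smul, zero_smul, add_zero, add_zero, one_smul, ← pow_two] at h
    refine Eq.mp (congrArg _ ?_) h
    push_cast
    ring
  · have h := key' 0 0 (1 / 2)
    rw [zero_smul, zero_smul, add_zero, zero_add] at h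
    refine Eq.mp (congrArg _ ?_) h
    push_cast
    ring

/-- The two forms of the position kernel. -/
theorem gaussianKernel_eq {Ξ a b c : ℝ} (hb : 0 < b) (h : Ξ ^ 2 = 4 * (a * b - c ^ 2)) (x y : ℝ) :
    gaussianKernel ((Ξ ^ 2 / 4 + 1 / 4 - Complex.I * c) / (2 * b)) ((Ξ ^ 2 - 1) / (4 * b))
      ((Ξ ^ 2 / 4 + 1 / 4 + Complex.I * c) / (2 * b)) x y = Complex.exp (
      -((a * b - (c + Complex.I / 2) ^ 2) / (2 * b) * (x : ℂ) ^ 2)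
        + (a * b - c ^ 2 - 1 / 4) / b * x * y
        - (a * b - (c - Complex.I / 2) ^ 2) / (2 * b) * (y : ℂ) ^ 2) ∧
    gaussianKernel ((Ξ ^ 2 / 4 + 1 / 4 - Complex.I * c) / (2 * b)) ((Ξ ^ 2 - 1) / (4 * b))
      ((Ξ ^ 2 / 4 + 1 / 4 + Complex.I * c) / (2 * b)) x y = Complex.exp (
        -((((x + y) / 2 : ℝ) : ℂ) ^ 2 / (2 * b))
          + Complex.I * (c / b) * ((x + y) / 2 : ℝ) * (x - y : ℝ)
          - (a * b - c ^ 2) / (2 * b) * ((x - y : ℝ) : ℂ) ^ 2) := by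
  have hb' : (b : ℂ) ≠ 0 := by exact_mod_cast hb.ne'
  have h' : (Ξ : ℂ) ^ 2 = 4 * (a * b - c ^ 2) := by exact_mod_cast h
  rw [gaussianKernel, h']
  constructor
  · congr 1
    field_simp
    ring_nf
    rw [Complex.I_sq]
    ring
  · congr 1
    push_cast
    field_simp
    ring

end SqueezedThermal
end

/-! ### The main theorem -/

open SqueezedThermal in
theorem mainTheorem2 (m ω η ψ θ ϑ a b c φ : ℝ)
    (hm : 0 < m) (hω : 0 < ω) (hη : 0 ≤ η) (hϑ : 0 < ϑ)
    (ha : a = m * ω / 2 * coth (ϑ / 2) *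
      (Real.cosh (2 * η) + Real.sinh (2 * η) * Real.cos ψ))
    (hb : b = 1 / (2 * m * ω) * coth (ϑ / 2) *
      (Real.cosh (2 * η) - Real.sinh (2 * η) * Real.cos ψ))
    (hc : c = -(coth (ϑ / 2) / 2) * Real.sinh (2 * η) * Real.sin ψ)
    (hφ : Real.exp (2 * φ) = coth (ϑ / 2) ^ 2)
    (ζ : ℂ) (hζ : ζ = (η : ℂ) * Complex.exp (Complex.I * (ψ : ℂ)))
    (ρ : StateSpace →L[ℂ] StateSpace) (hρ : ρ = squeezedThermalState m ω ζ θ ϑ) :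
    -- all the exponentials exist, and the thermal exponential has the stated trace
    HasExp (squeezeExponent m ω ζ) ∧ HasExp (rotationExponent m ω θ) ∧
    HasExp (thermalExponent m ω ϑ) ∧ HasExp (gaussianExponent a b c φ) ∧
    HasTrace (opExp (thermalExponent m ω ϑ)) ((√(Real.exp (2 * φ) - 1) / 2 : ℝ) : ℂ) ∧
    -- `a`, `b`, `c` are the covariance matrix elements of the state
    HasExpectation ρ (momentum ^ 2) (a : ℂ) ∧
    HasExpectation ρ (position ^ 2) (b : ℂ) ∧
    HasExpectation ρ ((1 / 2 : ℂ) • anticomm position momentum) (c : ℂ) ∧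
    Real.exp (2 * φ) = 4 * (a * b - c ^ 2) ∧
    -- operator form
    ρ = ((2 / √(Real.exp (2 * φ) - 1) : ℝ) : ℂ) • opExp (gaussianExponent a b c φ) ∧
    -- position matrix elements
    HasKernel ρ (fun x x' => ((1 / √(2 * Real.pi * b) : ℝ) : ℂ) * Complex.exp (
      -((a * b - (c + Complex.I / 2) ^ 2) / (2 * b) * (x : ℂ) ^ 2)
        + (a * b - c ^ 2 - 1 / 4) / b * x * x'
        - (a * b - (c - Complex.I / 2) ^ 2) / (2 * b) * (x' : ℂ) ^ 2)) ∧
    -- the same in terms of the centre and relative coordinates `s` and `d`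
    HasKernel ρ (fun x x' =>
      let s : ℝ := (x + x') / 2
      let d : ℝ := x - x'
      ((1 / √(2 * Real.pi * b) : ℝ) : ℂ) * Complex.exp (
        -((s : ℂ) ^ 2 / (2 * b)) + Complex.I * (c / b) * s * d
          - (a * b - c ^ 2) / (2 * b) * (d : ℂ) ^ 2)) := by
  have hκ := mul_pos hm hω
  obtain ⟨S, U, hU, hU1, hS⟩ := exists_squeeze hm hω η ψ
  rw [← hζ] at hU
  have hΞ := (thermal_relations hϑ).1
  set α := Real.cosh η + Real.cos ψ * Real.sinh η with hα
  set β := Real.sin ψ * Real.sinh η / (m * ω) with hβ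
  set γ := m * ω * Real.sin ψ * Real.sinh η with hγ
  set δ := Real.cosh η - Real.cos ψ * Real.sinh η with hδ
  have hch := Real.cosh_sq η
  have hsc := Real.sin_sq_add_cos_sq ψ
  have hβγ : β * γ = Real.sin ψ ^ 2 * Real.sinh η ^ 2 := by
    rw [hβ, hγ]
    field_simp
  have hdet : α * δ - β * γ = 1 := by
    rw [hβγ, hα, hδ]
    linear_combination hch - Real.sinh η ^ 2 * hsc
  have ha' : a = coth (ϑ / 2) / 2 * (γ ^ 2 / (m * ω) + α ^ 2 * (m * ω)) := by
    rw [ha, hα, hγ, Real.cosh_two_mul, Real.sinh_two_mul]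
    field_simp
    linear_combination (-Real.sinh η ^ 2) * hsc
  have hb' : b = coth (ϑ / 2) / 2 * (δ ^ 2 / (m * ω) + β ^ 2 * (m * ω)) := by
    rw [hb, hδ, hβ, Real.cosh_two_mul, Real.sinh_two_mul]
    field_simp
    linear_combination (-Real.sinh η ^ 2) * hsc
  have hc' : c = -(coth (ϑ / 2) / 2) * (δ * γ / (m * ω) + α * β * (m * ω)) := by
    rw [hc, hα, hβ, hγ, hδ, Real.sinh_two_mul]
    field_simp
    ring
  have habc : coth (ϑ / 2) ^ 2 = 4 * (a * b - c ^ 2) := by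
    rw [ha', hb', hc', covariance_det hκ.ne', hdet, one_pow, mul_one]
  -- If b were not positive, both squares would vanish, so δ = β = 0, contradicting determinant one.
  have hb0 : 0 < b := by
    have h1 : 0 < δ ^ 2 / (m * ω) + β ^ 2 * (m * ω) := by
      by_contra! h
      have h2 : δ ^ 2 / (m * ω) = 0 := by
        have := (by positivity : 0 ≤ β ^ 2 * (m * ω))
        exact le_antisymm (by linarith) (by positivity)
      have h3 : β ^ 2 * (m * ω) = 0 := by
        exact le_antisymm (by linarith) (by positivity)
      have h4 : δ = 0 := by simpa [hκ.ne', hm.ne', hω.ne'] using h2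
      have h5 : β = 0 := by simpa [hκ.ne', hm.ne', hω.ne'] using h3
      rw [h4, h5] at hdet
      simp at hdet
    rw [hb']
    have : 0 < coth (ϑ / 2) := by linarith
    positivity
  have hsq : squeeze m ω ζ = (lift S : StateSpace →L[ℂ] StateSpace) := hU.opExp_eq.trans hU1
  rw [squeezedThermalState_eq hm hω θ hϑ hsq] at hρ
  obtain ⟨V, hV, hV1⟩ := contractionExp_number hm hω (-(ϑ : ℂ)) (re_neg_ofReal_nonpos hϑ)
  have hG := hV.conj S
  rw [← gaussianExponent_eq hm hω hϑ hφ hS ha' hb' hc'] at hG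
  obtain ⟨hp2, hx2, hxp⟩ := hasExpectation_covariance hm hω hϑ hS hdet
  have hker := hasKernel_transformedThermal hm hω hϑ hS hdet hb' hc' hb0
  rw [← hρ] at hp2 hx2 hxp hker
  have hsqrt := sqrt_coth_sq_sub_one hϑ
  refine ⟨hU.hasExp, (rotation_eq hm hω θ).1, (opExp_thermalExponent hm hω hϑ).1, hG.hasExp, ?_,
    ha' ▸ hp2, hb' ▸ hx2, hc' ▸ hxp, hφ.trans habc, ?_, ?_, ?_⟩
  · have e : √(Real.exp (2 * φ) - 1) / 2 = 1 / (2 * Real.sinh (ϑ / 2)) := by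
      rw [hφ, hsqrt]
      ring
    rw [e, (opExp_thermalExponent hm hω hϑ).2]
    exact hasTrace_numberExp hm hω hϑ
  -- The prefactor 2/√(e^{2φ} - 1) equals 2 sinh(ϑ/2), the inverse of the partition function.
  · rw [hρ, hG.opExp_eq, hV1, hφ, hsqrt, div_div_eq_mul_div, div_one, transformedThermal]
  · simpa only [(gaussianKernel_eq hb0 habc _ _).1] using hker
  · simpa only [(gaussianKernel_eq hb0 habc _ _).2] using hker
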